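/- **Theorem (Rotating a Polyomino).** Consider the grid graph on $\mathbb{Z}^2$, whose nodes are called pixels; each pixel is either empty or occupied by a tile. A *polyomino* is a finite, non-empty set $P\subset\mathbb{Z}^2$ of tiles that is connected in the grid and such that any two tiles $(x_1,y_1),(x_2,y_2)\in P$ with $|x_1-x_2|=|y_1-y_2|=1$ have a common neighbour in $P$. A *robot* is a deterministic finite automaton located at a pixel: in each step it reads whether the current pixel is occupied and, depending on this and on its state, changes its state, leaves the current pixel occupied or empty, and moves one unit up, down, left or right; it terminates when it first reaches a final state. For each of the two rotations $\rho$ of the plane by $90^\circ$ (clockwise and counter-clockwise) there are a robot and a constant $C$ such that for every polyomino $P$ of width $w$ and height $h$ the following holds. If the grid initially contains exactly the tiles of $P$ and the robot starts on an arbitrary tile of $P$, then it terminates, the tiles on the grid at termination form exactly a translate of $\rho(P)$, and 1. the number of steps is at most $C\,(w+h)\,wh$; 2. the number of pixels outside the bounding box of $P$ visited by the robot is at most $C\,(|w-h|\,h+w+h)$; that is, the additional space is $O(|w-h|h)$ if $w\neq h$, and $O(w+h)$ if $w=h$; 3. at every time the number of tiles on the grid exceeds $|P|$ by at most $C\,(w+h)$.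 -/

import Mathlib

namespace TileRobot

/-- A pixel is a node of the infinite square grid `ℤ²`. -/
abbrev Pixel : Type := ℤ × ℤ

/-- The grid graph: two pixels are adjacent when they are at unit distance. -/
def grid : SimpleGraph Pixel where
  Adj p q := |p.1 - q.1| + |p.2 - q.2| = 1
  symm := ⟨fun p q h => by rw [abs_sub_comm q.1, abs_sub_comm q.2]; exact h⟩
  loopless := ⟨fun p h => by simp at h⟩

/-- Two pixels form a diagonal pair when they differ by exactly one in both coordinates. -/
def IsDiagonalPair (p q : Pixel) : Prop := |p.1 - q.1| = 1 ∧ |p.2 - q.2| = 1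

/-- A polyomino: a finite, non-empty, connected set of tiles in which any two tiles that form
a diagonal pair have a common adjacent tile. -/
structure IsPolyomino (P : Finset Pixel) : Prop where
  connected : (grid.induce (P : Set Pixel)).Connected
  diagonal : ∀ p ∈ P, ∀ q ∈ P, IsDiagonalPair p q → ∃ r ∈ P, grid.Adj r p ∧ grid.Adj r q

/-- The `x`-coordinates between the leftmost and the rightmost tile of `P` (inclusive). -/
def columns (P : Finset Pixel) : Set ℤ := {x | ∃ a ∈ P, ∃ b ∈ P, a.1 ≤ x ∧ x ≤ b.1}

/-- The `y`-coordinates between the lowest and the highest tile of `P` (inclusive). -/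
def rows (P : Finset Pixel) : Set ℤ := {y | ∃ a ∈ P, ∃ b ∈ P, a.2 ≤ y ∧ y ≤ b.2}

/-- The number of columns of the smallest enclosing axis-parallel rectangle. -/
noncomputable def width (P : Finset Pixel) : ℕ := (columns P).ncard

/-- The number of rows of the smallest enclosing axis-parallel rectangle. -/
noncomputable def height (P : Finset Pixel) : ℕ := (rows P).ncard

/-- The smallest enclosing axis-parallel rectangle, as a set of pixels. -/
def boundingBox (P : Finset Pixel) : Set Pixel := columns P ×ˢ rows P

/-- The four directions in which the robot can move. -/
inductive Dir where
  | up
  | down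
  | left
  | right

/-- The pixel reached by one step in the given direction. -/
def Dir.move : Dir → Pixel → Pixel
  | .up, p => (p.1, p.2 + 1)
  | .down, p => (p.1, p.2 - 1)
  | .left, p => (p.1 - 1, p.2)
  | .right, p => (p.1 + 1, p.2)

/-- A robot: a deterministic finite automaton. Its transition function maps its state and the
state of the current pixel (`true` means occupied) to its new state, the new state of the
current pixel and the direction of its next move. It terminates on reaching a final state. -/
structure Robot where
  State : Type
  finite : Finite State
  start : State
  final : Set State
  δ : State → Bool → State × Bool × Dir

/-- A configuration: the occupied pixels, the location of the robot and its state. -/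
structure Config (R : Robot) where
  tiles : Finset Pixel
  pos : Pixel
  state : R.State

/-- One look-compute-move step. -/
def Robot.step (R : Robot) (c : Config R) : Config R :=
  let a := R.δ c.state (decide (c.pos ∈ c.tiles))
  { tiles := if a.2.1 then insert c.pos c.tiles else c.tiles.erase c.pos
    pos := a.2.2.move c.pos
    state := a.1 }

/-- The configuration after `n` steps, when the tiles are `P` and the robot is at `s`, in its
start state, at the beginning. -/
def Robot.run (R : Robot) (P : Finset Pixel) (s : Pixel) (n : ℕ) : Config R :=
  R.step^[n] ⟨P, s, R.start⟩

/-- The robot terminates after exactly `n` steps: it is in a final state for the first time. -/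
def Robot.TerminatesAt (R : Robot) (P : Finset Pixel) (s : Pixel) (n : ℕ) : Prop :=
  (R.run P s n).state ∈ R.final ∧ ∀ i < n, (R.run P s i).state ∉ R.final

/-- The pixels at which the robot is located at some time within the first `n` steps. -/
def Robot.visited (R : Robot) (P : Finset Pixel) (s : Pixel) (n : ℕ) : Finset Pixel :=
  (Finset.range (n + 1)).image fun i => (R.run P s i).pos

/-- The number of pixels outside the bounding box of `P` visited within the first `n` steps. -/
noncomputable def Robot.additionalSpace (R : Robot) (P : Finset Pixel) (s : Pixel) (n : ℕ) : ℕ :=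
  ((R.visited P s n : Set Pixel) \ boundingBox P).ncard

/-- The maximum number of tiles on the grid within the first `n` steps, minus the number of
tiles of `P`. The subtraction does not truncate, since time `0` counts. -/
def Robot.auxiliaryTiles (R : Robot) (P : Finset Pixel) (s : Pixel) (n : ℕ) : ℕ :=
  ((Finset.range (n + 1)).sup fun i => (R.run P s i).tiles.card) - P.card

/-- Clockwise rotation of the plane by 90 degrees about the origin. -/
def rotateCW (p : Pixel) : Pixel := (p.2, -p.1)

/-- Counter-clockwise rotation of the plane by 90 degrees about the origin. -/
def rotateCCW (p : Pixel) : Pixel := (-p.2, p.1)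

end TileRobot

/-!
# Rotating a polyomino

The robot works in a frame of reference that it turns by multiples of a right angle, so that its
program has to deal with one side of a rectangle only. It grows a rectangle around its start, whose
corners are marked by patterns of four pixels, until no tile is adjacent to the rectangle. Then it
mirrors the polyomino row by row and transposes the result layer by layer; the composition
is the clockwise rotation. The counter-clockwise rotation is achieved by the same program in a
reflected frame of reference.
-/

/-! A clockwise quarter turn is, up to translation, the reflection in a vertical axis followed by
the transposition `(x, y) ↦ (y, x)`. Both can be carried out pixel by pixel by an automaton with
bounded memory, provided that a few auxiliary tiles tell it where it is. The robot carries one or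
two pixel states in its memory and finds the place to write them by walking along empty lanes that
end at walls or single tiles (tokens).

To know where the polyomino ends, the robot circles a rectangle that starts as a single tile. Each
corner is marked by a 2×2 checkerboard. The diagonal condition excludes such a pattern in a
polyomino, so a mark cannot be confused with original tiles, and the robot remembers the states that
it has overwritten. A side is pushed outwards whenever a tile is found next to it. By connectedness,
a rectangle that contains a tile but has none next to its sides is the bounding box (`Nice.closed`,
`rotate_scan`). There are `O(w + h)` rounds of `O(w + h)` steps each.

For the reflection, each row is copied backwards to the row three below, from the bottom row to the
top row; the two rows between are lanes, one for a token at the source and one for a token at the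
target (`mir_rows`). Each of the `w * h` pixels costs `O(w)` steps.

For the transposition, the polyomino is decomposed into L-shaped layers, each consisting of the rest
of a row and of a column that start at a common diagonal pixel. The arms of a layer are exchanged
and written two pixels further down and to the left, again with two lanes between for the tokens
(`layer`, `stage_step`). With `h ≤ w`, possibly after reflecting the frame of reference in the
diagonal, there are `h` layers of length at most `w + 2`, and each exchange costs `O(w)` steps, in
total `O(w ^ 2 * h)`. Only an L-shaped region around the `w × h` and `h × w` rectangles is visited,
whence the term `|w - h| * h` in the space bound (`exists_cover`).

Two devices keep the verification small. Execution commutes with the symmetries of the grid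
(`Cfg.step_map`), so that every claim is made in standard position. And `WS` is a calculus of
preconditions that accounts for steps, visited pixels and tiles at once. -/

namespace TileRobot

open Equiv (Perm)

/-! ### Robot programs -/

instance : DecidableEq Dir := fun a b => by
  cases a <;> cases b <;> first | exact isTrue rfl | exact isFalse (by simp)

instance : Fintype Dir := ⟨{.up, .down, .left, .right}, by intro d; cases d <;> simp⟩

/-- A straight-line robot program with jumps to labels in `Q`. The instruction `act f k` reads the
current pixel `b`, writes and moves according to `f b`, and continues with `k b`; `turn s q`
changes the robot's frame of reference by `s` and jumps to `q`. -/
inductive Code (Q : Type) : Type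
  | halt : Code Q
  | goto (q : Q) : Code Q
  | turn (s : Perm Dir) (q : Q) : Code Q
  | act (f : Bool → Bool × Dir) (k : Bool → Code Q) : Code Q

namespace Code
variable {Q : Type}

/-- Move without changing the current pixel. -/
def mv (d : Dir) (k : Code Q) : Code Q := act (fun b => (b, d)) fun _ => k

/-- Write `v` and move. -/
def put (v : Bool) (d : Dir) (k : Code Q) : Code Q := act (fun _ => (v, d)) fun _ => k

/-- Read the current pixel, leave it unchanged, and move. -/
def get (d : Dir) (k : Bool → Code Q) : Code Q := act (fun b => (b, d)) k

/-- Read the current pixel, write `v`, and move. -/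
def take (v : Bool) (d : Dir) (k : Bool → Code Q) : Code Q := act (fun _ => (v, d)) k

/-- If the current pixel is empty, write `v`, move in direction `d` and jump to `q`; otherwise
write `v'`, move in direction `d'` and continue with `k`. -/
def walk (v : Bool) (d : Dir) (q : Q) (v' : Bool) (d' : Dir) (k : Code Q) : Code Q :=
  act (fun b => if b then (v', d') else (v, d)) fun b => if b then k else goto q

/-- The suffixes of a program. -/
def suffixes : Code Q → Set (Code Q)
  | act f k => {act f k} ∪ (suffixes (k true) ∪ suffixes (k false))
  | c => {c}

theorem finite_suffixes (c : Code Q) : c.suffixes.Finite := by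
  induction c with
  | act f k ih => exact (Set.finite_singleton _).union ((ih true).union (ih false))
  | _ => exact Set.finite_singleton _

theorem self_mem_suffixes (c : Code Q) : c ∈ c.suffixes := by
  cases c <;> simp [suffixes]

theorem mem_suffixes_of_act {c : Code Q} {f : Bool → Bool × Dir} {k : Bool → Code Q}
    (h : act f k ∈ c.suffixes) (b : Bool) : k b ∈ c.suffixes := by
  induction c with
  | act f' k' ih =>
    rcases h with h | h | h
    · obtain ⟨rfl, rfl⟩ : f = f' ∧ k = k' := by simpa using h
      cases b
      · exact Or.inr (Or.inr (self_mem_suffixes _))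
      · exact Or.inr (Or.inl (self_mem_suffixes _))
    · exact Or.inr (Or.inl (ih _ h))
    · exact Or.inr (Or.inr (ih _ h))
  | _ => simp [suffixes] at h

end Code

/-! ### Programs as finite automata -/

section Machine
variable {Q : Type} (body : Q → Code Q)

/-- Resolve a jump at the head of a program. -/
def resolve (g : Perm Dir) : Code Q → Perm Dir × Code Q
  | .halt => (g, .halt)
  | .goto q => (g, body q)
  | .turn s q => (g * s, body q)
  | .act f k => (g, .act f k)

/-- The transition function on pairs of a frame and a resolved program. -/
def trans (x : Perm Dir × Code Q) (b : Bool) : (Perm Dir × Code Q) × Bool × Dir :=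
  match x.2 with
  | .act f k => (resolve body x.1 (k b), (f b).1, x.1 (f b).2)
  | _ => (x, b, x.1 .up)

/-- The programs that can occur during an execution. -/
def codes : Set (Code Q) := {.halt} ∪ ⋃ q, (body q).suffixes

theorem body_mem_codes (q : Q) : body q ∈ codes body :=
  Or.inr (Set.mem_iUnion.2 ⟨q, Code.self_mem_suffixes _⟩)

theorem trans_mem_codes {x : Perm Dir × Code Q} (hx : x.2 ∈ codes body) (b : Bool) :
    (trans body x b).1.2 ∈ codes body := by
  obtain ⟨g, c⟩ := x
  cases c with
  | act f k =>
    have hk : k b ∈ codes body := by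
      rcases hx with hx | hx
      · simp at hx
      · obtain ⟨q, hq⟩ := Set.mem_iUnion.1 hx
        exact Or.inr (Set.mem_iUnion.2 ⟨q, Code.mem_suffixes_of_act hq b⟩)
    simp only [trans]
    cases hc : k b with
    | halt => exact Or.inl rfl
    | goto q => exact body_mem_codes body q
    | turn s q => exact body_mem_codes body q
    | act f' k' => rw [hc] at hk; exact hk
  | _ => exact hx

/-- The robot that executes a program, starting in the frame `g` at the label `q`. -/
def toRobot [Finite Q] (g : Perm Dir) (q : Q) : Robot where
  State := {x : Perm Dir × Code Q // x.2 ∈ codes body}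
  finite := by
    -- There are finitely many frames and finitely many suffixes of the finitely many programs; a
    -- state is a pair of these.
    have h : (codes body).Finite :=
      (Set.finite_singleton _).union (Set.finite_iUnion fun q => (body q).finite_suffixes)
    have := h.to_subtype
    refine Finite.of_injective
      (fun x : {x : Perm Dir × Code Q // x.2 ∈ codes body} =>
        ((x.1.1, ⟨x.1.2, x.2⟩) : Perm Dir × codes body)) ?_
    rintro ⟨⟨g, c⟩, h⟩ ⟨⟨g', c'⟩, h'⟩ e
    simpa using e
  start := ⟨(g, body q), body_mem_codes body q⟩
  final := {x | x.1.2 = .halt}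
  δ x b := (⟨(trans body x.1 b).1, trans_mem_codes body x.2 b⟩, (trans body x.1 b).2)

/-- A configuration during the execution of a program. -/
@[ext] structure Cfg (Q : Type) where
  frame : Perm Dir
  code : Code Q
  tiles : Finset Pixel
  pos : Pixel

/-- Write `v` to the pixel `p`. -/
def upd (T : Finset Pixel) (p : Pixel) (v : Bool) : Finset Pixel :=
  if v then insert p T else T.erase p

theorem mem_upd {T : Finset Pixel} {p q : Pixel} {v : Bool} :
    q ∈ upd T p v ↔ (q = p ∧ v = true) ∨ (q ≠ p ∧ q ∈ T) := by
  unfold upd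
  cases v <;> by_cases h : q = p <;> simp [h]

theorem card_upd_le (T : Finset Pixel) (p : Pixel) (v : Bool) :
    (upd T p v).card ≤ T.card + 1 := by
  unfold upd
  cases v
  · exact (Finset.card_erase_le).trans (Nat.le_succ _)
  · exact Finset.card_insert_le _ _

theorem upd_decide (T : Finset Pixel) (p : Pixel) : upd T p (decide (p ∈ T)) = T := by
  ext q
  rw [mem_upd]
  by_cases h : q = p <;> simp [h]

theorem map_upd (E : Perm Pixel) (T : Finset Pixel) (p : Pixel) (v : Bool) :
    (upd T p v).map E.toEmbedding = upd (T.map E.toEmbedding) (E p) v := by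
  ext q
  obtain ⟨r, rfl⟩ := E.surjective q
  simp [mem_upd]

/-- One step of the execution of a program. -/
def Cfg.step (c : Cfg Q) : Cfg Q :=
  let a := trans body (c.frame, c.code) (decide (c.pos ∈ c.tiles))
  { frame := a.1.1
    code := a.1.2
    tiles := upd c.tiles c.pos a.2.1
    pos := a.2.2.move c.pos }

/-- The configuration of a program that belongs to a configuration of its robot. -/
def ofConfig [Finite Q] {g : Perm Dir} {q : Q} (c : Config (toRobot body g q)) : Cfg Q :=
  ⟨c.state.1.1, c.state.1.2, c.tiles, c.pos⟩

theorem ofConfig_step [Finite Q] {g : Perm Dir} {q : Q} (c : Config (toRobot body g q)) :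
    ofConfig body ((toRobot body g q).step c) = (ofConfig body c).step body := by
  rfl

theorem ofConfig_run [Finite Q] (g : Perm Dir) (q : Q) (P : Finset Pixel) (s : Pixel) (n : ℕ) :
    ofConfig body ((toRobot body g q).run P s n) = (Cfg.step body)^[n] ⟨g, body q, P, s⟩ := by
  induction n with
  | zero => rfl
  | succ n ih =>
    rw [Function.iterate_succ_apply', ← ih, ← ofConfig_step]
    simp only [Robot.run, Function.iterate_succ_apply']

/-- From the configuration the robot reaches within `n` steps a configuration that satisfies
`Post`; until then it stays in `V` and there are at most `K` tiles. -/
inductive WP (V : Set Pixel) (K : ℕ) (Post : Cfg Q → Prop) : ℕ → Cfg Q → Prop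
  | done (n : ℕ) (c : Cfg Q) : Post c → WP V K Post n c
  | step (n : ℕ) (c : Cfg Q) : c.code ≠ .halt → c.pos ∈ V → c.tiles.card ≤ K →
      WP V K Post n (c.step body) → WP V K Post (n + 1) c

/-! ### Total correctness with bounds on time, space and tiles -/

variable {body} {V : Set Pixel} {K : ℕ} {Post : Cfg Q → Prop}

theorem WP.mono {n m : ℕ} {c : Cfg Q} (h : WP body V K Post n c) (hnm : n ≤ m) :
    WP body V K Post m c := by
  induction h generalizing m with
  | done n c hc => exact .done _ _ hc
  | step n c h1 h2 h3 _ ih =>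
    obtain ⟨m, rfl⟩ : ∃ m', m = m' + 1 := ⟨m - 1, by omega⟩
    exact .step _ _ h1 h2 h3 (ih (by omega))

theorem WP.post_mono {Post' : Cfg Q → Prop} {n : ℕ} {c : Cfg Q} (h : WP body V K Post n c)
    (hP : ∀ c, Post c → Post' c) : WP body V K Post' n c := by
  induction h with
  | done n c hc => exact .done _ _ (hP _ hc)
  | step n c h1 h2 h3 _ ih => exact .step _ _ h1 h2 h3 ih

/-- Leads back from the calculus to an actual run. The last configuration is not constrained by `V`
and `K`, so the postconditions used later record its position and its tiles themselves. -/
theorem WP.exists_iterate {n : ℕ} {c : Cfg Q} (h : WP body V K Post n c) :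
    ∃ m ≤ n, Post ((Cfg.step body)^[m] c) ∧ ∀ i < m, ((Cfg.step body)^[i] c).code ≠ .halt ∧
      ((Cfg.step body)^[i] c).pos ∈ V ∧ ((Cfg.step body)^[i] c).tiles.card ≤ K := by
  induction h with
  | done n c hc => exact ⟨0, by omega, hc, by simp⟩
  | step n c h1 h2 h3 _ ih =>
    obtain ⟨m, hm, hP, hi⟩ := ih
    refine ⟨m + 1, by omega, by simpa using hP, ?_⟩
    rintro (_ | i) h
    · exact ⟨h1, h2, h3⟩
    · exact hi i (by omega)

/-- A symmetry of the grid, given on directions by `h` and on pixels by `E`. -/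
def IsSymmetry (h : Perm Dir) (E : Perm Pixel) : Prop := ∀ d p, E (d.move p) = (h d).move (E p)

/-- The image of a configuration under a symmetry. -/
def Cfg.map (h : Perm Dir) (E : Perm Pixel) (c : Cfg Q) : Cfg Q :=
  ⟨h * c.frame, c.code, c.tiles.map E.toEmbedding, E c.pos⟩

theorem resolve_mul (h g : Perm Dir) (c : Code Q) :
    resolve body (h * g) c = (h * (resolve body g c).1, (resolve body g c).2) := by
  cases c <;> simp [resolve, mul_assoc]

/-- A symmetry multiplies the frame from the left, whereas `turn` multiplies it from the right, so
the two do not interfere. -/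
theorem Cfg.step_map {h : Perm Dir} {E : Perm Pixel} (hE : IsSymmetry h E) (c : Cfg Q) :
    (c.map h E).step body = (c.step body).map h E := by
  obtain ⟨g, c, T, p⟩ := c
  have hb : decide (E p ∈ T.map E.toEmbedding) = decide (p ∈ T) := by simp
  unfold Cfg.step Cfg.map
  simp only [hb, map_upd, hE _ p]
  cases c with
  | act f k => simp only [trans, resolve_mul, Perm.mul_apply]
  | _ => rfl

theorem WP.map {Post' : Cfg Q → Prop} {V' : Set Pixel} {h : Perm Dir} {E : Perm Pixel}
    (hE : IsSymmetry h E) {n : ℕ} {c : Cfg Q} (hw : WP body V K Post n c)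
    (hV : ∀ p ∈ V, E p ∈ V') (hP : ∀ c, Post c → Post' (c.map h E)) :
    WP body V' K Post' n (c.map h E) := by
  induction hw with
  | done n c hc => exact .done _ _ (hP _ hc)
  | step n c h1 h2 h3 _ ih =>
    refine .step _ _ h1 (hV _ h2) (by simpa [Cfg.map] using h3) ?_
    rw [Cfg.step_map hE]
    exact ih

/-- The configuration in the standard frame in which the program `c` is about to be executed. -/
def cfg (body : Q → Code Q) (c : Code Q) (T : Finset Pixel) (p : Pixel) : Cfg Q :=
  ⟨(resolve body 1 c).1, (resolve body 1 c).2, T, p⟩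

variable (body V K Post) in
/-- `WP`, provided that there is room for `s` more tiles. -/
def WS (s n : ℕ) (c : Cfg Q) : Prop := c.tiles.card + s ≤ K → WP body V K Post n c

/-! ### Proof rules for single instructions and for walks -/

namespace WS
variable {s n : ℕ} {T : Finset Pixel} {x y : ℤ} {k : Code Q} {kb : Bool → Code Q} {v : Bool}

theorem mono {s' n' : ℕ} {c : Cfg Q} (h : WS body V K Post s n c) (hs : s ≤ s') (hn : n ≤ n') :
    WS body V K Post s' n' c :=
  fun hK => (h (by omega)).mono hn

theorem pos_eq {c : Code Q} {p p' : Pixel} (h : WS body V K Post s n (cfg body c T p'))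
    (hp : p.1 = p'.1 ∧ p.2 = p'.2) : WS body V K Post s n (cfg body c T p) := by
  rwa [Prod.ext hp.1 hp.2]

/-- Jumps take no time, but `resolve` follows one jump only; `hq` says that `body q` does not itself
start with a jump or a turn. -/
theorem enter {q : Q} (h : WS body V K Post s n (cfg body (body q) T (x, y)))
    (hq : resolve body 1 (body q) = (1, body q)) :
    WS body V K Post s n (cfg body (.goto q) T (x, y)) := by
  unfold cfg at h ⊢
  rw [hq] at h
  exact h

/-- Every write is charged with room for one tile, whether or not it adds a tile; `act_keep` is the
free variant for instructions that leave the pixel as it is. -/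
theorem act {f : Bool → Bool × Dir} (b : Bool) (hb : (x, y) ∈ T ↔ b = true)
    (h : WS body V K Post s n (cfg body (kb b) (upd T (x, y) (f b).1) ((f b).2.move (x, y))))
    (hV : (x, y) ∈ V) : WS body V K Post (s + 1) (n + 1) (cfg body (.act f kb) T (x, y)) := by
  intro hK
  simp only [cfg] at hK
  have hb' : decide ((x, y) ∈ T) = b := by cases b <;> simp [hb]
  refine .step _ _ (by simp [cfg, resolve]) hV (by simp only [cfg]; omega) ?_
  have e : (cfg body (.act f kb) T (x, y)).step body
      = cfg body (kb b) (upd T (x, y) (f b).1) ((f b).2.move (x, y)) := by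
    subst hb'
    rfl
  rw [e]
  apply h
  have := card_upd_le T (x, y) (f b).1
  simp only [cfg]
  omega

theorem act_keep {f : Bool → Bool × Dir} (b : Bool) (hb : (x, y) ∈ T ↔ b = true)
    (hf : (f b).1 = b)
    (h : WS body V K Post s n (cfg body (kb b) T ((f b).2.move (x, y))))
    (hV : (x, y) ∈ V) : WS body V K Post s (n + 1) (cfg body (.act f kb) T (x, y)) := by
  intro hK
  simp only [cfg] at hK
  have hb' : decide ((x, y) ∈ T) = b := by cases b <;> simp [hb]
  have hu : upd T (x, y) (f b).1 = T := by rw [hf, ← hb', upd_decide]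
  refine .step _ _ (by simp [cfg, resolve]) hV (by simp only [cfg]; omega) ?_
  have e : (cfg body (.act f kb) T (x, y)).step body
      = cfg body (kb b) T ((f b).2.move (x, y)) := by
    conv_rhs => rw [← hu]
    subst hb'
    rfl
  rw [e]
  exact h hK

theorem mvU (h : WS body V K Post s n (cfg body k T (x, y + 1))) (hV : (x, y) ∈ V) :
    WS body V K Post s (n + 1) (cfg body (.mv .up k) T (x, y)) :=
  act_keep (decide ((x, y) ∈ T)) (by simp) rfl h hV

theorem putU (h : WS body V K Post s n (cfg body k (upd T (x, y) v) (x, y + 1)))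
    (hV : (x, y) ∈ V) : WS body V K Post (s + 1) (n + 1) (cfg body (.put v .up k) T (x, y)) :=
  act (decide ((x, y) ∈ T)) (by simp) h hV

theorem getU (b : Bool) (hb : (x, y) ∈ T ↔ b = true)
    (h : WS body V K Post s n (cfg body (kb b) T (x, y + 1))) (hV : (x, y) ∈ V) :
    WS body V K Post s (n + 1) (cfg body (.get .up kb) T (x, y)) :=
  act_keep b hb rfl h hV

theorem takeU (b : Bool) (hb : (x, y) ∈ T ↔ b = true)
    (h : WS body V K Post s n (cfg body (kb b) (upd T (x, y) v) (x, y + 1))) (hV : (x, y) ∈ V) :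
    WS body V K Post (s + 1) (n + 1) (cfg body (.take v .up kb) T (x, y)) :=
  act b hb h hV

theorem hitU {q : Q} {d : Dir} (hT : (x, y) ∈ T)
    (h : WS body V K Post s n (cfg body k T (x, y + 1))) (hV : (x, y) ∈ V) :
    WS body V K Post s (n + 1) (cfg body (.walk v d q true .up k) T (x, y)) :=
  act_keep true (by simpa using hT) rfl h hV

theorem hitEraseU {q : Q} {d : Dir} (hT : (x, y) ∈ T)
    (h : WS body V K Post s n (cfg body k (upd T (x, y) false) (x, y + 1))) (hV : (x, y) ∈ V) :
    WS body V K Post (s + 1) (n + 1) (cfg body (.walk v d q false .up k) T (x, y)) :=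
  act true (by simpa using hT) h hV

theorem mvD (h : WS body V K Post s n (cfg body k T (x, y - 1))) (hV : (x, y) ∈ V) :
    WS body V K Post s (n + 1) (cfg body (.mv .down k) T (x, y)) :=
  act_keep (decide ((x, y) ∈ T)) (by simp) rfl h hV

theorem putD (h : WS body V K Post s n (cfg body k (upd T (x, y) v) (x, y - 1)))
    (hV : (x, y) ∈ V) : WS body V K Post (s + 1) (n + 1) (cfg body (.put v .down k) T (x, y)) :=
  act (decide ((x, y) ∈ T)) (by simp) h hV

theorem getD (b : Bool) (hb : (x, y) ∈ T ↔ b = true)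
    (h : WS body V K Post s n (cfg body (kb b) T (x, y - 1))) (hV : (x, y) ∈ V) :
    WS body V K Post s (n + 1) (cfg body (.get .down kb) T (x, y)) :=
  act_keep b hb rfl h hV

theorem takeD (b : Bool) (hb : (x, y) ∈ T ↔ b = true)
    (h : WS body V K Post s n (cfg body (kb b) (upd T (x, y) v) (x, y - 1))) (hV : (x, y) ∈ V) :
    WS body V K Post (s + 1) (n + 1) (cfg body (.take v .down kb) T (x, y)) :=
  act b hb h hV

theorem hitD {q : Q} {d : Dir} (hT : (x, y) ∈ T)
    (h : WS body V K Post s n (cfg body k T (x, y - 1))) (hV : (x, y) ∈ V) :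
    WS body V K Post s (n + 1) (cfg body (.walk v d q true .down k) T (x, y)) :=
  act_keep true (by simpa using hT) rfl h hV

theorem hitEraseD {q : Q} {d : Dir} (hT : (x, y) ∈ T)
    (h : WS body V K Post s n (cfg body k (upd T (x, y) false) (x, y - 1))) (hV : (x, y) ∈ V) :
    WS body V K Post (s + 1) (n + 1) (cfg body (.walk v d q false .down k) T (x, y)) :=
  act true (by simpa using hT) h hV

theorem mvL (h : WS body V K Post s n (cfg body k T (x - 1, y))) (hV : (x, y) ∈ V) :
    WS body V K Post s (n + 1) (cfg body (.mv .left k) T (x, y)) :=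
  act_keep (decide ((x, y) ∈ T)) (by simp) rfl h hV

theorem putL (h : WS body V K Post s n (cfg body k (upd T (x, y) v) (x - 1, y)))
    (hV : (x, y) ∈ V) : WS body V K Post (s + 1) (n + 1) (cfg body (.put v .left k) T (x, y)) :=
  act (decide ((x, y) ∈ T)) (by simp) h hV

theorem takeL (b : Bool) (hb : (x, y) ∈ T ↔ b = true)
    (h : WS body V K Post s n (cfg body (kb b) (upd T (x, y) v) (x - 1, y))) (hV : (x, y) ∈ V) :
    WS body V K Post (s + 1) (n + 1) (cfg body (.take v .left kb) T (x, y)) :=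
  act b hb h hV

theorem hitEraseL {q : Q} {d : Dir} (hT : (x, y) ∈ T)
    (h : WS body V K Post s n (cfg body k (upd T (x, y) false) (x - 1, y))) (hV : (x, y) ∈ V) :
    WS body V K Post (s + 1) (n + 1) (cfg body (.walk v d q false .left k) T (x, y)) :=
  act true (by simpa using hT) h hV

theorem mvR (h : WS body V K Post s n (cfg body k T (x + 1, y))) (hV : (x, y) ∈ V) :
    WS body V K Post s (n + 1) (cfg body (.mv .right k) T (x, y)) :=
  act_keep (decide ((x, y) ∈ T)) (by simp) rfl h hV

theorem putR (h : WS body V K Post s n (cfg body k (upd T (x, y) v) (x + 1, y)))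
    (hV : (x, y) ∈ V) : WS body V K Post (s + 1) (n + 1) (cfg body (.put v .right k) T (x, y)) :=
  act (decide ((x, y) ∈ T)) (by simp) h hV

theorem getR (b : Bool) (hb : (x, y) ∈ T ↔ b = true)
    (h : WS body V K Post s n (cfg body (kb b) T (x + 1, y))) (hV : (x, y) ∈ V) :
    WS body V K Post s (n + 1) (cfg body (.get .right kb) T (x, y)) :=
  act_keep b hb rfl h hV

theorem takeR (b : Bool) (hb : (x, y) ∈ T ↔ b = true)
    (h : WS body V K Post s n (cfg body (kb b) (upd T (x, y) v) (x + 1, y))) (hV : (x, y) ∈ V) :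
    WS body V K Post (s + 1) (n + 1) (cfg body (.take v .right kb) T (x, y)) :=
  act b hb h hV

theorem hitR {q : Q} {d : Dir} (hT : (x, y) ∈ T)
    (h : WS body V K Post s n (cfg body k T (x + 1, y))) (hV : (x, y) ∈ V) :
    WS body V K Post s (n + 1) (cfg body (.walk v d q true .right k) T (x, y)) :=
  act_keep true (by simpa using hT) rfl h hV

theorem hitEraseR {q : Q} {d : Dir} (hT : (x, y) ∈ T)
    (h : WS body V K Post s n (cfg body k (upd T (x, y) false) (x + 1, y))) (hV : (x, y) ∈ V) :
    WS body V K Post (s + 1) (n + 1) (cfg body (.walk v d q false .right k) T (x, y)) :=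
  act true (by simpa using hT) h hV

/-- The path is an abstract sequence of pixels, so that one induction serves all four directions.
The last step is split off, because the assumption concerns the end of the path. -/
theorem walk {q : Q} {d d' : Dir} {v' : Bool} (hq : body q = .walk false d q v' d' k)
    {p : ℕ → Pixel} (hp : ∀ i, d.move (p i) = p (i + 1)) (m : ℕ) (hT : ∀ i < m, p i ∉ T)
    (hV : ∀ i < m, p i ∈ V) (h : WS body V K Post s n (cfg body (.goto q) T (p m))) :
    WS body V K Post s (n + m) (cfg body (.goto q) T (p 0)) := by
  induction m generalizing n with
  | zero => exact h
  | succ m ih =>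
    refine (ih (fun i hi => hT i (by omega)) (fun i hi => hV i (by omega)) (n := n + 1) ?_).mono
      le_rfl (by omega)
    rcases hpm : p m with ⟨x, y⟩
    refine enter ?_ (by rw [hq]; rfl)
    rw [hq]
    refine act_keep (f := fun b => if b then (v', d') else (false, d)) false
      (by simpa [hpm] using hT m (by omega)) rfl ?_ (by rw [← hpm]; exact hV m (by omega))
    have e : d.move (x, y) = p (m + 1) := by rw [← hpm, hp]
    simpa [e] using h

theorem walkU {q : Q} {d' : Dir} {v' : Bool} {n' : ℕ} (y' : ℤ) (n : ℕ)
    (hq : body q = .walk false .up q v' d' k)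
    (h : WS body V K Post s n (cfg body (.goto q) T (x, y'))) (hle : y ≤ y')
    (hn : y' - y + n ≤ n') (hT : ∀ i, y ≤ i → i < y' → (x, i) ∉ T)
    (hV : ∀ i, y ≤ i → i < y' → (x, i) ∈ V) :
    WS body V K Post s n' (cfg body (.goto q) T (x, y)) := by
  obtain ⟨m, hm⟩ := Int.eq_ofNat_of_zero_le (sub_nonneg.2 hle)
  have := walk hq (p := fun i => (x, y + i)) (T := T) (V := V) (K := K) (Post := Post) (s := s) (n := n)
    (fun i => by simp [Dir.move]; try ring) m (fun i hi => hT _ (by omega) (by omega))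
    (fun i hi => hV _ (by omega) (by omega)) (pos_eq h (by simp; omega))
  exact (pos_eq this (by simp)).mono le_rfl (by omega)

theorem walkD {q : Q} {d' : Dir} {v' : Bool} {n' : ℕ} (y' : ℤ) (n : ℕ)
    (hq : body q = .walk false .down q v' d' k)
    (h : WS body V K Post s n (cfg body (.goto q) T (x, y'))) (hle : y' ≤ y)
    (hn : y - y' + n ≤ n') (hT : ∀ i, y' < i → i ≤ y → (x, i) ∉ T)
    (hV : ∀ i, y' < i → i ≤ y → (x, i) ∈ V) :
    WS body V K Post s n' (cfg body (.goto q) T (x, y)) := by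
  obtain ⟨m, hm⟩ := Int.eq_ofNat_of_zero_le (sub_nonneg.2 hle)
  have := walk hq (p := fun i => (x, y - i)) (T := T) (V := V) (K := K) (Post := Post) (s := s) (n := n)
    (fun i => by simp [Dir.move]; try ring) m (fun i hi => hT _ (by omega) (by omega))
    (fun i hi => hV _ (by omega) (by omega)) (pos_eq h (by simp; omega))
  exact (pos_eq this (by simp)).mono le_rfl (by omega)

theorem walkL {q : Q} {d' : Dir} {v' : Bool} {n' : ℕ} (x' : ℤ) (n : ℕ)
    (hq : body q = .walk false .left q v' d' k)
    (h : WS body V K Post s n (cfg body (.goto q) T (x', y))) (hle : x' ≤ x)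
    (hn : x - x' + n ≤ n') (hT : ∀ i, x' < i → i ≤ x → (i, y) ∉ T)
    (hV : ∀ i, x' < i → i ≤ x → (i, y) ∈ V) :
    WS body V K Post s n' (cfg body (.goto q) T (x, y)) := by
  obtain ⟨m, hm⟩ := Int.eq_ofNat_of_zero_le (sub_nonneg.2 hle)
  have := walk hq (p := fun i => (x - i, y)) (T := T) (V := V) (K := K) (Post := Post) (s := s) (n := n)
    (fun i => by simp [Dir.move]; try ring) m (fun i hi => hT _ (by omega) (by omega))
    (fun i hi => hV _ (by omega) (by omega)) (pos_eq h (by simp; omega))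
  exact (pos_eq this (by simp)).mono le_rfl (by omega)

theorem walkR {q : Q} {d' : Dir} {v' : Bool} {n' : ℕ} (x' : ℤ) (n : ℕ)
    (hq : body q = .walk false .right q v' d' k)
    (h : WS body V K Post s n (cfg body (.goto q) T (x', y))) (hle : x ≤ x')
    (hn : x' - x + n ≤ n') (hT : ∀ i, x ≤ i → i < x' → (i, y) ∉ T)
    (hV : ∀ i, x ≤ i → i < x' → (i, y) ∈ V) :
    WS body V K Post s n' (cfg body (.goto q) T (x, y)) := by
  obtain ⟨m, hm⟩ := Int.eq_ofNat_of_zero_le (sub_nonneg.2 hle)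
  have := walk hq (p := fun i => (x + i, y)) (T := T) (V := V) (K := K) (Post := Post) (s := s) (n := n)
    (fun i => by simp [Dir.move]; try ring) m (fun i hi => hT _ (by omega) (by omega))
    (fun i hi => hV _ (by omega) (by omega)) (pos_eq h (by simp; omega))
  exact (pos_eq this (by simp)).mono le_rfl (by omega)

end WS

end Machine

/-! ### The program -/

/-- The rotation that turns up into left. -/
def rot : Perm Dir where
  toFun | .up => .left | .left => .down | .down => .right | .right => .up
  invFun | .up => .right | .left => .up | .down => .left | .right => .down
  left_inv d := by cases d <;> rfl
  right_inv d := by cases d <;> rfl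

/-- The reflection that exchanges up and right. -/
def transp : Perm Dir where
  toFun | .up => .right | .left => .down | .down => .left | .right => .up
  invFun | .up => .right | .left => .down | .down => .left | .right => .up
  left_inv d := by cases d <;> rfl
  right_inv d := by cases d <;> rfl

/-- The original state of the four pixels of a corner mark. -/
abbrev Bits : Type := Bool × Bool × Bool × Bool

set_option synthInstance.maxHeartbeats 400000 in
set_option synthInstance.maxSize 10000 in
set_option maxSynthPendingDepth 100 in
/-- The labels of the program. Phase one (`init`, `scan`) grows a rectangle that is marked at its
corners to the bounding box; phase two (`setup` to `fillDown`) builds walls at its left and right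
side; phase three (`mirHead` to `mirEnd`) mirrors the rows between them; phase four (`fillTop` to
`eraseDown`) builds a wall at the top; phase five transposes the result, one L-shaped layer per
stage. -/
inductive Label : Type
  | init (k : Fin 4) (m : Bits × Bits × Bits × Bits)
  | scan (m : Bits × Bits × Bits × Bits) (g : Bool × Bool × Bool) (cnt : Fin 7) (f : Bool)
  | setup | fillUp | walkTop | fillDown
  | mirHead (first : Bool) | mirRight (first a : Bool) | mirTarget (a : Bool) | mirLeft
  | mirSource (last : Bool) | mirEnd
  | fillTop | backTop | eraseDown
  | stage (first : Bool) | iter (first : Bool) | itLeft (first a : Bool) | itUp (first a : Bool)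
  | itDown (first b hit : Bool) | itRight (first b hit : Bool)
  | endFind | endLeft (first more : Bool) | endUp (first more : Bool)
  | clear (more : Bool) | clearBack (more : Bool) | endDown (more : Bool)
  | turnDown | turnRight
  deriving Fintype

namespace Label
open Code

/-- Set a corner mark and remember the original state of its pixels. -/
def markCode (k : Bits → Code Label) : Code Label :=
  take false .right fun y1 => take true .up fun y2 => take false .left fun y3 =>
    take true .down fun y4 => k (y1, y2, y3, y4)

/-- Having reached the corner mark at the end of a side, move it. -/
def cornerCode (m : Bits × Bits × Bits × Bits) (g : Bool × Bool × Bool) (cnt : Fin 7) (f : Bool) :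
    Code Label :=
  put m.1.2.2.2 .down <| put m.1.1 .right <| put m.1.2.1 .left <|
    (if f then mv .right else id) <| (if g.1 then mv .up else id) <| markCode fun n =>
      if f then turn rot (scan (m.2.1, m.2.2.1, m.2.2.2, n) (g.2.1, g.2.2, true) 0 n.1)
      else if cnt = 6 then turn rot setup
      else turn rot (scan (m.2.1, m.2.2.1, m.2.2.2, n) (g.2.1, g.2.2, false) (cnt + 1) n.1)

/-- Scan the current pixel outside of the current side. -/
def scanCode (m : Bits × Bits × Bits × Bits) (g : Bool × Bool × Bool) (cnt : Fin 7) (f : Bool) :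
    Code Label :=
  act (fun b => if b then (true, .left) else (false, .up)) fun b =>
    if b then
      get .up fun u => get .right fun v =>
        act (fun z => if !u && v && !z then (m.1.2.2.1, .left) else (z, .down)) fun z =>
          if !u && v && !z then cornerCode m g cnt f else mv .up (goto (scan m g cnt true))
    else goto (scan m g cnt f)

/-- Set the target token, write the mirrored pixel below, and return unless the row is done. -/
def placeCode (a : Bool) : Code Label :=
  put true .down <| put a .up <| mv .left <|
    walk false .left mirLeft true .right <| put false .up <| goto (mirSource true)

/-- At the next position of the right token, decide how to proceed. -/
def nextCode (first hit : Bool) : Code Label :=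
  act (fun r => if r || hit then
      if first && !hit then (true, .left) else if first && !r then (false, .right) else (r, .up)
    else (true, .up)) fun r =>
    if r || hit then
      if first && !hit then turn transp turnDown else if first && !r then goto endFind
      else get .down fun more => put false .left <| goto (endLeft first more)
    else goto (iter first)

/-- The program of the robot. -/
def body : Label → Code Label
  | init k m => mv .up <| markCode fun n =>
      let m' := (m.2.1, m.2.2.1, m.2.2.2, n)
      if k = 3 then turn rot (scan m' (false, false, false) 0 n.1)
      else mv .down <| turn rot (init (k + 1) m')
  | scan m g cnt f => scanCode m g cnt f
  | setup => mv .right <| put false .left <| mv .down <| mv .down <| put true .down <|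
      put true .down <| put true .down <| put true .up <| mv .up <| mv .up <| mv .up <| mv .up <|
      goto fillUp
  | fillUp => walk true .up fillUp true .up <| mv .left <| put false .down <| goto walkTop
  | walkTop => walk false .left walkTop false .left <| mv .down <| put false .right <| mv .down <|
      goto fillDown
  | fillDown => walk true .down fillDown true .down <| put true .right <| put false .up <|
      goto (mirHead true)
  | mirHead first => put true .up <| take false .down fun a => mv .right <|
      goto (mirRight first a)
  | mirRight first a => walk false .right (mirRight first a) true .down <| mv .left <|
      if first then placeCode a
      else goto (mirTarget a)
  | mirTarget a => walk false .left (mirTarget a) false .left <| placeCode a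
  | mirLeft => walk false .left mirLeft true .up <| mv .right <| goto (mirSource false)
  | mirSource last =>
      if last then walk false .right (mirSource last) false .left <| goto mirEnd
      else walk false .right (mirSource last) false .right <| goto (mirHead false)
  | mirEnd => walk false .left mirEnd true .up <|
      act (fun more => if more then (true, .right) else (false, .down)) fun more =>
        if more then goto (mirHead true) else mv .down <| mv .right <| goto fillTop
  | fillTop => walk true .right fillTop false .down <| put false .up <| mv .up <| put false .up <|
      put false .up <| put false .left <| mv .down <| mv .down <| mv .down <| put false .up <|
      goto backTop
  | backTop => walk false .left backTop false .left <| mv .down <| put true .right <| mv .down <|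
      goto eraseDown
  | eraseDown => act (fun b => if b then (false, .down) else (false, .left)) fun b =>
      if b then goto eraseDown else mv .down <| mv .down <| put true .up <| goto (stage true)
  | stage first => mv .right <| take false .left fun c => mv .left <| mv .down <| mv .down <|
      put c .up <| mv .up <| mv .right <| mv .up <| take true .down fun hit =>
      mv .down <| mv .right <| mv .right <| nextCode first hit
  | iter first => take false .down fun a => mv .left <| goto (itLeft first a)
  | itLeft first a => walk false .left (itLeft first a) true .up <| goto (itUp first a)
  | itUp first a => walk false .up (itUp first a) false .right <| take false .left fun b =>
      mv .left <| mv .down <| mv .down <| put a .up <| mv .up <| mv .up <| mv .right <|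
      take true .down fun hit => goto (itDown first b hit)
  | itDown first b hit => walk false .down (itDown first b hit) true .right <|
      goto (itRight first b hit)
  | itRight first b hit => walk false .right (itRight first b hit) false .left <|
      mv .left <| mv .down <| put b .up <| mv .right <| mv .right <| mv .right <|
      nextCode first hit
  | turnDown => walk false .down turnDown true .right <| goto turnRight
  | turnRight => walk false .right turnRight false .right <| goto endFind
  | endFind => walk false .right endFind true .up <| get .down fun more =>
      put false .left <| goto (endLeft true more)
  | endLeft first more => walk false .left (endLeft first more) true .up <| goto (endUp first more)
  | endUp first more =>
      if first then walk false .up (endUp first more) true .right <| goto (clear more)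
      else walk false .up (endUp first more) false .down <| goto (endDown more)
  | clear more => act (fun b => if b then (false, .right) else (false, .left)) fun b =>
      if b then goto (clear more) else goto (clearBack more)
  | clearBack more => walk false .left (clearBack more) false .down <| goto (endDown more)
  | endDown more => walk false .down (endDown more) false .up <|
      if more then mv .right <| put true .up <| goto (stage false) else halt

end Label

/-! ### Loops that fill or erase a line of pixels -/

namespace WS
variable {Q : Type} {body : Q → Code Q} {V : Set Pixel} {K : ℕ} {Post : Cfg Q → Prop}
variable {s n : ℕ} {T : Finset Pixel} {x y : ℤ} {k : Code Q}

theorem finish {s' n' : ℕ} {c : Code Q} {p p' : Pixel}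
    (h : WS body V K Post s n (cfg body c T p')) (hs : s ≤ s') (hn : n ≤ n')
    (hp : p.1 = p'.1 ∧ p.2 = p'.2) : WS body V K Post s' n' (cfg body c T p) :=
  pos_eq (h.mono hs hn) hp

theorem fill {q : Q} {d d' : Dir} {v' : Bool} (hq : body q = .walk true d q v' d' k)
    {p : ℕ → Pixel} (hp : ∀ i, d.move (p i) = p (i + 1)) (hinj : Function.Injective p) (m : ℕ)
    (hT : ∀ i < m, p i ∉ T) (hV : ∀ i < m, p i ∈ V)
    (h : ∀ T', (∀ r, r ∈ T' ↔ r ∈ T ∨ ∃ i < m, r = p i) →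
      WS body V K Post s n (cfg body (.goto q) T' (p m))) :
    WS body V K Post (s + m) (n + m) (cfg body (.goto q) T (p 0)) := by
  induction m generalizing n s with
  | zero => exact h T (by simp)
  | succ m ih =>
    refine (ih (fun i hi => hT i (by omega)) (fun i hi => hV i (by omega)) (n := n + 1)
      (s := s + 1) fun T' hT' => ?_).mono (by omega) (by omega)
    have hm : p m ∉ T' := by
      rw [hT']
      rintro (h | ⟨i, hi, h⟩)
      · exact hT m (by omega) h
      · exact absurd (hinj h) (by omega)
    have hVm := hV m (by omega)
    have e := hp m
    have h' := h (upd T' (p m) true) fun r => by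
      rw [mem_upd, hT', show (∃ i < m + 1, r = p i) ↔ (∃ i < m, r = p i) ∨ r = p m from ?_]
      · by_cases hr : r = p m <;> simp [hr]
      · constructor
        · rintro ⟨i, hi, rfl⟩
          rcases Nat.lt_succ_iff_lt_or_eq.1 hi with h | rfl
          · exact Or.inl ⟨i, h, rfl⟩
          · exact Or.inr rfl
        · rintro (⟨i, hi, rfl⟩ | rfl)
          · exact ⟨i, by omega, rfl⟩
          · exact ⟨m, by omega, rfl⟩
    rw [← e] at h'
    generalize p m = pm at *
    obtain ⟨x, y⟩ := pm
    refine enter ?_ (by rw [hq]; rfl)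
    rw [hq]
    exact act (f := fun b => if b then (v', d') else (true, d)) false (by simpa using hm) h' hVm

/-- Unlike `act`, this rule charges no room: the loop erases occupied pixels only, so the number of
tiles decreases. -/
theorem erase {q : Q} {d d' : Dir} {v' : Bool}
    (hq : body q = .act (fun b => if b then (false, d) else (v', d'))
      fun b => if b then .goto q else k)
    {p : ℕ → Pixel} (hp : ∀ i, d.move (p i) = p (i + 1)) (hinj : Function.Injective p) (m : ℕ)
    (hT : ∀ i < m, p i ∈ T) (hV : ∀ i < m, p i ∈ V)
    (h : ∀ T', (∀ r, r ∈ T' ↔ r ∈ T ∧ ∀ i < m, r ≠ p i) →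
      WS body V K Post s n (cfg body (.goto q) T' (p m))) :
    WS body V K Post s (n + m) (cfg body (.goto q) T (p 0)) := by
  induction m generalizing n with
  | zero => exact h T (by simp)
  | succ m ih =>
    refine (ih (fun i hi => hT i (by omega)) (fun i hi => hV i (by omega)) (n := n + 1)
      fun T' hT' => ?_).mono le_rfl (by omega)
    have hm : p m ∈ T' :=
      (hT' _).2 ⟨hT m (by omega), fun i hi h => absurd (hinj h) (by omega)⟩
    have hVm := hV m (by omega)
    have e := hp m
    have h' := h (upd T' (p m) false) fun r => by
      rw [mem_upd, hT']
      constructor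
      · rintro (⟨_, h⟩ | ⟨h1, h2, h3⟩)
        · cases h
        · refine ⟨h2, fun i hi => ?_⟩
          rcases Nat.lt_succ_iff_lt_or_eq.1 hi with h | rfl
          · exact h3 i h
          · exact h1
      · rintro ⟨h1, h2⟩
        exact Or.inr ⟨h2 m (by omega), h1, fun i hi => h2 i (by omega)⟩
    rw [← e] at h'
    -- The erased tile leaves at least as much room for the rest of the run as there was before.
    have hc : (upd T' (p m) false).card + 1 ≤ T'.card :=
      (Finset.card_erase_add_one hm).le
    generalize p m = pm at *
    obtain ⟨x, y⟩ := pm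
    refine enter ?_ (by rw [hq]; rfl)
    rw [hq]
    intro hK
    refine .step _ _ (by simp [cfg, resolve]) hVm (by simp only [cfg] at hK ⊢; omega) ?_
    have hb : decide ((x, y) ∈ T') = true := by simpa using hm
    have e : (cfg body (.act (fun b => if b then (false, d) else (v', d'))
        fun b => if b then .goto q else k) T' (x, y)).step body
        = cfg body (.goto q) (upd T' (x, y) false) (d.move (x, y)) := by
      simp [cfg, resolve, Cfg.step, trans, hm]
    rw [e]
    apply h'
    simp only [cfg] at hK ⊢
    omega

theorem fillU {q : Q} {d' : Dir} {v' : Bool} {s' n' : ℕ} (y' : ℤ) (s n : ℕ)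
    (hq : body q = .walk true .up q v' d' k)
    (h : ∀ T', (∀ a b, (a, b) ∈ T' ↔ (a, b) ∈ T ∨ (a = x ∧ y ≤ b ∧ b < y')) →
      WS body V K Post s n (cfg body (.goto q) T' (x, y'))) (hle : y ≤ y')
    (hn : y' - y + n ≤ n') (hs : y' - y + s ≤ s') (hT : ∀ i, y ≤ i → i < y' → (x, i) ∉ T)
    (hV : ∀ i, y ≤ i → i < y' → (x, i) ∈ V) :
    WS body V K Post s' n' (cfg body (.goto q) T (x, y)) := by
  obtain ⟨m, hm⟩ := Int.eq_ofNat_of_zero_le (sub_nonneg.2 hle)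
  have := fill hq (p := fun i => (x, y + i)) (T := T) (V := V) (K := K) (Post := Post) (s := s) (n := n)
    (fun i => by simp [Dir.move]; try ring) (fun i j h => by simpa using h) m
    (fun i hi => hT _ (by omega) (by omega))
    (fun i hi => hV _ (by omega) (by omega)) fun T' hT' => pos_eq (h T' fun a b => ?_) (by simp; omega)
  · exact (pos_eq this (by simp)).mono (by omega) (by omega)
  · rw [hT']
    refine or_congr_right ⟨?_, fun h => ⟨(b - y).toNat, by omega, by ext <;> simp <;> omega⟩⟩
    rintro ⟨i, hi, h⟩
    simp only [Prod.mk.injEq] at h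
    omega

theorem fillD {q : Q} {d' : Dir} {v' : Bool} {s' n' : ℕ} (y' : ℤ) (s n : ℕ)
    (hq : body q = .walk true .down q v' d' k)
    (h : ∀ T', (∀ a b, (a, b) ∈ T' ↔ (a, b) ∈ T ∨ (a = x ∧ y' < b ∧ b ≤ y)) →
      WS body V K Post s n (cfg body (.goto q) T' (x, y'))) (hle : y' ≤ y)
    (hn : y - y' + n ≤ n') (hs : y - y' + s ≤ s') (hT : ∀ i, y' < i → i ≤ y → (x, i) ∉ T)
    (hV : ∀ i, y' < i → i ≤ y → (x, i) ∈ V) :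
    WS body V K Post s' n' (cfg body (.goto q) T (x, y)) := by
  obtain ⟨m, hm⟩ := Int.eq_ofNat_of_zero_le (sub_nonneg.2 hle)
  have := fill hq (p := fun i => (x, y - i)) (T := T) (V := V) (K := K) (Post := Post) (s := s) (n := n)
    (fun i => by simp [Dir.move]; try ring) (fun i j h => by simpa using h) m
    (fun i hi => hT _ (by omega) (by omega))
    (fun i hi => hV _ (by omega) (by omega)) fun T' hT' => pos_eq (h T' fun a b => ?_) (by simp; omega)
  · exact (pos_eq this (by simp)).mono (by omega) (by omega)
  · rw [hT']
    refine or_congr_right ⟨?_, fun h => ⟨(y - b).toNat, by omega, by ext <;> simp <;> omega⟩⟩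
    rintro ⟨i, hi, h⟩
    simp only [Prod.mk.injEq] at h
    omega

theorem eraseD {q : Q} {d' : Dir} {v' : Bool} {n' : ℕ} (y' : ℤ) (n : ℕ)
    (hq : body q = .act (fun b => if b then (false, .down) else (v', d'))
      fun b => if b then .goto q else k)
    (h : ∀ T', (∀ a b, (a, b) ∈ T' ↔ (a, b) ∈ T ∧ ¬ (a = x ∧ y' < b ∧ b ≤ y)) →
      WS body V K Post s n (cfg body (.goto q) T' (x, y'))) (hle : y' ≤ y)
    (hn : y - y' + n ≤ n') (hT : ∀ i, y' < i → i ≤ y → (x, i) ∈ T)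
    (hV : ∀ i, y' < i → i ≤ y → (x, i) ∈ V) :
    WS body V K Post s n' (cfg body (.goto q) T (x, y)) := by
  obtain ⟨m, hm⟩ := Int.eq_ofNat_of_zero_le (sub_nonneg.2 hle)
  have := erase hq (p := fun i => (x, y - i)) (T := T) (V := V) (K := K) (Post := Post) (s := s) (n := n)
    (fun i => by simp [Dir.move]; try ring) (fun i j h => by simpa using h) m
    (fun i hi => hT _ (by omega) (by omega))
    (fun i hi => hV _ (by omega) (by omega)) fun T' hT' => pos_eq (h T' fun a b => ?_) (by simp; omega)
  · exact (pos_eq this (by simp)).mono (by omega) (by omega)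
  · rw [hT']
    refine and_congr_right fun _ => ⟨fun h h' => h (y - b).toNat (by omega) (by ext <;> simp <;> omega),
      fun h i hi h' => h ?_⟩
    simp only [Prod.mk.injEq] at h'
    omega

theorem fillR {q : Q} {d' : Dir} {v' : Bool} {s' n' : ℕ} (x' : ℤ) (s n : ℕ)
    (hq : body q = .walk true .right q v' d' k)
    (h : ∀ T', (∀ a b, (a, b) ∈ T' ↔ (a, b) ∈ T ∨ (b = y ∧ x ≤ a ∧ a < x')) →
      WS body V K Post s n (cfg body (.goto q) T' (x', y))) (hle : x ≤ x')
    (hn : x' - x + n ≤ n') (hs : x' - x + s ≤ s') (hT : ∀ i, x ≤ i → i < x' → (i, y) ∉ T)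
    (hV : ∀ i, x ≤ i → i < x' → (i, y) ∈ V) :
    WS body V K Post s' n' (cfg body (.goto q) T (x, y)) := by
  obtain ⟨m, hm⟩ := Int.eq_ofNat_of_zero_le (sub_nonneg.2 hle)
  have := fill hq (p := fun i => (x + i, y)) (T := T) (V := V) (K := K) (Post := Post) (s := s) (n := n)
    (fun i => by simp [Dir.move]; try ring) (fun i j h => by simpa using h) m
    (fun i hi => hT _ (by omega) (by omega))
    (fun i hi => hV _ (by omega) (by omega)) fun T' hT' => pos_eq (h T' fun a b => ?_) (by simp; omega)
  · exact (pos_eq this (by simp)).mono (by omega) (by omega)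
  · rw [hT']
    refine or_congr_right ⟨?_, fun h => ⟨(a - x).toNat, by omega, by ext <;> simp <;> omega⟩⟩
    rintro ⟨i, hi, h⟩
    simp only [Prod.mk.injEq] at h
    omega

theorem eraseR {q : Q} {d' : Dir} {v' : Bool} {n' : ℕ} (x' : ℤ) (n : ℕ)
    (hq : body q = .act (fun b => if b then (false, .right) else (v', d'))
      fun b => if b then .goto q else k)
    (h : ∀ T', (∀ a b, (a, b) ∈ T' ↔ (a, b) ∈ T ∧ ¬ (b = y ∧ x ≤ a ∧ a < x')) →
      WS body V K Post s n (cfg body (.goto q) T' (x', y))) (hle : x ≤ x')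
    (hn : x' - x + n ≤ n') (hT : ∀ i, x ≤ i → i < x' → (i, y) ∈ T)
    (hV : ∀ i, x ≤ i → i < x' → (i, y) ∈ V) :
    WS body V K Post s n' (cfg body (.goto q) T (x, y)) := by
  obtain ⟨m, hm⟩ := Int.eq_ofNat_of_zero_le (sub_nonneg.2 hle)
  have := erase hq (p := fun i => (x + i, y)) (T := T) (V := V) (K := K) (Post := Post) (s := s) (n := n)
    (fun i => by simp [Dir.move]; try ring) (fun i j h => by simpa using h) m
    (fun i hi => hT _ (by omega) (by omega))
    (fun i hi => hV _ (by omega) (by omega)) fun T' hT' => pos_eq (h T' fun a b => ?_) (by simp; omega)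
  · exact (pos_eq this (by simp)).mono (by omega) (by omega)
  · rw [hT']
    refine and_congr_right fun _ => ⟨fun h h' => h (a - x).toNat (by omega) (by ext <;> simp <;> omega),
      fun h i hi h' => h ?_⟩
    simp only [Prod.mk.injEq] at h'
    omega

end WS

open Label Code

variable {V : Set Pixel} {K : ℕ} {Post : Cfg Label → Prop} {s n : ℕ} {T T₀ D P : Finset Pixel}

/-! ### Mirroring -/

/-- The tiles while a row is being mirrored: the row `y` is moved pixel by pixel to the row
`y - 3`, the columns left of `x` are done. -/
def MirRow (T₀ : Finset Pixel) (w : ℕ) (y x : ℤ) (T : Finset Pixel) : Prop :=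
  ∀ a b : ℤ, (a, b) ∈ T ↔ (b = y ∧ 0 ≤ a ∧ a < w ∧ x ≤ a ∧ (a, b) ∈ T₀) ∨
    (b = y - 3 ∧ 0 ≤ a ∧ a < w ∧ ((w - 1 - x < a ∧ (w - 1 - a, y) ∈ T₀) ∨
      (a ≤ w - 1 - x ∧ (a, b) ∈ T₀))) ∨
    (b = y - 2 ∧ 0 < x ∧ a = w - x) ∨ (¬ (0 ≤ a ∧ a < w ∧ (b = y ∨ b = y - 3)) ∧ (a, b) ∈ T₀)

/-- The lanes between the rows `y` and `y - 3` are empty and have walls at both ends. -/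
structure MirLane (T₀ : Finset Pixel) (w : ℕ) (y : ℤ) : Prop where
  wpos : 0 < w
  empty : ∀ a b : ℤ, 0 ≤ a → a < w → y - 2 ≤ b → b < y → (a, b) ∉ T₀
  left : ∀ b : ℤ, y - 2 ≤ b → b < y → (-1, b) ∈ T₀
  right : ∀ b : ℤ, y - 2 ≤ b → b < y → ((w : ℤ), b) ∈ T₀

/-- The robot moves tiles rather than creating them: the tiles in `S` are images of tiles in `S₀`,
except for the auxiliary tiles in `E`. -/
theorem card_le_of_image {α : Type*} [DecidableEq α] {S S₀ E : Finset α} (g : α → α)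
    (h : ∀ p ∈ S, p ∈ E ∨ ∃ q ∈ S₀, g q = p) : S.card ≤ S₀.card + E.card :=
  calc S.card ≤ (S₀.image g ∪ E).card := Finset.card_le_card fun p hp => by
        rcases h p hp with h | ⟨q, hq, rfl⟩
        · exact Finset.mem_union_right _ h
        · exact Finset.mem_union_left _ (Finset.mem_image_of_mem _ hq)
    _ ≤ _ := (Finset.card_union_le _ _).trans (Nat.add_le_add_right Finset.card_image_le _)

theorem MirRow.card_le {w : ℕ} {x y : ℤ} (hT : MirRow T₀ w y x T) : T.card ≤ T₀.card + 1 := by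
  refine card_le_of_image (E := {((w : ℤ) - x, y - 2)}) (fun p =>
    if p.2 = y ∧ 0 ≤ p.1 ∧ p.1 < w ∧ p.1 < x then ((w : ℤ) - 1 - p.1, y - 3) else p) ?_
  rintro ⟨a, b⟩ hp
  rcases (hT a b).1 hp with h | ⟨rfl, h1, h2, h | h⟩ | h | h
  · exact Or.inr ⟨(a, b), h.2.2.2.2, if_neg (by simp only; omega)⟩
  · refine Or.inr ⟨_, h.2, ?_⟩
    rw [if_pos ⟨rfl, by simp only; omega⟩]
    ext <;> simp
  · exact Or.inr ⟨_, h.2, if_neg (by simp only; omega)⟩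
  · simp [h.1, h.2.2]
  · exact Or.inr ⟨(a, b), h.2, if_neg (by simp only; omega)⟩

/-- The tiles when the target token has been set. -/
def MirPlaced (T₀ : Finset Pixel) (w : ℕ) (y x : ℤ) (T : Finset Pixel) : Prop :=
  ∀ a b : ℤ, (a, b) ∈ T ↔ (b = y ∧ 0 ≤ a ∧ a < w ∧ x + 1 ≤ a ∧ (a, b) ∈ T₀) ∨
    (b = y - 1 ∧ a = x) ∨
    (b = y - 3 ∧ 0 ≤ a ∧ a < w ∧ ((w - 1 - x < a ∧ (w - 1 - a, y) ∈ T₀) ∨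
      (a ≤ w - 1 - x ∧ (a, b) ∈ T₀))) ∨
    (¬ (0 ≤ a ∧ a < w ∧ (b = y ∨ b = y - 3)) ∧ (a, b) ∈ T₀)

/-- The part of the cycle shared by all pixels of the row: set the source token, pick up the pixel
`(x, y)`, go around at the right wall, and find the target in the lower lane. -/
theorem mir_head {w : ℕ} {x y : ℤ} (hl : MirLane T₀ w y) (hx : 0 ≤ x) (hxw : x < w)
    (hT : MirRow T₀ w y x T)
    (hV : ∀ a b : ℤ, -2 ≤ a ∧ a ≤ w + 1 ∧ y - 3 ≤ b ∧ b ≤ y + 1 → (a, b) ∈ V)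
    (h : ∀ T', MirPlaced T₀ w y x T' → WS body V K Post s n (cfg body
      (placeCode (decide ((x, y) ∈ T₀))) T' (w - 1 - x, y - 2))) :
    WS body V K Post (s + 3) (n + 2 * w + 10)
      (cfg body (goto (mirHead (decide (x = 0)))) T (x, y - 1)) := by
  obtain ⟨hw, he, hleft, hright⟩ := hl
  refine WS.enter ?_ rfl
  dsimp only [Label.body]
  refine WS.putU ?_ (hV _ _ (by omega))
  refine WS.takeD (decide ((x, y) ∈ T₀)) ?_ ?_ (hV _ _ (by omega))
  · have := hT x y
    grind [mem_upd]
  refine WS.mvR ?_ (hV _ _ (by omega))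
  refine WS.walkR w (n + w + 6) rfl ?_ (by omega) (by omega) ?_
    fun i _ _ => hV _ _ (by omega)
  swap
  · intro i hi hi'
    have := hT i (y - 1)
    have := he i (y - 1)
    grind [mem_upd]
  refine WS.enter ?_ rfl
  refine WS.hitD ?_ ?_ (hV _ _ (by omega))
  · have := hT w (y-1)
    have := hright (y-1)
    grind [mem_upd]
  refine WS.mvL ?_ (hV _ _ (by omega))
  -- For the first pixel there is no target token yet, and the target is next to the right wall.
  -- Later, the token marks the previous target in column `w - x`.
  by_cases hx0 : x = 0
  · rw [if_pos (decide_eq_true hx0)]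
    refine WS.finish (h _ fun a b => ?_) (by omega) (by omega) (by simp; omega)
    have h1 := hT a b
    have := he a b
    clear hV h he hleft hright hT
    simp only [mem_upd, ne_eq, Prod.mk.injEq, h1]
    grind
  · rw [if_neg (by simpa using hx0)]
    refine WS.walkL (w - x) (n + 1) rfl ?_ (by omega) (by omega) ?_
      fun i _ _ => hV _ _ (by omega)
    swap
    · intro i hi hi'
      have := hT i (y - 1 + 1 - 1 - 1)
      have := he i (y - 1 + 1 - 1 - 1)
      grind [mem_upd]
    refine WS.enter ?_ rfl
    refine WS.hitEraseL ?_ ?_ (hV _ _ (by omega))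
    · have := hT (w - x) (y - 1 + 1 - 1 - 1)
      grind [mem_upd]
    refine WS.finish (h _ fun a b => ?_) (by omega) (by omega) (by simp; omega)
    have h1 := hT a b
    have := he a b
    clear hV h he hleft hright hT
    simp only [mem_upd, ne_eq, Prod.mk.injEq, h1]
    grind

theorem mir_step {w : ℕ} {x y : ℤ} (hl : MirLane T₀ w y) (hx : 0 ≤ x) (hxw : x + 1 < w)
    (hT : MirRow T₀ w y x T)
    (hV : ∀ a b : ℤ, -2 ≤ a ∧ a ≤ w + 1 ∧ y - 3 ≤ b ∧ b ≤ y + 1 → (a, b) ∈ V)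
    (h : ∀ T', MirRow T₀ w y (x + 1) T' →
      WS body V K Post s n (cfg body (goto (mirHead false)) T' (x + 1, y - 1))) :
    WS body V K Post (s + 7) (n + 4 * w + 20)
      (cfg body (goto (mirHead (decide (x = 0)))) T (x, y - 1)) := by
  refine (mir_head (s := s + 4) (n := n + 2 * w + 10) hl hx (by omega) hT hV
    fun T' hT' => ?_).mono (by omega) (by omega)
  obtain ⟨hw, he, hleft, hright⟩ := hl
  refine WS.putD ?_ (hV _ _ (by omega))
  refine WS.putU ?_ (hV _ _ (by omega))
  refine WS.mvL ?_ (hV _ _ (by omega))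
  -- As `x + 1 < w`, the target is not in column `0`, so the pixel to its left belongs to the lane
  -- and is empty. This is how the robot learns that the row is not done.
  refine WS.act_keep (f := fun b => if b then (true, Dir.right) else (false, Dir.left)) false ?_ rfl ?_ (hV _ _ (by omega))
  · have := hT' (w - 1 - x - 1) (y - 2 - 1 + 1)
    have := he (w - 1 - x - 1) (y - 2 - 1 + 1)
    grind [mem_upd]
  dsimp only [Dir.move, Bool.false_eq_true, if_false]
  refine WS.walkL (-1) (n + w + 6) rfl ?_ (by omega) (by omega) ?_
    fun i _ _ => hV _ _ (by omega)
  swap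
  · intro i hi hi'
    have := hT' i (y - 2 - 1 + 1)
    have := he i (y - 2 - 1 + 1)
    grind [mem_upd]
  refine WS.enter ?_ rfl
  refine WS.hitU ?_ ?_ (hV _ _ (by omega))
  · have := hT' (-1) (y - 2 - 1 + 1)
    have := hleft (y - 2 - 1 + 1)
    grind [mem_upd]
  refine WS.mvR ?_ (hV _ _ (by omega))
  refine WS.walkR x (n + 4) rfl ?_ (by omega) (by omega) ?_
    fun i _ _ => hV _ _ (by omega)
  swap
  · intro i hi hi'
    have := hT' i (y - 2 - 1 + 1 + 1)
    have := he i (y - 2 - 1 + 1 + 1)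
    grind [mem_upd]
  refine WS.enter ?_ rfl
  refine WS.hitEraseR ?_ ?_ (hV _ _ (by omega))
  · have := hT' x (y - 2 - 1 + 1 + 1)
    grind [mem_upd]
  refine WS.finish (h _ fun a b => ?_) (by omega) (by omega) (by simp; omega)
  have h1 := hT' a b
  have := he a b
  have := hleft b
  have : a = w - 1 - x → ((w - 1 - a, y) ∈ T₀ ↔ (x, y) ∈ T₀) := by rintro rfl; simp
  clear hV h he hleft hright hT hT'
  simp only [mem_upd, ne_eq, Prod.mk.injEq, h1]
  grind

/-- The tiles when a row has been mirrored. -/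
def MirDone (T₀ : Finset Pixel) (w : ℕ) (y : ℤ) (T : Finset Pixel) : Prop :=
  ∀ a b : ℤ, (a, b) ∈ T ↔ (b = y - 3 ∧ 0 ≤ a ∧ a < w ∧ (w - 1 - a, y) ∈ T₀) ∨
    (¬ (0 ≤ a ∧ a < w ∧ (b = y ∨ b = y - 3)) ∧ (a, b) ∈ T₀)

theorem mir_last {w : ℕ} {x y : ℤ} (hl : MirLane T₀ w y) (hx : 0 ≤ x) (hxw : x + 1 = w)
    (hT : MirRow T₀ w y x T)
    (hV : ∀ a b : ℤ, -2 ≤ a ∧ a ≤ w + 1 ∧ y - 3 ≤ b ∧ b ≤ y + 1 → (a, b) ∈ V)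
    (h : ∀ T', MirDone T₀ w y T' → WS body V K Post s n
      (if (-1, y) ∈ T₀ then cfg body (goto (mirHead true)) T' (0, y)
        else cfg body (goto fillTop) T' (0, y - 2))) :
    WS body V K Post (s + 7) (n + 4 * w + 20)
      (cfg body (goto (mirHead (decide (x = 0)))) T (x, y - 1)) := by
  have hfin : ∀ T', MirDone T₀ w y T' → WS body V K Post s (n + 3) (cfg body
      (act (fun more => if more = true then (true, Dir.right) else (false, Dir.down)) fun more =>
        if more = true then goto (mirHead true) else mv .down (mv .right (goto fillTop)))
      T' (-1, y)) := by
    intro T' hT'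
    have h' := h _ hT'
    have hm' := hT' (-1) y
    by_cases hm : (-1, y) ∈ T₀
    · rw [if_pos hm] at h'
      refine WS.act_keep (f := fun more => if more then (true, Dir.right) else (false, Dir.down))
        true (by grind) rfl ?_ (hV _ _ (by omega))
      exact WS.finish h' (by omega) (by omega) (by simp [Dir.move])
    · rw [if_neg hm] at h'
      refine WS.act_keep (f := fun more => if more then (true, Dir.right) else (false, Dir.down))
        false (by grind) rfl ?_ (hV _ _ (by omega))
      dsimp only [Dir.move, Bool.false_eq_true, if_false]
      refine WS.mvD ?_ (hV _ _ (by omega))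
      refine WS.mvR ?_ (hV _ _ (by omega))
      exact WS.finish h' (by omega) (by omega) (by simp; omega)
  refine (mir_head (s := s + 4) (n := n + 2 * w + 10) hl hx (by omega) hT hV
    fun T' hT' => ?_).mono (by omega) (by omega)
  obtain ⟨hw, he, hleft, hright⟩ := hl
  refine WS.putD ?_ (hV _ _ (by omega))
  refine WS.putU ?_ (hV _ _ (by omega))
  refine WS.mvL ?_ (hV _ _ (by omega))
  -- The last target is in column `0`, so the pixel to its left is the wall: the row is done, and
  -- both tokens are removed.
  refine WS.hitR ?_ ?_ (hV _ _ (by omega))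
  · have := hT' (w - 1 - x - 1) (y - 2 - 1 + 1)
    have := hleft (y - 2 - 1 + 1)
    grind [mem_upd]
  refine WS.putU ?_ (hV _ _ (by omega))
  refine WS.walkR x (n + w + 5) rfl ?_ (by omega) (by omega) ?_ fun i _ _ => hV _ _ (by omega)
  swap
  · intro i hi hi'
    have := hT' i (y - 2 - 1 + 1 + 1)
    have := he i (y - 2 - 1 + 1 + 1)
    grind [mem_upd]
  refine WS.enter ?_ rfl
  refine WS.hitEraseL ?_ ?_ (hV _ _ (by omega))
  · have := hT' x (y - 2 - 1 + 1 + 1)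
    grind [mem_upd]
  refine WS.walkL (-1) (n + 4) rfl ?_ (by omega) (by omega) ?_ fun i _ _ => hV _ _ (by omega)
  swap
  · intro i hi hi'
    have := hT' i (y - 2 - 1 + 1 + 1)
    have := he i (y - 2 - 1 + 1 + 1)
    grind [mem_upd]
  refine WS.enter ?_ rfl
  refine WS.hitU ?_ ?_ (hV _ _ (by omega))
  · have := hT' (-1) (y - 2 - 1 + 1 + 1)
    have := hleft (y - 2 - 1 + 1 + 1)
    grind [mem_upd]
  refine WS.finish (hfin _ fun a b => ?_) (by omega) (by omega) (by simp; omega)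
  have h1 := hT' a b
  have := he a b
  have := hleft b
  have : a = w - 1 - x → ((w - 1 - a, y) ∈ T₀ ↔ (x, y) ∈ T₀) := by rintro rfl; simp
  clear hV h hfin he hleft hright hT hT'
  simp only [mem_upd, ne_eq, Prod.mk.injEq, h1]
  grind

theorem mir_row {w N : ℕ} {y : ℤ} (hl : MirLane T₀ w y) (hK : T₀.card + 8 ≤ K)
    (hV : ∀ a b : ℤ, -2 ≤ a ∧ a ≤ w + 1 ∧ y - 3 ≤ b ∧ b ≤ y + 1 → (a, b) ∈ V)
    (h : ∀ T', MirDone T₀ w y T' → WP body V K Post N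
      (if (-1, y) ∈ T₀ then cfg body (goto (mirHead true)) T' (0, y)
        else cfg body (goto fillTop) T' (0, y - 2))) :
    WP body V K Post (N + w * (4 * w + 20)) (cfg body (goto (mirHead true)) T₀ (0, y - 1)) := by
  -- Induction on the number of pixels of the row that remain after the pixel in column `x`.
  suffices H : ∀ (m : ℕ) (x : ℤ) (T : Finset Pixel), 0 ≤ x → x + (m + 1) = w → MirRow T₀ w y x T →
      WP body V K Post (N + (m + 1) * (4 * w + 20))
        (cfg body (goto (mirHead (decide (x = 0)))) T (x, y - 1)) by
    obtain ⟨m, rfl⟩ : ∃ m, w = m + 1 := ⟨w - 1, by have := hl.wpos; omega⟩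
    refine H m 0 T₀ le_rfl (by push_cast; ring) fun a b => ?_
    have := hl.empty a b
    grind
  intro m
  induction m with
  | zero =>
    intro x T hx hxw hT
    have := mir_last (K := K) (s := 0) (n := N) hl hx (by omega) hT hV fun T' hT' _ => h T' hT'
    exact (this (by have := hT.card_le; simp only [cfg]; omega)).mono (by omega)
  | succ m ih =>
    intro x T hx hxw hT
    have := mir_step (K := K) (s := 0) (n := N + (m + 1) * (4 * w + 20)) hl hx (by omega) hT hV
      fun T' hT' _ => by
        have := ih (x + 1) T' (by omega) (by push_cast at hxw ⊢; linarith) hT'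
        rwa [decide_eq_false (by omega)] at this
    exact (this (by have := hT.card_le; simp only [cfg]; omega)).mono (by ring_nf; omega)

/-- The tiles while the rows are being mirrored: the rows below `y` are done. -/
def MirRows (T₀ : Finset Pixel) (w h : ℕ) (y : ℤ) (T : Finset Pixel) : Prop :=
  ∀ a b : ℤ, (a, b) ∈ T ↔ (0 ≤ a ∧ a < w ∧ -3 ≤ b ∧ b < h ∧
      ((b < y - 3 ∧ (w - 1 - a, b + 3) ∈ T₀) ∨ (y ≤ b ∧ (a, b) ∈ T₀))) ∨
    (¬ (0 ≤ a ∧ a < w ∧ -3 ≤ b ∧ b < h) ∧ (a, b) ∈ T₀)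

theorem MirRows.card_le {w h : ℕ} {y : ℤ} (hT : MirRows T₀ w h y T) (hy : y ≤ h) :
    T.card ≤ T₀.card := by
  refine card_le_of_image (E := ∅) (fun p =>
    if 0 ≤ p.1 ∧ p.1 < w ∧ 0 ≤ p.2 ∧ p.2 < h ∧ p.2 < y then ((w : ℤ) - 1 - p.1, p.2 - 3) else p) ?_
  rintro ⟨a, b⟩ hp
  rcases (hT a b).1 hp with ⟨h1, h2, h3, h4, h5 | h5⟩ | h5
  · refine Or.inr ⟨_, h5.2, ?_⟩
    rw [if_pos (by simp only; omega)]
    ext <;> simp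
  · exact Or.inr ⟨(a, b), h5.2, if_neg (by simp only; omega)⟩
  · exact Or.inr ⟨(a, b), h5.2, if_neg (by simp only; omega)⟩

/-- A mirrored row leaves its place empty, so after it the two lanes below the next row are empty
again. The gap of the left wall at height `h - 1` tells the robot that this row is the last one. -/
theorem mir_rows {w h N : ℕ} (hw : 0 < w) (hh : 0 < h)
    (he : ∀ a b : ℤ, 0 ≤ a → a < w → -3 ≤ b → b < 0 → (a, b) ∉ T₀)
    (hleft : ∀ b : ℤ, -2 ≤ b → b ≤ h - 1 → ((-1, b) ∈ T₀ ↔ b < h - 1))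
    (hright : ∀ b : ℤ, -2 ≤ b → b < h - 1 → ((w : ℤ), b) ∈ T₀) (hK : T₀.card + 8 ≤ K)
    (hV : ∀ a b : ℤ, -2 ≤ a ∧ a ≤ w + 1 ∧ -3 ≤ b ∧ b ≤ h → (a, b) ∈ V)
    (H : ∀ T', MirRows T₀ w h h T' → WP body V K Post N (cfg body (goto fillTop) T' (0, h - 3))) :
    WP body V K Post (N + h * (w * (4 * w + 20))) (cfg body (goto (mirHead true)) T₀ (0, -1)) := by
  suffices H' : ∀ (m : ℕ) (y : ℤ) (T : Finset Pixel), 0 ≤ y → y + (m + 1) = h →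
      MirRows T₀ w h y T → WP body V K Post (N + (m + 1) * (w * (4 * w + 20)))
        (cfg body (goto (mirHead true)) T (0, y - 1)) by
    obtain ⟨m, rfl⟩ : ∃ m, h = m + 1 := ⟨h - 1, by omega⟩
    refine H' m 0 T₀ le_rfl (by push_cast; ring) fun a b => ?_
    have := he a b
    grind
  have hlane : ∀ (y : ℤ) (T : Finset Pixel), 0 ≤ y → y < h → MirRows T₀ w h y T →
      MirLane T w y := fun y T h0 h1 hT =>
    ⟨hw, fun a b _ _ _ _ => by have := hT a b; grind,
      fun b _ _ => by have := hT (-1) b; have := hleft b; grind,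
      fun b _ _ => by have := hT w b; have := hright b; grind⟩
  have hnext : ∀ (y : ℤ) (T T' : Finset Pixel), 0 ≤ y → y < h → MirRows T₀ w h y T →
      MirDone T w y T' → MirRows T₀ w h (y + 1) T' := by
    intro y T T' h0 h1 hT hT' a b
    have h1 := hT' a b
    have h2 := hT a b
    have h3 := hT (w - 1 - a) y
    have : b = y - 3 → b + 3 = y := by omega
    rw [h1, h2, h3]
    clear h1 h2 h3 hT hT' hlane H hright hleft hV
    grind
  have hmore : ∀ (y : ℤ) (T : Finset Pixel), 0 ≤ y → y < h → MirRows T₀ w h y T →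
      ((-1, y) ∈ T ↔ y < h - 1) := fun y T h0 h1 hT => by
    have := hT (-1) y
    have := hleft y
    grind
  intro m
  induction m with
  | zero =>
    intro y T h0 h1 hT
    refine (mir_row (N := N) (hlane y T h0 (by omega) hT)
      (by have := hT.card_le (by omega); omega) (fun a b hab => hV a b (by omega))
      fun T' hT' => ?_).mono (by omega)
    rw [if_neg (by rw [hmore y T h0 (by omega) hT]; omega)]
    have e : (h : ℤ) = y + 1 := by omega
    have := H T' (by rw [e]; exact e ▸ hnext y T T' h0 (by omega) hT hT')
    rwa [show y - 2 = (h : ℤ) - 3 by omega]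
  | succ m ih =>
    intro y T h0 h1 hT
    push_cast at h1
    refine (mir_row (N := N + (m + 1) * (w * (4 * w + 20))) (hlane y T h0 (by omega) hT)
      (by have := hT.card_le (by omega); omega) (fun a b hab => hV a b (by omega))
      fun T' hT' => ?_).mono (by ring_nf; omega)
    rw [if_pos (by rw [hmore y T h0 (by omega) hT]; omega)]
    have := ih (y + 1) T' (by omega) (by omega) (hnext y T T' h0 (by omega) hT hT')
    rwa [show y + 1 - 1 = y by omega] at this

/-! ### Walls around the polyomino -/

/-- The tiles when the bounding box has been found. -/
def Boxed (P : Finset Pixel) (w h : ℕ) (T : Finset Pixel) : Prop :=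
  ∀ a b : ℤ, (a, b) ∈ T ↔ (a, b) ∈ P ∨ (a = w ∧ b = h) ∨ (a = w - 1 ∧ b = h + 1) ∨
    (a = -1 ∧ b = h) ∨ (a = -2 ∧ b = h - 1) ∨ (a = -1 ∧ b = -1) ∨ (a = 0 ∧ b = -2) ∨
    (a = w ∧ b = -1) ∨ (a = w + 1 ∧ b = 0)

/-- The tiles when the walls for mirroring have been built. -/
def Walled (P : Finset Pixel) (w h : ℕ) (T : Finset Pixel) : Prop :=
  ∀ a b : ℤ, (a, b) ∈ T ↔ (a, b) ∈ P ∨ (a = w ∧ -5 ≤ b ∧ b ≤ h) ∨ (a = -1 ∧ -2 ≤ b ∧ b ≤ h - 2)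

/-- The tiles when the walls for transposing have been built. -/
def Framed (P : Finset Pixel) (w h : ℕ) (T : Finset Pixel) : Prop :=
  ∀ a b : ℤ, (a, b) ∈ T ↔ (0 ≤ a ∧ a < w ∧ -3 ≤ b ∧ b < h - 3 ∧ (w - 1 - a, b + 3) ∈ P) ∨
    (a = w ∧ -5 ≤ b ∧ b ≤ h - 5) ∨ (b = h - 3 ∧ -2 ≤ a ∧ a ≤ w - 2) ∨ (a = -2 ∧ b = -5)

/-- The tiles of the corner marks serve as stops: `(w, h)` ends the right wall, `(-1, h)` the walk
along the top, and `(-1, -1)` the downward loop at the left. The right wall extends down to `-5`,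
because its part from `-5` to `h - 5` is reused for the transposition. -/
theorem setup_walls {w h : ℕ} (hw : 0 < w) (hh : 0 < h)
    (hP : ∀ a b : ℤ, (a, b) ∈ P → 0 ≤ a ∧ a < w ∧ 0 ≤ b ∧ b < h) (hT : Boxed P w h T)
    (hV : ∀ a b : ℤ, -2 ≤ a ∧ a ≤ w + 1 ∧ -5 ≤ b ∧ b ≤ h + 1 → (a, b) ∈ V)
    (H : ∀ T', Walled P w h T' →
      WS body V K Post s n (cfg body (goto (mirHead true)) T' (0, -1))) :
    WS body V K Post (s + 2 * h + 12) (n + w + 2 * h + 30) (cfg body (goto setup) T (w, 0)) := by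
  refine WS.enter ?_ rfl
  refine WS.mvR ?_ (hV _ _ (by omega))
  refine WS.putL ?_ (hV _ _ (by omega))
  refine WS.mvD ?_ (hV _ _ (by omega))
  refine WS.mvD ?_ (hV _ _ (by omega))
  refine WS.putD ?_ (hV _ _ (by omega))
  refine WS.putD ?_ (hV _ _ (by omega))
  refine WS.putD ?_ (hV _ _ (by omega))
  refine WS.putU ?_ (hV _ _ (by omega))
  refine WS.mvU ?_ (hV _ _ (by omega))
  refine WS.mvU ?_ (hV _ _ (by omega))
  refine WS.mvU ?_ (hV _ _ (by omega))
  refine WS.mvU ?_ (hV _ _ (by omega))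
  refine WS.fillU h (s + h + 6) (n + w + h + 17) rfl (fun T₁ hT₁ => ?_) (by omega) (by omega)
    (by omega) (fun i _ _ => ?_) fun i _ _ => hV _ _ (by omega)
  swap
  · have := hT (w + 1 - 1) i
    have := hP (w + 1 - 1) i
    grind [mem_upd]
  have h1 : ∀ a b : ℤ, (a, b) ∈ T₁ ↔ (a, b) ∈ P ∨ (a = w ∧ -5 ≤ b ∧ b ≤ h) ∨
      (a = w - 1 ∧ b = h + 1) ∨ (a = -1 ∧ b = h) ∨ (a = -2 ∧ b = h - 1) ∨ (a = -1 ∧ b = -1) ∨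
      (a = 0 ∧ b = -2) := by
    intro a b
    have h1 := hT a b
    have := hP a b
    rw [hT₁]
    clear hV H hP hT hT₁
    simp only [mem_upd, ne_eq, Prod.mk.injEq, h1]
    grind (splits := 30)
  clear hT₁
  refine WS.enter ?_ rfl
  refine WS.hitU ?_ ?_ (hV _ _ (by omega))
  · grind
  refine WS.mvL ?_ (hV _ _ (by omega))
  refine WS.putD ?_ (hV _ _ (by omega))
  refine WS.walkL (-1) (n + h + 11) rfl ?_ (by omega) (by omega) (fun i _ _ => ?_)
    fun i _ _ => hV _ _ (by omega)
  swap
  · have := hP i (h + 1 - 1)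
    grind [mem_upd]
  refine WS.enter ?_ rfl
  refine WS.hitEraseL ?_ ?_ (hV _ _ (by omega))
  · grind [mem_upd]
  refine WS.mvD ?_ (hV _ _ (by omega))
  refine WS.putR ?_ (hV _ _ (by omega))
  refine WS.mvD ?_ (hV _ _ (by omega))
  refine WS.fillD (-1) (s + 2) (n + 4) rfl (fun T₂ hT₂ => ?_) (by omega) (by omega)
    (by omega) (fun i _ _ => ?_) fun i _ _ => hV _ _ (by omega)
  swap
  · have := hP (-1 - 1 + 1) i
    grind [mem_upd]
  have h2 : ∀ a b : ℤ, (a, b) ∈ T₂ ↔ (a, b) ∈ P ∨ (a = w ∧ -5 ≤ b ∧ b ≤ h) ∨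
      (a = -1 ∧ -1 ≤ b ∧ b ≤ h - 2) ∨ (a = 0 ∧ b = -2) := by
    intro a b
    have h1 := h1 a b
    have := hP a b
    rw [hT₂]
    clear hV H hP hT hT₂
    simp only [mem_upd, ne_eq, Prod.mk.injEq, h1]
    grind (splits := 30)
  clear hT₂
  refine WS.enter ?_ rfl
  refine WS.hitD ?_ ?_ (hV _ _ (by omega))
  · grind
  refine WS.putR ?_ (hV _ _ (by omega))
  refine WS.putU ?_ (hV _ _ (by omega))
  refine WS.finish (H _ fun a b => ?_) (by omega) (by omega) (by simp)
  have h2 := h2 a b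
  have := hP a b
  clear hV H hP hT
  simp only [mem_upd, ne_eq, Prod.mk.injEq, h2]
  grind

/-- The right wall is shortened from above and the left wall is replaced by a top wall. The ends are
chosen such that the frame, seen from the corner tile `(-2, -5)`, is symmetric under transposition
together with exchanging `w` and `h`; `stage_zero_turned` depends on it. -/
theorem setup_frame {w h : ℕ} (hw : 0 < w) (hh : 0 < h)
    (hP : ∀ a b : ℤ, (a, b) ∈ P → 0 ≤ a ∧ a < w ∧ 0 ≤ b ∧ b < h) (hT₀ : Walled P w h T₀)
    (hT : MirRows T₀ w h h T)
    (hV : ∀ a b : ℤ, -2 ≤ a ∧ a ≤ w + 1 ∧ -5 ≤ b ∧ b ≤ h + 1 → (a, b) ∈ V)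
    (H : ∀ T', Framed P w h T' →
      WS body V K Post s n (cfg body (goto (stage true)) T' (-2, -4))) :
    WS body V K Post (s + w + 10) (n + 2 * w + h + 30)
      (cfg body (goto fillTop) T (0, h - 3)) := by
  have h0 : ∀ a b : ℤ, (a, b) ∈ T ↔
      (0 ≤ a ∧ a < w ∧ -3 ≤ b ∧ b < h - 3 ∧ (w - 1 - a, b + 3) ∈ P) ∨
      (a = w ∧ -5 ≤ b ∧ b ≤ h) ∨ (a = -1 ∧ -2 ≤ b ∧ b ≤ h - 2) := by
    intro a b
    have h1 := hT a b
    have := hP a b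
    rw [hT₀ a b, hT₀ (w - 1 - a)] at h1
    clear hV H hP hT hT₀
    grind
  clear hT hT₀
  refine WS.fillR w (s + 10) (n + w + h + 30) rfl (fun T₁ hT₁ => ?_) (by omega) (by omega)
    (by omega) (fun i _ _ => by grind) fun i _ _ => hV _ _ (by omega)
  refine WS.enter ?_ rfl
  refine WS.hitEraseD ?_ ?_ (hV _ _ (by omega))
  · grind
  refine WS.putU ?_ (hV _ _ (by omega))
  refine WS.mvU ?_ (hV _ _ (by omega))
  refine WS.putU ?_ (hV _ _ (by omega))
  refine WS.putU ?_ (hV _ _ (by omega))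
  refine WS.putL ?_ (hV _ _ (by omega))
  refine WS.mvD ?_ (hV _ _ (by omega))
  refine WS.mvD ?_ (hV _ _ (by omega))
  refine WS.mvD ?_ (hV _ _ (by omega))
  refine WS.putU ?_ (hV _ _ (by omega))
  refine WS.walkL (-1) (n + h + 9) rfl ?_ (by omega) (by omega) (fun i _ _ => ?_)
    fun i _ _ => hV _ _ (by omega)
  swap
  · rw [show (h : ℤ) - 3 - 1 + 1 + 1 + 1 + 1 - 1 - 1 - 1 + 1 = h - 2 by ring]
    simp only [mem_upd, hT₁, h0]
    grind
  refine WS.enter ?_ rfl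
  refine WS.hitEraseL ?_ ?_ (hV _ _ (by omega))
  · rw [show (h : ℤ) - 3 - 1 + 1 + 1 + 1 + 1 - 1 - 1 - 1 + 1 = h - 2 by ring]
    simp only [mem_upd, hT₁, h0]
    grind
  refine WS.mvD ?_ (hV _ _ (by omega))
  refine WS.putR ?_ (hV _ _ (by omega))
  refine WS.mvD ?_ (hV _ _ (by omega))
  refine WS.eraseD (-3) (n + 4) rfl (fun T₂ hT₂ => ?_) (by omega) (by omega)
    (fun i _ _ => ?_) fun i _ _ => hV _ _ (by omega)
  swap
  · have : h - 3 - 1 + 1 + 1 + 1 + 1 - 1 - 1 - 1 + 1 - 1 - 1 = (h : ℤ) - 4 := by ring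
    simp only [mem_upd, hT₁, h0, ne_eq, Prod.mk.injEq]
    clear hV H hP hT₁ h0
    grind (splits := 30)
  refine WS.enter ?_ rfl
  refine WS.act (f := fun b => if b then (false, Dir.down) else (false, Dir.left)) false ?_ ?_ (hV _ _ (by omega))
  · simp only [hT₂, mem_upd, hT₁, h0, ne_eq, Prod.mk.injEq]
    clear hV H hP hT₁ hT₂ h0
    grind
  dsimp only [Dir.move, Bool.false_eq_true, if_false]
  refine WS.mvD ?_ (hV _ _ (by omega))
  refine WS.mvD ?_ (hV _ _ (by omega))
  refine WS.putU ?_ (hV _ _ (by omega))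
  refine WS.finish (H _ fun a b => ?_) (by omega) (by omega) (by simp)
  have h1 := h0 a b
  have := hP a b
  simp only [mem_upd, ne_eq, Prod.mk.injEq, hT₂, hT₁, h1]
  clear hV H hP hT₁ hT₂ h0
  grind (splits := 30)

/-- The tiles while an L-shaped layer with corner `(1, 1)` is being transposed: the pixels of the
layer before the position `i` of the tokens are done; the right token is not set yet. -/
def Layer (T₀ : Finset Pixel) (i : ℤ) (T : Finset Pixel) : Prop :=
  ∀ a b : ℤ, (a, b) ∈ T ↔ (a = -1 ∧ b = -1 ∧ (1, 1) ∈ T₀) ∨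
    (a = -1 ∧ 0 ≤ b ∧ b < i - 2 ∧ (b + 2, 1) ∈ T₀) ∨
    (b = -1 ∧ 0 ≤ a ∧ a < i - 2 ∧ (1, a + 2) ∈ T₀) ∨ (a = 0 ∧ b = i) ∨
    (¬ (a = -1 ∧ -1 ≤ b ∧ b < i - 2) ∧ ¬ (b = -1 ∧ -1 ≤ a ∧ a < i - 2) ∧
      ¬ (b = 1 ∧ 1 ≤ a ∧ a < i) ∧ ¬ (a = 1 ∧ 1 ≤ b ∧ b < i) ∧ (a, b) ∈ T₀)

theorem Layer.card_le {i : ℤ} (hi : 2 ≤ i) (hT : Layer T₀ i T) : T.card ≤ T₀.card + 1 := by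
  refine card_le_of_image (E := {((0 : ℤ), i)}) (fun p =>
    if p.2 = 1 ∧ 1 ≤ p.1 ∧ p.1 < i then ((-1 : ℤ), p.1 - 2)
    else if p.1 = 1 ∧ 1 ≤ p.2 ∧ p.2 < i then (p.2 - 2, -1) else p) ?_
  rintro ⟨a, b⟩ hp
  rcases (hT a b).1 hp with ⟨rfl, rfl, h⟩ | ⟨rfl, h1, h2, h⟩ | ⟨rfl, h1, h2, h⟩ | ⟨rfl, rfl⟩ | h
  · exact Or.inr ⟨_, h, by rw [if_pos (by grind)]; rfl⟩
  · exact Or.inr ⟨_, h, by rw [if_pos (by grind)]; ext <;> simp⟩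
  · exact Or.inr ⟨_, h, by
      rw [if_neg (by grind), if_pos (by grind)]; ext <;> simp⟩
  · simp
  · exact Or.inr ⟨_, h.2.2.2.2, by
      rw [if_neg (by grind), if_neg (by grind)]⟩

/-! ### Transposing a layer -/

/-- The lanes beside the layer are empty before the position `k`, and start at a tile. -/
structure Lanes (T₀ : Finset Pixel) (k : ℤ) : Prop where
  two_le : 2 ≤ k
  corner : (0, 0) ∈ T₀
  row : ∀ j : ℤ, 1 ≤ j → j < k → (j, 0) ∉ T₀
  col : ∀ j : ℤ, 1 ≤ j → j < k → (0, j) ∉ T₀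

/-- The diagonal pixel `(1, 1)` is its own partner, so it is moved on its own. The token in the
vertical lane is set at the same time, and what it covers decides whether the top wall has been
reached. -/
theorem layer_start {k : ℤ} {first : Bool} (hl : Lanes T₀ k)
    (hV : ∀ a b : ℤ, -1 ≤ a ∧ a ≤ k + 1 ∧ -1 ≤ b ∧ b ≤ k + 1 ∧ (a ≤ 1 ∨ b ≤ 1) → (a, b) ∈ V)
    (h : ∀ T', Layer T₀ 2 T' → WS body V K Post s n
      (cfg body (nextCode first (decide ((0, 2) ∈ T₀))) T' (2, 0))) :
    WS body V K Post (s + 5) (n + 15) (cfg body (goto (stage first)) T₀ (0, 1)) := by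
  obtain ⟨hk, hc, hrow, hcol⟩ := hl
  refine WS.enter ?_ rfl
  refine WS.mvR ?_ (hV _ _ (by omega))
  refine WS.takeL (decide ((1, 1) ∈ T₀)) (by simp) ?_ (hV _ _ (by omega))
  refine WS.mvL ?_ (hV _ _ (by omega))
  refine WS.mvD ?_ (hV _ _ (by omega))
  refine WS.mvD ?_ (hV _ _ (by omega))
  refine WS.putU ?_ (hV _ _ (by omega))
  refine WS.mvU ?_ (hV _ _ (by omega))
  refine WS.mvR ?_ (hV _ _ (by omega))
  refine WS.mvU ?_ (hV _ _ (by omega))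
  refine WS.takeD (decide ((0, 2) ∈ T₀)) (by simp [mem_upd]) ?_ (hV _ _ (by omega))
  refine WS.mvD ?_ (hV _ _ (by omega))
  refine WS.mvR ?_ (hV _ _ (by omega))
  refine WS.mvR ?_ (hV _ _ (by omega))
  refine WS.finish (h _ fun a b => ?_) (by omega) (by omega) (by simp)
  simp only [mem_upd, ne_eq, Prod.mk.injEq]
  clear hV h hrow hcol
  grind (splits := 30)

/-- The pixels `(i, 1)` and `(1, i)` are carried past the corner tile `(0, 0)` and written to `(-1,
i - 2)` and `(i - 2, -1)`. Each token is advanced when the robot is at it, so that it can find the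
next pair. -/
theorem layer_step {i k : ℤ} {first : Bool} (hl : Lanes T₀ k) (hi : 2 ≤ i) (hik : i < k)
    (hT : Layer T₀ i T)
    (hV : ∀ a b : ℤ, -1 ≤ a ∧ a ≤ k + 1 ∧ -1 ≤ b ∧ b ≤ k + 1 ∧ (a ≤ 1 ∨ b ≤ 1) → (a, b) ∈ V)
    (h : ∀ T', Layer T₀ (i + 1) T' → WS body V K Post s n
      (cfg body (nextCode first (decide ((0, i + 1) ∈ T₀))) T' (i + 1, 0))) :
    WS body V K Post (s + 10) (n + 4 * k.toNat + 20)
      (cfg body (nextCode first false) T (i, 0)) := by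
  obtain ⟨hk, hc, hrow, hcol⟩ := hl
  have hki : ((k.toNat : ℕ) : ℤ) = k := by omega
  refine WS.act (s := s + 9) (n := n + 4 * k.toNat + 19) (f := fun r => if r || false then
      if first && !false then (true, .left) else if first && !r then (false, .right) else (r, .up)
    else (true, .up)) false ?_ ?_ (hV _ _ (by omega))
  · have := hT i 0
    have := hrow i
    grind
  dsimp only [Dir.move, Bool.false_eq_true, Bool.or_false, if_false]
  refine WS.enter ?_ rfl
  refine WS.takeD (decide ((i, 1) ∈ T₀)) ?_ ?_ (hV _ _ (by omega))
  · have := hT i (0 + 1)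
    simp only [mem_upd]
    grind
  refine WS.mvL ?_ (hV _ _ (by omega))
  refine WS.walkL 0 (n + 3 * k.toNat + 18) rfl ?_ (by omega) (by omega) (fun j _ _ => ?_)
    fun i _ _ => hV _ _ (by omega)
  swap
  · have := hT j (0 + 1 - 1)
    have := hrow j
    simp only [mem_upd]
    grind
  refine WS.enter ?_ rfl
  refine WS.hitU ?_ ?_ (hV _ _ (by omega))
  · have := hT 0 (0 + 1 - 1)
    simp only [mem_upd]
    grind
  refine WS.walkU i (n + 2 * k.toNat + 17) rfl ?_ (by omega) (by omega) (fun j _ _ => ?_)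
    fun i _ _ => hV _ _ (by omega)
  swap
  · have := hT 0 j
    have := hcol j
    simp only [mem_upd]
    grind
  refine WS.enter ?_ rfl
  refine WS.hitEraseR ?_ ?_ (hV _ _ (by omega))
  · have := hT 0 i
    simp only [mem_upd]
    grind
  refine WS.takeL (decide ((1, i) ∈ T₀)) ?_ ?_ (hV _ _ (by omega))
  · have := hT (0 + 1) i
    simp only [mem_upd]
    grind
  refine WS.mvL ?_ (hV _ _ (by omega))
  refine WS.mvD ?_ (hV _ _ (by omega))
  refine WS.mvD ?_ (hV _ _ (by omega))
  refine WS.putU ?_ (hV _ _ (by omega))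
  refine WS.mvU ?_ (hV _ _ (by omega))
  refine WS.mvU ?_ (hV _ _ (by omega))
  refine WS.mvR ?_ (hV _ _ (by omega))
  refine WS.takeD (decide ((0, i + 1) ∈ T₀)) ?_ ?_ (hV _ _ (by omega))
  · have := hT (-1 + 1) (i - 1 - 1 + 1 + 1 + 1)
    simp only [mem_upd]
    grind
  refine WS.walkD 0 (n + k.toNat + 8) rfl ?_ (by omega) (by omega) (fun j _ _ => ?_)
    fun i _ _ => hV _ _ (by omega)
  swap
  · have := hT (-1 + 1) j
    have := hcol j
    simp only [mem_upd]
    grind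
  refine WS.enter ?_ rfl
  refine WS.hitR ?_ ?_ (hV _ _ (by omega))
  · have := hT (-1 + 1) 0
    simp only [mem_upd]
    grind
  refine WS.walkR i (n + 7) rfl ?_ (by omega) (by omega) (fun j _ _ => ?_)
    fun i _ _ => hV _ _ (by omega)
  swap
  · have := hT j 0
    have := hrow j
    simp only [mem_upd]
    grind
  refine WS.enter ?_ rfl
  refine WS.hitEraseL ?_ ?_ (hV _ _ (by omega))
  · simp only [mem_upd]
    grind
  refine WS.mvL ?_ (hV _ _ (by omega))
  refine WS.mvD ?_ (hV _ _ (by omega))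
  refine WS.putU ?_ (hV _ _ (by omega))
  refine WS.mvR ?_ (hV _ _ (by omega))
  refine WS.mvR ?_ (hV _ _ (by omega))
  refine WS.mvR ?_ (hV _ _ (by omega))
  refine WS.finish (h _ fun a b => ?_) (by omega) (by omega) (by simp)
  have h1 := hT a b
  have := hrow i
  have := hcol i
  have e1 : b = i - 2 → ((b + 2, 1) ∈ T₀ ↔ (i, 1) ∈ T₀) := by rintro rfl; simp
  have e2 : a = i - 2 → ((1, a + 2) ∈ T₀ ↔ (1, i) ∈ T₀) := by rintro rfl; simp
  clear hV h hT
  simp only [mem_upd, ne_eq, Prod.mk.injEq, h1]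
  clear h1 hrow hcol
  grind (splits := 40)

theorem layer_loop {k : ℤ} {N : ℕ} {first : Bool} (hl : Lanes T₀ k) (hK : T₀.card + 12 ≤ K)
    (hV : ∀ a b : ℤ, -1 ≤ a ∧ a ≤ k + 1 ∧ -1 ≤ b ∧ b ≤ k + 1 ∧ (a ≤ 1 ∨ b ≤ 1) → (a, b) ∈ V)
    (h : ∀ T', Layer T₀ k T' → WP body V K Post N
      (cfg body (nextCode first (decide ((0, k) ∈ T₀))) T' (k, 0))) :
    WP body V K Post (N + k.toNat * (4 * k.toNat + 20)) (cfg body (goto (stage first)) T₀ (0, 1)) := by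
  suffices H : ∀ (m : ℕ) (i : ℤ) (T : Finset Pixel), 2 ≤ i → i + m = k → Layer T₀ i T →
      WP body V K Post (N + m * (4 * k.toNat + 20))
        (cfg body (nextCode first (decide ((0, i) ∈ T₀))) T (i, 0)) by
    have hk := hl.two_le
    obtain ⟨m, hm⟩ := Int.eq_ofNat_of_zero_le (sub_nonneg.2 hk)
    have := layer_start (K := K) (s := 0) (n := N + m * (4 * k.toNat + 20)) (first := first)
      hl hV fun T' hT' _ => H m 2 T' le_rfl (by omega) hT'
    refine (this (by simp only [cfg]; omega)).mono ?_
    rw [show k.toNat = m + 2 by omega]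
    ring_nf
    omega
  intro m
  induction m with
  | zero =>
    intro i T hi hik hT
    obtain rfl : i = k := by omega
    simpa using h T hT
  | succ m ih =>
    intro i T hi hik hT
    rw [decide_eq_false (hl.col i (by omega) (by omega))]
    have := layer_step (K := K) (s := 0) (n := N + m * (4 * k.toNat + 20)) (first := first)
      hl hi (by omega) hT hV fun T' hT' _ => ih (i + 1) T' (by omega) (by omega) hT'
    exact (this (by have := hT.card_le hi; simp only [cfg]; omega)).mono (by ring_nf; omega)

/-- The common end of a layer and of the removal of the top wall: the corner tile is erased and, if
another layer follows, set again one step further along the diagonal. -/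
theorem layer_descend {k : ℤ} {more : Bool} (hk : 1 ≤ k) (hc : (0, 0) ∈ T)
    (hcol : ∀ j : ℤ, 1 ≤ j → j < k → (0, j) ∉ T)
    (hV : ∀ a b : ℤ, 0 ≤ a ∧ a ≤ 1 ∧ 0 ≤ b ∧ b ≤ k → (a, b) ∈ V)
    (h : WS body V K Post s n (if more then
      cfg body (goto (stage false)) (upd (upd T (0, 0) false) (1, 1) true) (1, 2)
        else cfg body halt (upd T (0, 0) false) (0, 1))) :
    WS body V K Post (s + 2) (n + k.toNat + 3) (cfg body (goto (endDown more)) T (0, k - 1)) := by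
  refine WS.walkD 0 (n + 3) rfl ?_ (by omega) (by omega) (fun j _ _ => hcol j (by omega) (by omega))
    fun i _ _ => hV _ _ (by omega)
  refine WS.enter ?_ rfl
  refine WS.hitEraseU ?_ ?_ (hV _ _ (by omega))
  · exact hc
  cases more
  · exact h.mono (by omega) (by omega)
  · simp only [if_true] at h ⊢
    refine WS.mvR ?_ (hV _ _ (by omega))
    refine WS.putU ?_ (hV _ _ (by omega))
    exact WS.finish h (by omega) (by omega) (by simp)

/-- The tiles when a layer has been transposed and the corner has been moved, if there is another
layer. -/
def Layered (T₀ : Finset Pixel) (k : ℤ) (T : Finset Pixel) : Prop :=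
  ∀ a b : ℤ, (a, b) ∈ T ↔ (a = -1 ∧ b = -1 ∧ (1, 1) ∈ T₀) ∨
    (a = -1 ∧ 0 ≤ b ∧ b < k - 2 ∧ (b + 2, 1) ∈ T₀) ∨
    (b = -1 ∧ 0 ≤ a ∧ a < k - 2 ∧ (1, a + 2) ∈ T₀) ∨ (a = 1 ∧ b = 1 ∧ (k, 1) ∈ T₀) ∨
    (¬ (a = -1 ∧ -1 ≤ b ∧ b < k - 2) ∧ ¬ (b = -1 ∧ -1 ≤ a ∧ a < k - 2) ∧
      ¬ (b = 1 ∧ 1 ≤ a ∧ a < k) ∧ ¬ (a = 1 ∧ 1 ≤ b ∧ b < k) ∧ ¬ (b = 0 ∧ (a = 0 ∨ a = k)) ∧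
      ¬ (a = 0 ∧ b = k) ∧ (a, b) ∈ T₀)

/-- The right wall ends the layer and also counts the layers: it loses its lowest pixel each time,
and the pixel above, at `(k, 1)`, is occupied as long as another layer follows. -/
theorem layer_end {k : ℤ} (hl : Lanes T₀ k) (hr : (k, 0) ∈ T₀) (hc : (0, k) ∉ T₀)
    (hT : Layer T₀ k T)
    (hV : ∀ a b : ℤ, -1 ≤ a ∧ a ≤ k + 1 ∧ -1 ≤ b ∧ b ≤ k + 1 ∧ (a ≤ 1 ∨ b ≤ 1) → (a, b) ∈ V)
    (h : ∀ T', Layered T₀ k T' → WS body V K Post s n (if (k, 1) ∈ T₀ then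
      cfg body (goto (stage false)) T' (1, 2) else cfg body halt T' (0, 1))) :
    WS body V K Post (s + 5) (n + 3 * k.toNat + 20)
      (cfg body (nextCode false false) T (k, 0)) := by
  obtain ⟨hk, hc0, hrow, hcol⟩ := hl
  refine WS.act_keep (n := n + 3 * k.toNat + 19) (f := fun r => if r || false then
      if false && !false then (true, .left) else if false && !r then (false, .right) else (r, .up)
    else (true, .up)) true ?_ rfl ?_ (hV _ _ (by omega))
  · have := hT k 0
    grind
  dsimp only [Dir.move, Bool.or_false, if_true, Bool.and_true, Bool.false_eq_true, if_false,
    Bool.and_false, Bool.not_true]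
  refine WS.getD (decide ((k, 1) ∈ T₀)) ?_ ?_ (hV _ _ (by omega))
  · have := hT k (0 + 1)
    grind
  refine WS.putL ?_ (hV _ _ (by omega))
  refine WS.walkL 0 (n + 2 * k.toNat + 16) rfl ?_ (by omega) (by omega) (fun j _ _ => ?_)
    fun i _ _ => hV _ _ (by omega)
  swap
  · have := hT j (0 + 1 - 1)
    have := hrow j
    simp only [mem_upd]
    grind
  refine WS.enter ?_ rfl
  refine WS.hitU ?_ ?_ (hV _ _ (by omega))
  · have := hT 0 (0 + 1 - 1)
    simp only [mem_upd]
    grind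
  refine WS.walkU k (n + k.toNat + 14) rfl ?_ (by omega) (by omega) (fun j _ _ => ?_)
    fun i _ _ => hV _ _ (by omega)
  swap
  · have := hT 0 j
    have := hcol j
    simp only [mem_upd]
    grind
  refine WS.enter ?_ rfl
  refine WS.hitEraseD ?_ ?_ (hV _ _ (by omega))
  · have := hT 0 k
    simp only [mem_upd]
    grind
  have hd := layer_descend (V := V) (K := K) (Post := Post) (s := s) (n := n) (k := k)
    (more := decide ((k, 1) ∈ T₀)) (T := upd (upd T (k, 0 + 1 - 1) false) (0, k) false)
    (by omega) ?_ (fun j _ _ => ?_) (fun a b _ => hV _ _ (by omega)) ?_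
  · exact WS.finish hd (by omega) (by omega) (by simp)
  · have := hT 0 0
    simp only [mem_upd]
    grind
  · have := hT 0 j
    have := hcol j
    simp only [mem_upd]
    grind
  · by_cases hm : (k, 1) ∈ T₀
    · simp only [hm, if_true, decide_true] at h ⊢
      refine h _ fun a b => ?_
      have h1 := hT a b
      clear hV h hT
      simp only [mem_upd, ne_eq, Prod.mk.injEq, h1]
      clear h1 hrow hcol
      grind (splits := 40)
    · simp only [hm, if_false, decide_false, Bool.false_eq_true] at h ⊢
      refine h _ fun a b => ?_
      have h1 := hT a b
      clear hV h hT
      simp only [mem_upd, ne_eq, Prod.mk.injEq, h1]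
      clear h1 hrow hcol
      grind (splits := 40)

theorem layer {k : ℤ} {N : ℕ} (hl : Lanes T₀ k) (hr : (k, 0) ∈ T₀) (hc : (0, k) ∉ T₀)
    (hK : T₀.card + 12 ≤ K)
    (hV : ∀ a b : ℤ, -1 ≤ a ∧ a ≤ k + 1 ∧ -1 ≤ b ∧ b ≤ k + 1 ∧ (a ≤ 1 ∨ b ≤ 1) → (a, b) ∈ V)
    (h : ∀ T', Layered T₀ k T' → WP body V K Post N (if (k, 1) ∈ T₀ then
      cfg body (goto (stage false)) T' (1, 2) else cfg body halt T' (0, 1))) :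
    WP body V K Post (N + (k.toNat * (4 * k.toNat + 20) + 3 * k.toNat + 20))
      (cfg body (goto (stage false)) T₀ (0, 1)) := by
  refine (layer_loop (N := N + 3 * k.toNat + 20) hl hK hV fun T hT => ?_).mono (by omega)
  rw [decide_eq_false hc]
  have := layer_end (K := K) (s := 0) (n := N) hl hr hc hT hV fun T' hT' _ => h T' hT'
  exact this (by have := hT.card_le hl.two_le; simp only [cfg]; omega)

/-! ### The sequence of layers -/

/-- The tiles before the first stage of the transposition of `D`. -/
def StageZero (D : Finset Pixel) (w h : ℕ) (T : Finset Pixel) : Prop :=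
  ∀ a b : ℤ, (a, b) ∈ T ↔ (a - 2, b - 2) ∈ D ∨ (a = w + 2 ∧ 0 ≤ b ∧ b ≤ h) ∨
    (b = h + 2 ∧ 0 ≤ a ∧ a ≤ w) ∨ (a = 0 ∧ b = 0)

/-- The tiles before stage `k` of the transposition of `D`. -/
def Stage (D : Finset Pixel) (w h : ℕ) (k : ℤ) (T : Finset Pixel) : Prop :=
  ∀ a b : ℤ, (a, b) ∈ T ↔ (k + 1 ≤ a ∧ k + 1 ≤ b ∧ (a - 2, b - 2) ∈ D) ∨
    ((a < k - 1 ∨ b < k - 1) ∧ (b, a) ∈ D) ∨ (a = w + 2 ∧ k ≤ b ∧ b ≤ h) ∨ (a = k ∧ b = k)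

/-- All tiles of `D` are in the rectangle of size `w × h` at the origin. -/
def InRect (w h : ℕ) (D : Finset Pixel) : Prop :=
  ∀ a b : ℤ, (a, b) ∈ D → 0 ≤ a ∧ a < w ∧ 0 ≤ b ∧ b < h

/-- The top wall is only needed to compare `w` with `h`. It must vanish before the real layers
start, as their vertical arms extend beyond it if `h < w`. -/
theorem frame_clear {w h : ℕ} (hh : 0 < h) (hhw : h ≤ w) (hD : InRect w h D) (hT : StageZero D w h T)
    (hV : ∀ a b : ℤ, -1 ≤ a ∧ a ≤ w + 3 ∧ -1 ≤ b ∧ b ≤ h + 3 → (a, b) ∈ V)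
    (H : ∀ T', Stage D w h 1 T' →
      WS body V K Post s n (cfg body (goto (stage false)) T' (1, 2))) :
    WS body V K Post (s + 5) (n + 3 * w + 2 * h + 30) (cfg body (get .down fun more =>
      put false .left <| goto (endLeft true more)) T (w + 2, 1)) := by
  refine WS.getD true ?_ ?_ (hV _ _ (by omega))
  · have := hT (w + 2) 1
    grind
  refine WS.putL ?_ (hV _ _ (by omega))
  refine WS.walkL 0 (n + 2 * w + 2 * h + 26) rfl ?_ (by omega) (by omega) (fun j _ _ => ?_)
    fun i _ _ => hV _ _ (by omega)
  swap
  · have := hT j (1 - 1)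
    have := hD (j - 2) (1 - 1 - 2)
    simp only [mem_upd]
    grind
  refine WS.enter ?_ rfl
  refine WS.hitU ?_ ?_ (hV _ _ (by omega))
  · have := hT 0 (1 - 1)
    simp only [mem_upd]
    grind
  refine WS.walkU (h + 2) (n + 2 * w + h + 23) rfl ?_ (by omega) (by omega) (fun j _ _ => ?_)
    fun i _ _ => hV _ _ (by omega)
  swap
  · have := hT 0 j
    have := hD (0 - 2) (j - 2)
    simp only [mem_upd]
    grind
  refine WS.enter ?_ rfl
  refine WS.hitR ?_ ?_ (hV _ _ (by omega))
  · have := hT 0 (h + 2)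
    simp only [mem_upd]
    grind
  refine WS.eraseR (w + 1) (n + w + h + 20) rfl (fun T₁ hT₁ => ?_) (by omega) (by omega)
    (fun j _ _ => ?_) fun i _ _ => hV _ _ (by omega)
  swap
  · have := hT j (h + 2)
    simp only [mem_upd]
    grind
  have h1 : ∀ a b : ℤ, (a, b) ∈ T₁ ↔ (a - 2, b - 2) ∈ D ∨ (a = w + 2 ∧ 1 ≤ b ∧ b ≤ h) ∨
    (b = h + 2 ∧ a = 0) ∨ (a = 0 ∧ b = 0) := by
    intro a b
    have h1 := hT a b
    have := hD (a - 2) (b - 2)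
    rw [hT₁]
    clear hV H hT hT₁ hD
    simp only [mem_upd, ne_eq, Prod.mk.injEq, h1]
    grind (splits := 30)
  clear hT₁ hT
  refine WS.enter ?_ rfl
  refine WS.act_keep (f := fun b => if b then (false, .right) else (false, .left)) false ?_ rfl ?_
    (hV _ _ (by omega))
  · have := h1 (w + 1) (h + 2)
    have := hD (w + 1 - 2) (h + 2 - 2)
    grind
  dsimp only [Dir.move, Bool.false_eq_true, if_false]
  refine WS.walkL 0 (n + h + 10) rfl ?_ (by omega) (by omega) (fun j _ _ => ?_)
    fun i _ _ => hV _ _ (by omega)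
  swap
  · have := h1 j (h + 2)
    have := hD (j - 2) (h + 2 - 2)
    grind
  refine WS.enter ?_ rfl
  refine WS.hitEraseD ?_ ?_ (hV _ _ (by omega))
  · have := h1 0 (h + 2)
    grind
  have hd := layer_descend (V := V) (K := K) (Post := Post) (s := s) (n := n) (k := h + 2)
    (more := true) (T := upd T₁ (0, h + 2) false)
    (by omega) ?_ (fun j _ _ => ?_) (fun a b _ => hV _ _ (by omega)) ?_
  · exact WS.finish hd (by omega) (by omega) (by simp)
  · have := h1 0 0
    simp only [mem_upd]
    grind
  · have := h1 0 j
    have := hD (0 - 2) (j - 2)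
    simp only [mem_upd]
    grind
  · refine H _ fun a b => ?_
    have h1 := h1 a b
    have := hD (a - 2) (b - 2)
    have := hD b a
    clear hV H hD
    simp only [mem_upd, ne_eq, Prod.mk.injEq, h1]
    clear h1
    grind (splits := 40)

theorem find_wall {w h : ℕ} (hh : 0 < h) (hhw : h < w) (hD : InRect w h D) (hT : StageZero D w h T)
    (hV : ∀ a b : ℤ, -1 ≤ a ∧ a ≤ w + 3 ∧ -1 ≤ b ∧ b ≤ h + 3 → (a, b) ∈ V)
    (H : ∀ T', Stage D w h 1 T' →
      WS body V K Post s n (cfg body (goto (stage false)) T' (1, 2))) :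
    WS body V K Post (s + 5) (n + 4 * w + 2 * h + 40) (cfg body (goto endFind) T (h + 3, 0)) := by
  refine WS.walkR (w + 2) (n + 3 * w + 2 * h + 35) rfl ?_ (by omega) (by omega) (fun j _ _ => ?_)
    fun i _ _ => hV _ _ (by omega)
  swap
  · have := hT j 0
    have := hD (j - 2) (0 - 2)
    grind
  refine WS.enter ?_ rfl
  refine WS.hitU ?_ ?_ (hV _ _ (by omega))
  · have := hT (w + 2) 0
    grind
  exact WS.finish (frame_clear hh hhw.le hD hT hV H) (by omega) (by omega) (by simp)

/-- The layer processed in stage zero and the places where it is written contain no tiles, so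
exchanging its arms changes nothing but the token. -/
theorem StageZero.of_layer {w h : ℕ} {k : ℤ} (hD : InRect w h D) (hT₀ : StageZero D w h T₀)
    (hk : 2 ≤ k) (hkw : k ≤ w + 2) (hkh : k ≤ h + 2) (hT : Layer T₀ k T) (a b : ℤ) :
    (a, b) ∈ T ↔ (a, b) ∈ T₀ ∨ (a = 0 ∧ b = k) := by
  have h0 := hT a b
  have h1 := hT₀ a b
  have h2 := hT₀ (b + 2) 1
  have h3 := hT₀ 1 (a + 2)
  have h4 := hT₀ 1 1
  have h5 := hD (a - 2) (b - 2)
  have h6 := hD (b + 2 - 2) (1 - 2)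
  have h7 := hD (1 - 2) (a + 2 - 2)
  have h8 := hD (1 - 2) (1 - 2)
  clear hT hT₀ hD
  grind (splits := 40)

theorem stageZero_lanes {w h : ℕ} {k : ℤ} (hD : InRect w h D) (hT : StageZero D w h T)
    (hk : 2 ≤ k) (hkw : k ≤ w + 2) (hkh : k ≤ h + 2) : Lanes T k := by
  refine ⟨hk, by have := hT 0 0; grind, fun j _ _ => ?_, fun j _ _ => ?_⟩
  · have := hT j 0
    have := hD (j - 2) (0 - 2)
    grind
  · have := hT 0 j
    have := hD (0 - 2) (j - 2)
    grind

/-- Stage zero is a rehearsal on an empty layer: both tokens advance at the same speed, and the wall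
that is reached first reveals the shorter side. Here this is the top wall, possibly simultaneously
with the right wall. -/
theorem stage_zero {w h N : ℕ} (hh : 0 < h) (hhw : h ≤ w) (hD : InRect w h D)
    (hT : StageZero D w h T) (hK : T.card + 20 ≤ K)
    (hV : ∀ a b : ℤ, -1 ≤ a ∧ a ≤ w + 3 ∧ -1 ≤ b ∧ b ≤ h + 3 → (a, b) ∈ V)
    (H : ∀ T', Stage D w h 1 T' →
      WP body V K Post N (cfg body (goto (stage false)) T' (1, 2))) :
    WP body V K Post (N + 4 * w + 2 * h + 50 + (h + 2) * (4 * (h + 2) + 20))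
      (cfg body (goto (stage true)) T (0, 1)) := by
  have hk := layer_loop (V := V) (K := K) (Post := Post) (N := N + 4 * w + 2 * h + 50)
    (first := true) (stageZero_lanes (k := h + 2) hD hT (by omega) (by omega) (by omega))
    (by omega) (fun a b _ => hV a b (by omega)) fun T' hT' => ?_
  · rwa [show (h + 2 : ℤ).toNat = h + 2 by omega] at hk
  have hch : (0, (h : ℤ) + 2) ∈ T := by
    have := hT 0 (h + 2)
    grind
  -- The vertical token lies on the first pixel of the top wall and hence is not an additional tile.
  have hTT : T' = T := by
    ext ⟨a, b⟩
    rw [hT.of_layer hD (by omega) (by omega) (by omega) hT']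
    grind
  subst hTT
  rw [decide_eq_true hch]
  suffices hs : WS body V K Post 10 (N + 4 * w + 2 * h + 50)
      (cfg body (nextCode true true) T' (h + 2, 0)) from hs (by simp only [cfg]; omega)
  rcases hhw.lt_or_eq with hlt | rfl
  · refine WS.act_keep (n := N + 4 * w + 2 * h + 49) (f := fun r => if r || true then
      if true && !true then (true, .left) else if true && !r then (false, .right) else (r, .up)
      else (true, .up)) false ?_ rfl ?_ (hV _ _ (by omega))
    · have := hT (h + 2) 0
      have := hD (h + 2 - 2) (0 - 2)
      grind
    exact WS.finish (find_wall (s := 0) (n := N) hh hlt hD hT hV fun T' h _ => H T' h)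
      (by omega) (by omega) (by simp [Dir.move]; omega)
  · refine WS.act_keep (n := N + 4 * h + 2 * h + 49) (f := fun r => if r || true then
      if true && !true then (true, .left) else if true && !r then (false, .right) else (r, .up)
      else (true, .up)) true ?_ rfl ?_ (hV _ _ (by omega))
    · have := hT (h + 2) 0
      grind
    exact WS.finish (frame_clear (s := 0) (n := N) hh le_rfl hD hT hV fun T' h _ => H T' h)
      (by omega) (by omega) (by simp [Dir.move])

/-! ### Changes of the frame of reference -/

/-- Translation of the grid. -/
def shift (v : Pixel) : Perm Pixel := Equiv.addRight v

theorem isSymmetry_shift (v : Pixel) : IsSymmetry 1 (shift v) := by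
  rintro d ⟨x, y⟩
  cases d <;> ext <;> simp [Dir.move, shift] <;> ring

theorem isSymmetry_transp : IsSymmetry transp (Equiv.prodComm ℤ ℤ) := by
  rintro d ⟨x, y⟩
  cases d <;> rfl

theorem mem_map_perm {E : Perm Pixel} {p : Pixel} : p ∈ T.map E.toEmbedding ↔ E.symm p ∈ T := by
  simp [Finset.mem_map_equiv]

theorem Cfg.map_map {h h' : Perm Dir} {E E' : Perm Pixel} (c : Cfg Label) :
    (c.map h E).map h' E' = c.map (h' * h) (E' * E) := by
  ext1
  · simp [Cfg.map, mul_assoc]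
  · rfl
  · simp only [Cfg.map, Finset.map_map]
    rfl
  · rfl

theorem Cfg.map_one (c : Cfg Label) : c.map 1 1 = c := by
  ext1
  · simp [Cfg.map]
  · rfl
  · simp only [Cfg.map]
    ext
    rw [mem_map_perm]
    rfl
  · rfl

/-- Executing a program in a frame of reference that is moved by a symmetry. -/
theorem WP.of_symm {h : Perm Dir} {E : Perm Pixel} (hE : IsSymmetry h E) {c : Cfg Label} {n : ℕ}
    (hw : WP body (E ⁻¹' V) K (fun c => Post (c.map h E)) n c) :
    WP body V K Post n (c.map h E) :=
  hw.map hE (fun _ h => h) fun _ h => h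

theorem IsSymmetry.inv {h : Perm Dir} {E : Perm Pixel} (hE : IsSymmetry h E) :
    IsSymmetry h⁻¹ E⁻¹ := by
  intro d p
  apply E.injective
  rw [hE]
  simp

theorem WP.to_symm {h : Perm Dir} {E : Perm Pixel} (hE : IsSymmetry h E) {c : Cfg Label} {n : ℕ}
    (hw : WP body V K Post n (c.map h E)) :
    WP body (E ⁻¹' V) K (fun c => Post (c.map h E)) n c := by
  have := hw.map hE.inv (V' := E ⁻¹' V) (Post' := fun c => Post (c.map h E))
    (fun p hp => by simpa using hp) fun c hc => by
      rw [Cfg.map_map, mul_inv_cancel, mul_inv_cancel, Cfg.map_one]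
      exact hc
  rwa [Cfg.map_map, inv_mul_cancel, inv_mul_cancel, Cfg.map_one] at this

theorem cfg_map_one {c : Code Label} {p : Pixel} {E : Perm Pixel} :
    (cfg body c T p).map 1 E = cfg body c (T.map E.toEmbedding) (E p) := rfl

/-- Changing the frame of reference. -/
theorem WP.turn {g : Perm Dir} {E : Perm Pixel} (hE : IsSymmetry g E) {q : Label} {p : Pixel}
    (h : WP body (E ⁻¹' V) K (fun c => Post (c.map g E)) n
      (cfg body (.goto q) (T.map E⁻¹.toEmbedding) (E⁻¹ p))) :
    WP body V K Post n (cfg body (.turn g q) T p) := by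
  have := WP.of_symm hE h
  have e : (cfg body (.goto q) (T.map E⁻¹.toEmbedding) (E⁻¹ p)).map g E
      = cfg body (.turn g q) T p := by
    ext1
    · simp [Cfg.map, cfg, resolve]
    · rfl
    · simp only [Cfg.map, cfg]
      ext r
      rw [mem_map_perm, mem_map_perm]
      exact Eq.to_iff (congrArg (· ∈ T) (E.apply_symm_apply r))
    · simp [Cfg.map, cfg]
  rwa [e] at this

/-- The robot has stopped with the transposition of `D` on the grid. -/
def Transposed (V : Set Pixel) (D : Finset Pixel) (c : Cfg Label) : Prop :=
  c.code = halt ∧ c.pos ∈ V ∧ ∀ a b : ℤ, (a, b) ∈ c.tiles ↔ (b, a) ∈ D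

/-- The auxiliary tiles are the rest of the right wall and the corner tile. -/
theorem Stage.card_le {w h : ℕ} {k : ℤ} (hk : 0 ≤ k) (hT : Stage D w h k T) :
    T.card ≤ D.card + (h + 2) := by
  refine (card_le_of_image (E := insert (k, k) ((Finset.Icc k h).image fun b => ((w : ℤ) + 2, b)))
    (S₀ := D) (fun p => if p.1 < k - 1 ∨ p.2 < k - 1 then (p.2, p.1) else (p.1 + 2, p.2 + 2))
    ?_).trans (Nat.add_le_add_left ((Finset.card_insert_le _ _).trans
      (Nat.add_le_add_right (Finset.card_image_le.trans ?_) 1)) _)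
  · rintro ⟨a, b⟩ hp
    rcases (hT a b).1 hp with ⟨h1, h2, h3⟩ | ⟨h1, h2⟩ | ⟨rfl, h1, h2⟩ | ⟨rfl, rfl⟩
    · exact Or.inr ⟨_, h3, by rw [if_neg (by simp only; omega)]; ext <;> simp⟩
    · exact Or.inr ⟨_, h2, by rw [if_pos (by simp only; omega)]⟩
    · left
      simp [h1, h2]
    · simp
  · rw [Int.card_Icc]
    omega

/-- The layer moved in stage `k` contains the pixels of `D` for which the smaller coordinate is `k -
1`. Shifting by two in both coordinates cancels the offset at which `D` is stored, so they arrive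
exactly at their transposed places. -/
theorem stage_next {w h : ℕ} {k : ℤ} (hk : 1 ≤ k) (hkh : k ≤ h) (hhw : h ≤ w) (hD : InRect w h D)
    (hT : Stage D w h k T)
    (hL : Layered (T.map (shift (k, k))⁻¹.toEmbedding) (w + 2 - k) T₀) (a b : ℤ) :
    (a, b) ∈ T₀.map (shift (k, k)).toEmbedding ↔
      (k + 2 ≤ a ∧ k + 2 ≤ b ∧ (a - 2, b - 2) ∈ D) ∨ ((a < k ∨ b < k) ∧ (b, a) ∈ D) ∨
        (k < h ∧ ((a = w + 2 ∧ k + 1 ≤ b ∧ b ≤ h) ∨ (a = k + 1 ∧ b = k + 1))) := by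
  have hT' : ∀ a b : ℤ, (a, b) ∈ T.map (shift (k, k))⁻¹.toEmbedding ↔ (a + k, b + k) ∈ T := by
    intro a b
    rw [mem_map_perm]
    rfl
  have h0 : (a, b) ∈ T₀.map (shift (k, k)).toEmbedding ↔ (a - k, b - k) ∈ T₀ := by
    rw [mem_map_perm]
    simp [shift, sub_eq_add_neg]
  rw [h0, hL (a - k) (b - k), hT', hT', hT', hT', hT',
    show 1 + k = k + 1 by ring, show b - k + 2 + k = b + 2 by ring,
    show a - k + 2 + k = a + 2 by ring, show w + 2 - k + k = (w : ℤ) + 2 by ring,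
    show a - k + k = a by ring, show b - k + k = b by ring, hT, hT, hT, hT, hT]
  have h1 := hD (a - 2) (b - 2)
  have h2 := hD b a
  have h3 := hD (w + 2) (k + 1)
  have h4 := hD (w + 2 - 2) (k + 1 - 2)
  have h5 := hD (k + 1) (w + 2)
  have h6 : a = k - 1 → ((b + 2 - 2, k + 1 - 2) ∈ D ↔ (b, a) ∈ D) := by
    rintro rfl; ring_nf
  have h7 : b = k - 1 → ((k + 1 - 2, a + 2 - 2) ∈ D ↔ (b, a) ∈ D) := by
    rintro rfl; ring_nf
  have h8 : a = k - 1 → b = k - 1 → ((k + 1 - 2, k + 1 - 2) ∈ D ↔ (b, a) ∈ D) := by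
    rintro rfl rfl; ring_nf
  clear hT hT' hL h0 hD
  grind (splits := 60)

theorem stage_step {w h N : ℕ} (hhw : h ≤ w) (hD : InRect w h D) (hK : D.card + h + 20 ≤ K)
    (hV : ∀ a b : ℤ, -1 ≤ a ∧ -1 ≤ b ∧ a ≤ w + 3 ∧ b ≤ w + 3 ∧ (a ≤ h + 3 ∨ b ≤ h + 3) →
      (a, b) ∈ V) {k : ℤ} (hk : 1 ≤ k) (hkh : k ≤ h) (hT : Stage D w h k T)
    (H : ∀ T' : Finset Pixel, (∀ a b : ℤ, (a, b) ∈ T' ↔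
      (k + 2 ≤ a ∧ k + 2 ≤ b ∧ (a - 2, b - 2) ∈ D) ∨ ((a < k ∨ b < k) ∧ (b, a) ∈ D) ∨
        (k < h ∧ ((a = w + 2 ∧ k + 1 ≤ b ∧ b ≤ h) ∨ (a = k + 1 ∧ b = k + 1)))) →
      WP body V K Post N (if k < h then cfg body (goto (stage false)) T' (k + 1, k + 2)
        else cfg body halt T' (k, k + 1))) :
    WP body V K Post (N + ((w + 2) * (4 * (w + 2) + 20) + 3 * (w + 2) + 20))
      (cfg body (goto (stage false)) T (k, k + 1)) := by
  have hT' : ∀ a b : ℤ, (a, b) ∈ T.map (shift (k, k))⁻¹.toEmbedding ↔ (a + k, b + k) ∈ T := by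
    intro a b
    rw [mem_map_perm]
    rfl
  -- The corner tile `(k, k)` becomes the origin, which is the position that `layer` assumes.
  have e : cfg body (goto (stage false)) T (k, k + 1) = (cfg body (goto (stage false))
      (T.map (shift (k, k))⁻¹.toEmbedding) (0, 1)).map 1 (shift (k, k)) := by
    rw [cfg_map_one]
    congr 1
    · ext r
      rw [mem_map_perm, mem_map_perm]
      exact Eq.to_iff (congrArg (· ∈ T) ((shift (k, k)).apply_symm_apply r).symm)
    · ext <;> simp [shift]; ring
  rw [e]
  refine WP.of_symm (isSymmetry_shift _) ?_
  refine (layer (k := w + 2 - k) (N := N) ⟨by omega, ?_, fun j _ _ => ?_, fun j _ _ => ?_⟩ ?_ ?_ ?_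
    (fun a b _ => hV (a + k) (b + k) ?_) fun T₁ hT₁ => ?_).mono ?_
  · rw [hT', hT]
    grind
  · rw [hT', hT]
    have := hD (j + k - 2) (0 + k - 2)
    have := hD (0 + k) (j + k)
    grind
  · rw [hT', hT]
    have := hD (0 + k - 2) (j + k - 2)
    have := hD (j + k) (0 + k)
    grind
  · rw [hT', hT]
    grind
  · rw [hT', hT]
    have := hD (0 + k - 2) (w + 2 - k + k - 2)
    have := hD (w + 2 - k + k) (0 + k)
    grind
  · have := hT.card_le (by omega)
    rw [Finset.card_map]
    omega
  · omega
  · have hm : (w + 2 - k, 1) ∈ T.map (shift (k, k))⁻¹.toEmbedding ↔ k < h := by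
      rw [hT', hT]
      have := hD (w + 2 - k + k - 2) (1 + k - 2)
      have := hD (1 + k) (w + 2 - k + k)
      grind
    have := H _ (stage_next hk hkh hhw hD hT hT₁)
    apply WP.to_symm (isSymmetry_shift _)
    by_cases hkh' : k < h
    · rw [if_pos hkh'] at this
      rw [if_pos (hm.2 hkh'), cfg_map_one]
      convert this using 2
      ext <;> simp [shift] <;> ring
    · rw [if_neg hkh'] at this
      rw [if_neg (mt hm.1 hkh'), cfg_map_one]
      convert this using 2
      ext <;> simp [shift]; ring
  · have : (w + 2 - k : ℤ).toNat ≤ w + 2 := by omega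
    generalize (w + 2 - k : ℤ).toNat = r at *
    have := Nat.mul_le_mul this (show 4 * r + 20 ≤ 4 * (w + 2) + 20 by omega)
    omega

theorem stages {w h N : ℕ} (hhw : h ≤ w) (hD : InRect w h D) (hK : D.card + h + 20 ≤ K)
    (hV : ∀ a b : ℤ, -1 ≤ a ∧ -1 ≤ b ∧ a ≤ w + 3 ∧ b ≤ w + 3 ∧ (a ≤ h + 3 ∨ b ≤ h + 3) →
      (a, b) ∈ V) (m : ℕ) {k : ℤ} (hk : 1 ≤ k) (hkm : k + m = h) (hT : Stage D w h k T)
    (hN : (w + 2) * (4 * (w + 2) + 20) + 3 * (w + 2) + 20 ≤ N) :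
    WP body V K (Transposed V D) ((m + 1) * N)
      (cfg body (goto (stage false)) T (k, k + 1)) := by
  induction m generalizing k T with
  | zero =>
    refine (stage_step (N := 0) hhw hD hK hV hk (by omega) hT fun T' hT' => ?_).mono (by omega)
    rw [if_neg (by omega)]
    refine .done _ _ ⟨rfl, hV _ _ (by omega), fun a b => ?_⟩
    have h1 := hT' a b
    have h2 := hD b a
    simp only [cfg]
    rw [h1]
    have h3 := hD (a - 2) (b - 2)
    grind
  | succ m ih =>
    push_cast at hkm
    refine (stage_step (N := (m + 1) * N) hhw hD hK hV hk (by omega) hT fun T' hT' => ?_).mono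
      (by rw [add_mul (m + 1)]; omega)
    rw [if_pos (by omega)]
    have := ih (k := k + 1) (T := T') (by omega) (by omega) fun a b => by
      rw [hT']
      grind
    rwa [show k + 1 + 1 = k + 2 by ring] at this

theorem transpose_of_le {w h : ℕ} (hh : 0 < h) (hhw : h ≤ w) (hD : InRect w h D)
    {N : ℕ} (hK : D.card + h + 20 ≤ K)
    (hV : ∀ a b : ℤ, -1 ≤ a ∧ -1 ≤ b ∧ a ≤ w + 3 ∧ b ≤ w + 3 ∧ (a ≤ h + 3 ∨ b ≤ h + 3) →
      (a, b) ∈ V) (hT : Stage D w h 1 T)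
    (hN : h * ((w + 2) * (4 * (w + 2) + 20) + 3 * (w + 2) + 20) ≤ N) :
    WP body V K (Transposed V D) N (cfg body (goto (stage false)) T (1, 2)) := by
  obtain ⟨m, rfl⟩ : ∃ m, h = m + 1 := ⟨h - 1, by omega⟩
  exact (stages hhw hD hK hV m (k := 1) le_rfl (by push_cast; ring) hT le_rfl).mono hN

/-- If the right wall is reached first, the robot continues in the frame that is reflected in the
diagonal, in which the rectangle is wider than high. The vertical token is then in the horizontal
lane and is removed on the way to the other wall. -/
theorem stage_zero_turned {w h N : ℕ} (hw : 0 < w) (hwh : w < h) (hD : InRect w h D)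
    (hT : StageZero D w h T) (hK : T.card + 20 ≤ K) (hK' : D.card + w + 20 ≤ K)
    (hV : ∀ a b : ℤ, -1 ≤ a ∧ -1 ≤ b ∧ a ≤ h + 3 ∧ b ≤ h + 3 ∧ (a ≤ w + 3 ∨ b ≤ w + 3) →
      (a, b) ∈ V)
    (hN : w * ((h + 2) * (4 * (h + 2) + 20) + 3 * (h + 2) + 20) ≤ N) :
    WP body V K (Transposed V D) (N + 4 * h + 6 * w + 100 + (w + 2) * (4 * (w + 2) + 20))
      (cfg body (goto (stage true)) T (0, 1)) := by
  have hk := layer_loop (V := V) (K := K) (Post := Transposed V D)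
    (N := N + 4 * h + 6 * w + 100)
    (first := true) (stageZero_lanes (k := w + 2) hD hT (by omega) (by omega) (by omega))
    (by omega) (fun a b _ => hV a b (by omega)) fun T₁ hT₁ => ?_
  · rwa [show (w + 2 : ℤ).toNat = w + 2 by omega] at hk
  have hch : (0, (w : ℤ) + 2) ∉ T := by
    have := hT 0 (w + 2)
    have := hD (0 - 2) (w + 2 - 2)
    grind
  have h1 := hT.of_layer hD (by omega) (by omega) (by omega) hT₁
  have hcard := hT₁.card_le (by omega)
  clear hT₁
  rw [decide_eq_false hch]
  suffices hs : WS body V K (Transposed V D) 9 (N + 4 * h + 6 * w + 100)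
      (cfg body (nextCode true false) T₁ (w + 2, 0)) from hs (by simp only [cfg]; omega)
  refine WS.act_keep (n := N + 4 * h + 6 * w + 99) (f := fun r => if r || false then
      if true && !false then (true, .left) else if true && !r then (false, .right) else (r, .up)
      else (true, .up)) true ?_ rfl ?_ (hV _ _ (by omega))
  · have := h1 (w + 2) 0
    have := hT (w + 2) 0
    grind
  dsimp only [Dir.move, Bool.or_false, if_true, Bool.and_true, Bool.not_false]
  intro hK₁
  refine WP.turn isSymmetry_transp ?_
  set E : Perm Pixel := Equiv.prodComm ℤ ℤ with hE
  have hmem : ∀ (S : Finset Pixel) (a b : ℤ), (a, b) ∈ S.map E⁻¹.toEmbedding ↔ (b, a) ∈ S :=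
    fun S a b => by rw [mem_map_perm]; rfl
  -- Transposition commutes with the reflection in the diagonal, so transposing in the reflected
  -- frame is transposing in the original one.
  refine WP.post_mono (Post := Transposed (E ⁻¹' V) (D.map E⁻¹.toEmbedding)) ?_ fun c hc =>
    ⟨hc.1, hc.2.1, fun a b => ?_⟩
  swap
  · have : (a, b) ∈ (c.map transp E).tiles ↔ (b, a) ∈ c.tiles := by
      simp only [Cfg.map]
      rw [mem_map_perm]
      rfl
    rw [this, hc.2.2, hmem]
  have hD' : InRect h w (D.map E⁻¹.toEmbedding) := fun a b hab => by
    have := hD b a ((hmem _ _ _).1 hab)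
    omega
  have hV' : ∀ a b : ℤ, -1 ≤ a ∧ -1 ≤ b ∧ a ≤ h + 3 ∧ b ≤ h + 3 ∧ (a ≤ w + 3 ∨ b ≤ w + 3) →
      (a, b) ∈ E ⁻¹' V := fun a b hab => hV b a (by omega)
  have h2 : ∀ a b : ℤ, (a, b) ∈ T₁.map E⁻¹.toEmbedding ↔ (b, a) ∈ T ∨ (b = 0 ∧ a = w + 2) :=
    fun a b => by rw [hmem, h1]
  have hcard' : (T₁.map E⁻¹.toEmbedding).card = T₁.card := Finset.card_map _
  generalize T₁.map E⁻¹.toEmbedding = T₂ at *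
  suffices hs : WS body (E ⁻¹' V) K (Transposed (E ⁻¹' V) (D.map E⁻¹.toEmbedding)) 8
      (N + 4 * h + 6 * w + 99) (cfg body (goto turnDown) T₂ (0, w + 2 - 1)) from
    hs (by simp only [cfg]; omega)
  refine WS.walkD 0 (N + 4 * h + 4 * w + 80) rfl ?_ (by omega) (by omega) (fun j _ _ => ?_)
    fun i _ _ => hV' _ _ (by omega)
  swap
  · have := h2 0 j
    have := hT j 0
    have := hD (j - 2) (0 - 2)
    grind
  refine WS.enter ?_ rfl
  refine WS.hitR ?_ ?_ (hV' _ _ (by omega))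
  · have := h2 0 0
    have := hT 0 0
    grind
  refine WS.walkR (w + 2) (N + 4 * h + 2 * w + 60) rfl ?_ (by omega) (by omega) (fun j _ _ => ?_)
    fun i _ _ => hV' _ _ (by omega)
  swap
  · have := h2 j 0
    have := hT 0 j
    have := hD (0 - 2) (j - 2)
    grind
  refine WS.enter ?_ rfl
  refine WS.hitEraseR ?_ ?_ (hV' _ _ (by omega))
  · have := h2 (w + 2) 0
    grind
  refine WS.finish (find_wall (s := 0) (n := N) hw hwh hD' (fun a b => ?_)
    (fun a b _ => hV' a b (by omega)) fun T' hT' _ => ?_) (by omega) (by omega) (by simp; omega)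
  · have h3 := h2 a b
    have h4 := hT b a
    have h5 := hD (b - 2) (a - 2)
    simp only [mem_upd, ne_eq, Prod.mk.injEq, h3, h4, hmem]
    clear h2 h1 hT hD hV hV' hD' hmem
    grind
  · exact transpose_of_le hw hwh.le hD' (by rw [Finset.card_map]; omega) hV' hT' hN

theorem transpose_time {w h : ℕ} (hh : 0 < h) (hhw : h ≤ w) :
    h * ((w + 2) * (4 * (w + 2) + 20) + 3 * (w + 2) + 20) + 4 * w + 6 * h + 100 +
      (h + 2) * (4 * (h + 2) + 20) ≤ 1000 * ((w + h) * (w * h)) := by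
  obtain ⟨a, rfl⟩ : ∃ a, h = a + 1 := ⟨h - 1, by omega⟩
  obtain ⟨b, rfl⟩ : ∃ b, w = a + 1 + b := ⟨w - (a + 1), by omega⟩
  ring_nf
  nlinarith [Nat.zero_le (a * b), Nat.zero_le (a * b ^ 2), Nat.zero_le (a ^ 2 * b),
    Nat.zero_le (a ^ 3), Nat.zero_le (a ^ 2), Nat.zero_le (b ^ 2)]

theorem transpose {w h : ℕ} (hw : 0 < w) (hh : 0 < h) (hD : InRect w h D)
    (hT : StageZero D w h T) (hK : T.card + 20 ≤ K) (hK' : D.card + w + h + 20 ≤ K)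
    (hV : ∀ a b : ℤ, -1 ≤ a ∧ -1 ≤ b ∧ (a ≤ w + 3 ∨ a ≤ h + 3) ∧ (b ≤ w + 3 ∨ b ≤ h + 3) ∧
      (a ≤ w + 3 ∧ a ≤ h + 3 ∨ b ≤ w + 3 ∧ b ≤ h + 3) → (a, b) ∈ V) :
    WP body V K (Transposed V D) (1000 * ((w + h) * (w * h)))
      (cfg body (goto (stage true)) T (0, 1)) := by
  rcases le_or_gt h w with hhw | hwh
  · exact (stage_zero hh hhw hD hT hK (fun a b _ => hV a b (by omega)) fun T' hT' =>
      transpose_of_le hh hhw hD (by omega) (fun a b _ => hV a b (by omega)) hT' le_rfl).mono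
        (by have := transpose_time hh hhw; omega)
  · have := transpose_time hw hwh.le
    exact (stage_zero_turned hw hwh hD hT hK (by omega) (fun a b _ => hV a b (by omega))
      le_rfl).mono (by rw [add_comm w h, mul_comm w h]; omega)

/-! ### Rotation once the bounding box is known -/

/-- The pixels that the robot visits when the bounding box is the rectangle of size `w × h` at the
origin. -/
def region (w h : ℕ) : Set Pixel :=
  {p | -12 ≤ p.1 ∧ -12 ≤ p.2 ∧ (p.1 ≤ w + 12 ∨ p.1 ≤ h + 12) ∧ (p.2 ≤ w + 12 ∨ p.2 ≤ h + 12) ∧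
    (p.1 ≤ w + 12 ∧ p.1 ≤ h + 12 ∨ p.2 ≤ w + 12 ∧ p.2 ≤ h + 12)}

/-- The robot has stopped with a translate of the image of `P` under `ρ` on the grid. -/
def Rotated (ρ : Pixel → Pixel) (V : Set Pixel) (P : Finset Pixel) (c : Cfg Label) : Prop :=
  c.code = halt ∧ c.pos ∈ V ∧ ∃ v : Pixel, c.tiles = P.image fun p => ρ p + v

/-- Reflection of the grid that maps the columns from `0` to `w - 1` to each other. -/
def mirror (w : ℕ) : Perm Pixel where
  toFun p := (w - 1 - p.1, p.2)
  invFun p := (w - 1 - p.1, p.2)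
  left_inv p := by simp
  right_inv p := by simp

theorem rotate_time {w h : ℕ} (hw : 0 < w) (hh : 0 < h) :
    1000 * ((w + h) * (w * h)) + 2 * w + h + 30 + h * (w * (4 * w + 20)) + w + 2 * h + 30 ≤
      2000 * ((w + h) * (w * h)) := by
  obtain ⟨a, rfl⟩ : ∃ a, h = a + 1 := ⟨h - 1, by omega⟩
  obtain ⟨b, rfl⟩ : ∃ b, w = b + 1 := ⟨w - 1, by omega⟩
  ring_nf
  nlinarith [Nat.zero_le (a * b), Nat.zero_le (a * b ^ 2), Nat.zero_le (a ^ 2 * b),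
    Nat.zero_le (a ^ 2), Nat.zero_le (b ^ 2)]

theorem rotate_boxed {w h : ℕ} (hw : 0 < w) (hh : 0 < h) (hP : InRect w h P) (hT : Boxed P w h T)
    (hK : P.card + 10 * (w + h) + 200 ≤ K) :
    WP body (region w h) K (Rotated rotateCW (region w h) P) (2000 * ((w + h) * (w * h)))
      (cfg body (goto setup) T (w, 0)) := by
  have hV : ∀ a b : ℤ, -2 ≤ a ∧ a ≤ w + 1 ∧ -5 ≤ b ∧ b ≤ h + 1 → (a, b) ∈ region w h := by
    intro a b hab
    simp only [region, Set.mem_ofPred_eq]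
    omega
  have hcard : T.card ≤ P.card + 8 := by
    refine (card_le_of_image (E := [((w : ℤ), (h : ℤ)), (w - 1, h + 1), (-1, (h : ℤ)),
      (-2, h - 1), (-1, -1), (0, -2), ((w : ℤ), -1), ((w : ℤ) + 1, 0)].toFinset) id ?_).trans
      (Nat.add_le_add_left (List.toFinset_card_le _) _)
    rintro ⟨a, b⟩ hp
    have := hT a b
    simp only [List.mem_toFinset, List.mem_cons, Prod.mk.injEq]
    grind
  -- The walls for mirroring take `2 * h + 12` tiles; of the remaining room, `w + 10` is for the top
  -- wall and `30` for the transposition.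
  suffices hs : WS body (region w h) K (Rotated rotateCW (region w h) P) (w + 40 + 2 * h + 12)
      (1000 * ((w + h) * (w * h)) + 2 * w + h + 30 + h * (w * (4 * w + 20)) + w + 2 * h + 30)
      (cfg body (goto setup) T (w, 0)) from
    (hs (by simp only [cfg]; omega)).mono (rotate_time hw hh)
  refine setup_walls hw hh hP hT hV fun T₁ hT₁ hK₁ => ?_
  simp only [cfg] at hK₁
  refine mir_rows hw hh (fun a b _ _ _ _ => ?_) (fun b _ _ => ?_) (fun b _ _ => ?_) (by omega)
    (fun a b _ => hV a b (by omega)) fun T₂ hT₂ => ?_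
  · have := hT₁ a b
    have := hP a b
    grind
  · have := hT₁ (-1) b
    have := hP (-1) b
    grind
  · have := hT₁ w b
    grind
  have hcard₂ := hT₂.card_le le_rfl
  refine setup_frame (s := 30) hw hh hP hT₁ hT₂ hV (fun T₃ hT₃ hK₃ => ?_)
    (by simp only [cfg]; omega)
  simp only [cfg] at hK₃
  clear hT hT₁ hT₂
  have e : cfg body (goto (stage true)) T₃ (-2, -4) = (cfg body (goto (stage true))
      (T₃.map (shift (-2, -5))⁻¹.toEmbedding) (0, 1)).map 1 (shift (-2, -5)) := by
    rw [cfg_map_one]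
    congr 1
    ext r
    rw [mem_map_perm, mem_map_perm]
    exact Eq.to_iff (congrArg (· ∈ T₃) ((shift (-2, -5)).apply_symm_apply r).symm)
  rw [e]
  refine WP.of_symm (isSymmetry_shift _) ?_
  have hD : ∀ a b : ℤ, (a, b) ∈ P.map (mirror w).toEmbedding ↔ (w - 1 - a, b) ∈ P := fun a b => by
    rw [mem_map_perm]
    rfl
  -- The tile `(x, y)` is mirrored to `(w - 1 - x, y)`, transposed to `(y, w - 1 - x)` and shifted
  -- by `(-2, -5)`, which gives `(y, -x) + (-2, w - 6)`.
  refine WP.post_mono (Post := Transposed _ (P.map (mirror w).toEmbedding)) (transpose hw hh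
    (fun a b hab => ?_) (fun a b => ?_) ?_ ?_ fun a b hab => ?_) fun c hc =>
      ⟨hc.1, hc.2.1, (-2, (w : ℤ) - 6), ?_⟩
  · have := hP _ _ ((hD a b).1 hab)
    omega
  · rw [mem_map_perm, hD]
    have h3 : (a - 2, b - 5) ∈ T₃ ↔ _ := hT₃ (a - 2) (b - 5)
    have h4 := hP (w - 1 - (a - 2)) (b - 2)
    have h5 : b - 5 + 3 = b - 2 := by ring
    refine Iff.trans (b := (a - 2, b - 5) ∈ T₃) (by rfl) (h3.trans ?_)
    rw [h5]
    clear hT₃ h3 hD hP hV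
    grind
  · rw [Finset.card_map]
    omega
  · rw [Finset.card_map]
    omega
  · simp only [region, shift, Set.mem_preimage, Equiv.coe_addRight, Set.mem_ofPred_eq, Prod.mk_add_mk]
    omega
  · ext ⟨a, b⟩
    have h1 : (a, b) ∈ (c.map 1 (shift (-2, -5))).tiles ↔ (a + 2, b + 5) ∈ c.tiles := by
      simp only [Cfg.map]
      rw [mem_map_perm]
      simp [shift]
    rw [h1, hc.2.2, hD, Finset.mem_image]
    constructor
    · exact fun h => ⟨_, h, by ext <;> simp [rotateCW]; ring⟩
    · rintro ⟨⟨x, y⟩, h, e⟩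
      simp only [rotateCW, Prod.mk_add_mk, Prod.mk.injEq] at e
      rwa [show (w : ℤ) - 1 - (b + 5) = x by omega, show a + 2 = y by omega]

/-! ### The search for the bounding box -/

/-- A mark at the corner `(x, y)` of a rectangle; `(u, v)` is the direction in which the robot
arrives at the corner. -/
structure CornerMark where
  x : ℤ
  y : ℤ
  u : ℤ
  v : ℤ
  bits : Bits

namespace CornerMark

/-- The pixels of a mark. -/
def cells (μ : CornerMark) : List Pixel :=
  [(μ.x + μ.u, μ.y + μ.v), (μ.x + μ.u + μ.v, μ.y + μ.v - μ.u),
    (μ.x + 2 * μ.u + μ.v, μ.y + 2 * μ.v - μ.u), (μ.x + 2 * μ.u, μ.y + 2 * μ.v)]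

/-- The pixels of the mark form a checkerboard pattern, and their original state is known. -/
structure IsSet (P T : Finset Pixel) (μ : CornerMark) : Prop where
  h1 : (μ.x + μ.u, μ.y + μ.v) ∉ T
  h2 : (μ.x + μ.u + μ.v, μ.y + μ.v - μ.u) ∈ T
  h3 : (μ.x + 2 * μ.u + μ.v, μ.y + 2 * μ.v - μ.u) ∉ T
  h4 : (μ.x + 2 * μ.u, μ.y + 2 * μ.v) ∈ T
  b1 : (μ.x + μ.u, μ.y + μ.v) ∈ P ↔ μ.bits.1 = true
  b2 : (μ.x + μ.u + μ.v, μ.y + μ.v - μ.u) ∈ P ↔ μ.bits.2.1 = true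
  b3 : (μ.x + 2 * μ.u + μ.v, μ.y + 2 * μ.v - μ.u) ∈ P ↔ μ.bits.2.2.1 = true
  b4 : (μ.x + 2 * μ.u, μ.y + 2 * μ.v) ∈ P ↔ μ.bits.2.2.2 = true

theorem IsSet.congr {μ : CornerMark} (h : μ.IsSet P T) (hT : ∀ p ∈ μ.cells, p ∈ T₀ ↔ p ∈ T) :
    μ.IsSet P T₀ := by
  obtain ⟨h1, h2, h3, h4, b1, b2, b3, b4⟩ := h
  simp only [cells, List.forall_mem_cons] at hT
  obtain ⟨e1, e2, e3, e4, -⟩ := hT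
  exact ⟨by rwa [e1], by rwa [e2], by rwa [e3], by rwa [e4], b1, b2, b3, b4⟩

/-- The mark in the frame of reference that is turned to the left. -/
def turn (μ : CornerMark) : CornerMark := ⟨μ.y, -μ.x, μ.v, -μ.u, μ.bits⟩

end CornerMark

/-- The tiles are those of `P`, up to marks. -/
structure Marked (P T : Finset Pixel) (L : List CornerMark) : Prop where
  off : ∀ p, (∀ μ ∈ L, p ∉ μ.cells) → (p ∈ T ↔ p ∈ P)
  on : ∀ μ ∈ L, μ.IsSet P T

namespace Marked
variable {L : List CornerMark} {μ : CornerMark}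

theorem card_le (h : Marked P T L) : T.card ≤ P.card + 4 * L.length := by
  refine (card_le_of_image (E := (L.flatMap CornerMark.cells).toFinset) id fun p hp => ?_).trans
    (Nat.add_le_add_left ((List.toFinset_card_le _).trans ?_) _)
  · by_cases hL : ∀ μ ∈ L, p ∉ μ.cells
    · exact Or.inr ⟨p, (h.off p hL).1 hp, rfl⟩
    · push Not at hL
      exact Or.inl (by simpa using hL)
  · rw [List.length_flatMap]
    have : L.map (fun μ => μ.cells.length) = L.map fun _ => 4 := List.map_congr_left fun μ _ => rfl
    rw [this]
    simp [mul_comm]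

theorem restore (h : Marked P T (μ :: L)) (hd : ∀ ν ∈ L, ∀ p ∈ μ.cells, p ∉ ν.cells)
    (hT : ∀ p, p ∈ T₀ ↔ (p ∈ μ.cells ∧ p ∈ P) ∨ (p ∉ μ.cells ∧ p ∈ T)) : Marked P T₀ L := by
  refine ⟨fun p hp => ?_, fun ν hν => (h.on ν (List.mem_cons_of_mem _ hν)).congr fun p hp => ?_⟩
  · have := h.off p
    simp only [List.forall_mem_cons] at this
    grind
  · have := hd ν hν p
    grind

theorem place (h : Marked P T L) (hd : ∀ ν ∈ L, ∀ p ∈ μ.cells, p ∉ ν.cells)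
    (hT : ∀ p, p ∉ μ.cells → (p ∈ T₀ ↔ p ∈ T)) (hμ : μ.IsSet P T₀) : Marked P T₀ (L ++ [μ]) := by
  refine ⟨fun p hp => ?_, fun ν hν => ?_⟩
  · rw [hT p (hp μ (by simp))]
    exact h.off p fun ν hν => hp ν (by simp [hν])
  · rcases List.mem_append.1 hν with hν | hν
    · exact (h.on ν hν).congr fun p hp => hT p fun h' => hd ν hν p h' hp
    · rwa [List.mem_singleton.1 hν]

end Marked

/-- Rotation of the grid to the left. -/
def rotL : Perm Pixel where
  toFun p := (-p.2, p.1)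
  invFun p := (p.2, -p.1)
  left_inv p := by simp
  right_inv p := by simp

theorem isSymmetry_rotL : IsSymmetry rot rotL := by
  rintro d ⟨x, y⟩
  cases d <;> ext <;> simp [Dir.move, rotL, rot] <;> ring

theorem mem_map_rotL {x y : ℤ} : (x, y) ∈ T.map rotL⁻¹.toEmbedding ↔ (-y, x) ∈ T := by
  rw [mem_map_perm]
  rfl

theorem CornerMark.mem_cells_turn {μ : CornerMark} {x y : ℤ} :
    (x, y) ∈ μ.turn.cells ↔ (-y, x) ∈ μ.cells := by
  simp only [turn, cells, List.mem_cons, Prod.mk.injEq, List.not_mem_nil, or_false]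
  grind

theorem CornerMark.IsSet.turn {μ : CornerMark} (h : μ.IsSet P T) :
    μ.turn.IsSet (P.map rotL⁻¹.toEmbedding) (T.map rotL⁻¹.toEmbedding) := by
  obtain ⟨h1, h2, h3, h4, b1, b2, b3, b4⟩ := h
  refine ⟨?_, ?_, ?_, ?_, ?_, ?_, ?_, ?_⟩ <;> rw [mem_map_rotL] <;> simp only [CornerMark.turn]
  · convert h1 using 3; ring
  · convert h2 using 2 <;> ring
  · convert h3 using 3 <;> ring
  · convert h4 using 2; ring
  · rw [← b1]; ring_nf
  · rw [← b2]; ring_nf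
  · rw [← b3]; ring_nf
  · rw [← b4]; ring_nf

theorem Marked.turn {L : List CornerMark} (h : Marked P T L) :
    Marked (P.map rotL⁻¹.toEmbedding) (T.map rotL⁻¹.toEmbedding) (L.map CornerMark.turn) := by
  refine ⟨?_, ?_⟩
  · rintro ⟨x, y⟩ hp
    rw [mem_map_rotL, mem_map_rotL]
    exact h.off _ fun μ hμ hc =>
      hp _ (List.mem_map_of_mem hμ) (CornerMark.mem_cells_turn.2 hc)
  · intro μ hμ
    obtain ⟨ν, hν, rfl⟩ := List.mem_map.1 hμ
    exact (h.on ν hν).turn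

/-- The new mark avoids the old ones, so the states read while setting it are those of `P`. The
state of its first pixel is singled out, because the scan of the next side starts there. -/
theorem place_mark {L : List CornerMark} {x y : ℤ} {k : Bits → Code Label} (h : Marked P T L)
    (hd : ∀ m, ∀ ν ∈ L, ∀ p ∈ (⟨x, y, 0, 1, m⟩ : CornerMark).cells, p ∉ ν.cells)
    (hV : ∀ a b : ℤ, x ≤ a ∧ a ≤ x + 1 ∧ y + 1 ≤ b ∧ b ≤ y + 2 → (a, b) ∈ V)
    (H : ∀ m T', Marked P T' (L ++ [⟨x, y, 0, 1, m⟩]) → ((x, y + 1) ∈ P ↔ m.1 = true) →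
      WS body V K Post s n (cfg body (k m) T' (x, y + 1))) :
    WS body V K Post (s + 4) (n + 4) (cfg body (markCode k) T (x, y + 1)) := by
  have hTP : ∀ p ∈ (⟨x, y, 0, 1, default⟩ : CornerMark).cells, p ∈ T ↔ p ∈ P := fun p hp =>
    h.off p fun ν hν => hd default ν hν p hp
  simp only [CornerMark.cells, List.forall_mem_cons] at hTP
  obtain ⟨e1, e2, e3, e4, -⟩ := hTP
  refine WS.takeR (decide ((x, y + 1) ∈ P)) (by simpa using e1) ?_ (hV _ _ (by omega))
  refine WS.takeU (decide ((x + 1, y + 1) ∈ P)) (by simpa [mem_upd] using e2) ?_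
    (hV _ _ (by omega))
  refine WS.takeL (decide ((x + 1, y + 2) ∈ P)) ?_ ?_ (hV _ _ (by omega))
  · rw [show y + 1 + 1 = y + 2 by ring]
    simpa [mem_upd] using e3
  refine WS.takeD (decide ((x, y + 2) ∈ P)) ?_ ?_ (hV _ _ (by omega))
  · rw [show y + 1 + 1 = y + 2 by ring, show x + 1 - 1 = x by ring]
    simpa [mem_upd] using e4
  refine WS.finish (H (decide ((x, y + 1) ∈ P), decide ((x + 1, y + 1) ∈ P),
    decide ((x + 1, y + 2) ∈ P), decide ((x, y + 2) ∈ P)) _ (h.place (hd _) ?_ ?_) (by simp))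
    le_rfl le_rfl (by simp)
  · rintro ⟨a, b⟩ hp
    simp only [CornerMark.cells, List.mem_cons, Prod.mk.injEq, List.not_mem_nil, or_false] at hp
    simp only [mem_upd, ne_eq, Prod.mk.injEq]
    clear e1 e2 e3 e4 hd hV H
    grind
  · constructor <;> simp [mem_upd] <;> grind

/-- The marks at the corners of the rectangle from `(a, c)` to `(b, d)`; the rectangle may have
grown by one since the mark was set. -/
def cornerMarks (a b c d A C D : ℤ) (m : Bits × Bits × Bits × Bits) : List CornerMark :=
  [⟨b, D, 0, 1, m.1⟩, ⟨A, d, -1, 0, m.2.1⟩, ⟨a, C, 0, -1, m.2.2.1⟩, ⟨b, c, 1, 0, m.2.2.2⟩]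

/-- The positions of the marks at the corners of the rectangle, and the memory of the robot. -/
structure Lags (a b c d A C D : ℤ) (g : Bool × Bool × Bool) : Prop where
  top : c ≤ D ∧ D = d - if g.1 then 1 else 0
  left : A ≤ b ∧ A = a + if g.2.1 then 1 else 0
  bot : C ≤ d ∧ C = c + if g.2.2 then 1 else 0

theorem Lags.bounds {a b c d A C D : ℤ} {g : Bool × Bool × Bool} (h : Lags a b c d A C D g) :
    c ≤ D ∧ D ≤ d ∧ a ≤ A ∧ A ≤ b ∧ c ≤ C ∧ C ≤ d ∧ d - 1 ≤ D ∧ A ≤ a + 1 ∧ C ≤ c + 1 := by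
  obtain ⟨⟨h1, h2⟩, ⟨h3, h4⟩, ⟨h5, h6⟩⟩ := h
  refine ⟨h1, ?_, ?_, h3, ?_, h5, ?_, ?_, ?_⟩ <;> split_ifs at * <;> omega

/-- The first pixel next to the side is covered by the mark set last. It is empty now; its original
state is already in the flag `f`. -/
theorem scan_start {a b c d A C D : ℤ} {m : Bits × Bits × Bits × Bits} {g : Bool × Bool × Bool}
    {cnt : Fin 7} {f : Bool} (hM : Marked P T (cornerMarks a b c d A C D m))
    (hV : (b + 1, c) ∈ V)
    (H : WS body V K Post s n (cfg body (goto (scan m g cnt f)) T (b + 1, c + 1))) :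
    WS body V K Post s (n + 1) (cfg body (goto (scan m g cnt f)) T (b + 1, c)) := by
  have h := (hM.on ⟨b, c, 1, 0, m.2.2.2⟩ (by simp [cornerMarks])).h1
  simp only [add_zero] at h
  refine WS.enter ?_ rfl
  exact WS.act_keep (f := fun b => if b then (true, .left) else (false, .up)) false (by simpa using h)
    rfl H hV

/-- An occupied pixel next to the side is either a tile of `P` or the corner mark, which the robot
decides by inspecting the 2×2 block to the upper left. Such a block needs at most five steps. -/
theorem scan_loop {a b c d A C D : ℤ} {m : Bits × Bits × Bits × Bits} {g : Bool × Bool × Bool}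
    {cnt : Fin 7} (hdiag : ∀ x y, (x + 1, y) ∈ P → (x, y + 1) ∈ P → (x, y) ∈ P ∨ (x + 1, y + 1) ∈ P)
    (hM : Marked P T (cornerMarks a b c d A C D m)) (hg : Lags a b c d A C D g)
    (hV : ∀ x y : ℤ, b ≤ x ∧ x ≤ b + 1 ∧ c ≤ y ∧ y ≤ D + 1 → (x, y) ∈ V)
    (H : ∀ f : Bool, (f = true ↔ ∃ y', c ≤ y' ∧ y' ≤ D ∧ (b + 1, y') ∈ P) →
      WS body V K Post s n (cfg body (goto (scan m g cnt f)) T (b + 1, D + 1))) (r : ℕ) {y : ℤ}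
    {f : Bool} (hy : c + 1 ≤ y) (hr : y + r = D + 1)
    (hf : f = true ↔ ∃ y', c ≤ y' ∧ y' < y ∧ (b + 1, y') ∈ P) :
    WS body V K Post s (n + 5 * r) (cfg body (goto (scan m g cnt f)) T (b + 1, y)) := by
  induction r generalizing y f with
  | zero =>
    obtain rfl : y = D + 1 := by omega
    exact H f (by simp only [hf, Int.lt_add_one_iff])
  | succ r ih =>
    obtain ⟨h1, h2, h3, h4, h5, h6, h7, h8, h9⟩ := hg.bounds
    push_cast at hr
    have hoff : ∀ x y : ℤ, b ≤ x → x ≤ b + 1 → c + 1 ≤ y → y ≤ D → ((x, y) ∈ T ↔ (x, y) ∈ P) := by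
      intro x y _ _ _ _
      apply hM.off
      simp only [cornerMarks, List.forall_mem_cons]
      simp only [CornerMark.cells, List.mem_cons, Prod.mk.injEq, List.not_mem_nil, or_false]
      refine ⟨?_, ?_, ?_, ?_, by simp⟩ <;> omega
    have hmark := (hM.on ⟨b, D, 0, 1, m.1⟩ (by simp [cornerMarks])).h1
    simp only [add_zero] at hmark
    have hstep : ∀ z : Bool, (z = true ↔ (b + 1, y) ∈ P) →
        ((f || z) = true ↔ ∃ y', c ≤ y' ∧ y' < y + 1 ∧ (b + 1, y') ∈ P) := by
      intro z hz
      rw [Bool.or_eq_true, hf, hz]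
      constructor
      · rintro (⟨y', h1, h2, h3⟩ | h)
        · exact ⟨y', h1, by omega, h3⟩
        · exact ⟨y, by omega, by omega, h⟩
      · rintro ⟨y', h1, h2, h3⟩
        rcases (Int.lt_add_one_iff.1 h2).lt_or_eq with h | rfl
        · exact Or.inl ⟨y', h1, h, h3⟩
        · exact Or.inr h3
    refine WS.enter ?_ rfl
    by_cases hb : (b + 1, y) ∈ P
    · have hbT : (b + 1, y) ∈ T := (hoff _ _ (by omega) (by omega) (by omega) (by omega)).2 hb
      refine WS.act_keep (n := n + 5 * r + 4) (f := fun b => if b then (true, .left) else (false, .up))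
        true (by simpa using hbT) rfl ?_ (hV _ _ (by omega))
      simp only [Dir.move, eq_self, if_true]
      rw [show b + 1 - 1 = b by ring]
      refine WS.getU (decide ((b, y) ∈ T)) (by simp) ?_ (hV _ _ (by omega))
      refine WS.getR (decide ((b, y + 1) ∈ T)) (by simp) ?_ (hV _ _ (by omega))
      -- No false alarm: below `D` the block is unmarked, and a checkerboard would violate `hdiag`;
      -- at height `D` the pixel `(b, D + 1)` is the first one of the mark and empty.
      have hno : (!decide ((b, y) ∈ T) && decide ((b, y + 1) ∈ T) &&
          !decide ((b + 1, y + 1) ∈ T)) = false := by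
        rcases (show y ≤ D by omega).lt_or_eq with hlt | rfl
        · have := hdiag b y hb
          have e1 := hoff b y (by omega) (by omega) (by omega) (by omega)
          have e2 := hoff b (y + 1) (by omega) (by omega) (by omega) (by omega)
          have e3 := hoff (b + 1) (y + 1) (by omega) (by omega) (by omega) (by omega)
          simp only [e1, e2, e3]
          clear hoff ih H hstep hV hM hf hdiag
          by_cases h : (b, y) ∈ P <;> simp_all
        · simp [hmark]
      refine WS.act_keep (n := n + 5 * r + 1) (f := fun z =>
        if !decide ((b, y) ∈ T) && decide ((b, y + 1) ∈ T) && !z then (m.1.2.2.1, .left)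
        else (z, .down)) (decide ((b + 1, y + 1) ∈ T)) (by simp) (by simp only [hno]; rfl) ?_
        (hV _ _ (by omega))
      simp only [hno, Bool.false_eq_true, if_false, Dir.move]
      refine WS.mvU ?_ (hV _ _ (by omega))
      refine WS.finish (ih (y := y + 1) (f := true) (by omega) (by omega) ?_) le_rfl (by omega)
        (by simp)
      simpa using hstep true (by simpa using hb)
    · have hbT : (b + 1, y) ∉ T := fun h =>
        hb ((hoff _ _ (by omega) (by omega) (by omega) (by omega)).1 h)
      refine WS.act_keep (n := n + 5 * r + 4) (f := fun b => if b then (true, .left) else (false, .up))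
        false (by simpa using hbT) rfl ?_ (hV _ _ (by omega))
      refine (ih (y := y + 1) (f := f) (by omega) (by omega) ?_).mono le_rfl (by omega)
      simpa using hstep false (by simpa using hb)

/-- The marks that remain when the first mark has been restored. -/
def restMarks (a b c d A C : ℤ) (m : Bits × Bits × Bits × Bits) : List CornerMark :=
  [⟨A, d, -1, 0, m.2.1⟩, ⟨a, C, 0, -1, m.2.2.1⟩, ⟨b, c, 1, 0, m.2.2.2⟩]

/-- The code after a mark has been restored. -/
def advanceCode (m : Bits × Bits × Bits × Bits) (g : Bool × Bool × Bool) (cnt : Fin 7) (f : Bool) :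
    Code Label :=
  markCode fun n =>
    if f then turn rot (scan (m.2.1, m.2.2.1, m.2.2.2, n) (g.2.1, g.2.2, true) 0 n.1)
    else if cnt = 6 then turn rot setup
    else turn rot (scan (m.2.1, m.2.2.1, m.2.2.2, n) (g.2.1, g.2.2, false) (cnt + 1) n.1)

/-- The old mark is recognized and undone. The new one goes a column to the right if a tile was
found at this side, and a row up if the adjacent side has moved since the mark was set, which is
remembered in `g.1`. -/
theorem scan_end {a b c d A C D : ℤ} {m : Bits × Bits × Bits × Bits} {g : Bool × Bool × Bool}
    {cnt : Fin 7} {f : Bool} (hM : Marked P T (cornerMarks a b c d A C D m))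
    (hg : Lags a b c d A C D g)
    (hV : ∀ x y : ℤ, b ≤ x ∧ x ≤ b + 1 ∧ D + 1 ≤ y ∧ y ≤ D + 2 → (x, y) ∈ V)
    (H : ∀ T', Marked P T' (restMarks a b c d A C m) →
      WS body V K Post s n (cfg body (advanceCode m g cnt f) T' (b + (if f then 1 else 0), d + 1))) :
    WS body V K Post (s + 4) (n + 9) (cfg body (goto (scan m g cnt f)) T (b + 1, D + 1)) := by
  obtain ⟨h1, h2, h3, h4, h5⟩ := hg.bounds
  have hm := hM.on ⟨b, D, 0, 1, m.1⟩ (by simp [cornerMarks])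
  obtain ⟨h1, h2, h3, h4, b1, b2, b3, b4⟩ := hm
  simp only [add_zero, mul_zero, mul_one, sub_zero] at h1 h2 h3 h4 b1 b2 b3 b4
  refine WS.enter ?_ rfl
  refine WS.act_keep (n := n + 8) (f := fun b => if b then (true, .left) else (false, .up)) true
    (by simpa using h2) rfl ?_ (hV _ _ (by omega))
  simp only [Dir.move, eq_self, if_true]
  rw [show b + 1 - 1 = b by ring]
  refine WS.getU false (by simpa using h1) ?_ (hV _ _ (by omega))
  refine WS.getR true (by simpa [add_assoc] using h4) ?_ (hV _ _ (by omega))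
  refine WS.act (s := s + 3) (n := n + 5) (f := fun z => if !false && true && !z then
    (m.1.2.2.1, .left) else (z, .down)) false (by simpa [add_assoc] using h3) ?_ (hV _ _ (by omega))
  simp only [Bool.not_false, Bool.true_and, if_true, Dir.move]
  rw [show b + 1 - 1 = b by ring, show D + 1 + 1 = D + 2 by ring]
  refine WS.putD ?_ (hV _ _ (by omega))
  refine WS.putR ?_ (hV _ _ (by omega))
  refine WS.putL ?_ (hV _ _ (by omega))
  rw [show b + 1 - 1 = b by ring, show D + 2 - 1 = D + 1 by ring]
  have H' := H (upd (upd (upd (upd T (b + 1, D + 2) m.1.2.2.1) (b, D + 2) m.1.2.2.2)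
    (b, D + 1) m.1.1) (b + 1, D + 1) m.1.2.1) (hM.restore ?_ ?_)
  · have hg1 := hg.top.2
    cases f <;> cases hg1' : g.1 <;> simp only [hg1', Bool.false_eq_true, if_false, if_true] at hg1 H' ⊢
    · exact WS.finish H' (by omega) (by omega) (by simp; omega)
    · refine WS.mvU ?_ (hV _ _ (by omega))
      exact WS.finish H' (by omega) (by omega) (by simp; omega)
    · refine WS.mvR ?_ (hV _ _ (by omega))
      exact WS.finish H' (by omega) (by omega) (by simp; omega)
    · refine WS.mvR ?_ (hV _ _ (by omega))
      refine WS.mvU ?_ (hV _ _ (by omega))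
      exact WS.finish H' (by omega) (by omega) (by simp; omega)
  · simp only [CornerMark.cells, List.forall_mem_cons]
    simp only [List.mem_cons, Prod.mk.injEq, List.not_mem_nil, or_false]
    refine ⟨?_, ?_, ?_, by simp⟩ <;> refine ⟨?_, ?_, ?_, ?_, by simp⟩ <;> omega
  · rintro ⟨x, y⟩
    simp only [CornerMark.cells, List.mem_cons, Prod.mk.injEq, List.not_mem_nil, or_false, mem_upd,
      ne_eq, add_zero, mul_zero, mul_one, sub_zero]
    have e1 : x = b → y = D + 1 → ((x, y) ∈ P ↔ m.1.1 = true) := by rintro rfl rfl; exact b1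
    have e2 : x = b + 1 → y = D + 1 → ((x, y) ∈ P ↔ m.1.2.1 = true) := by rintro rfl rfl; exact b2
    have e3 : x = b + 1 → y = D + 2 → ((x, y) ∈ P ↔ m.1.2.2.1 = true) := by rintro rfl rfl; exact b3
    have e4 : x = b → y = D + 2 → ((x, y) ∈ P ↔ m.1.2.2.2 = true) := by rintro rfl rfl; exact b4
    clear b1 b2 b3 b4 h1 h2 h3 h4 hV H hM hg
    grind

/-! ### Rectangles that contain the polyomino -/

/-- The properties of a polyomino that the robot makes use of: there are no diagonal pairs without
a common neighbour, and a rectangle that contains a tile, but none next to its boundary, contains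
all tiles. -/
structure Nice (P : Finset Pixel) : Prop where
  diag : ∀ x y : ℤ, (x + 1, y) ∈ P → (x, y + 1) ∈ P → (x, y) ∈ P ∨ (x + 1, y + 1) ∈ P
  diag' : ∀ x y : ℤ, (x, y) ∈ P → (x + 1, y + 1) ∈ P → (x + 1, y) ∈ P ∨ (x, y + 1) ∈ P
  closed : ∀ a b c d : ℤ, (∃ x y : ℤ, (x, y) ∈ P ∧ a ≤ x ∧ x ≤ b ∧ c ≤ y ∧ y ≤ d) →
    (∀ y, c ≤ y → y ≤ d → (b + 1, y) ∉ P ∧ (a - 1, y) ∉ P) →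
    (∀ x, a ≤ x → x ≤ b → (x, d + 1) ∉ P ∧ (x, c - 1) ∉ P) →
    ∀ x y : ℤ, (x, y) ∈ P → a ≤ x ∧ x ≤ b ∧ c ≤ y ∧ y ≤ d

/-- A quarter turn exchanges the two diagonals, which is why both `diag` and `diag'` are required.
-/
theorem Nice.turn (h : Nice P) : Nice (P.map rotL⁻¹.toEmbedding) := by
  refine ⟨fun x y h1 h2 => ?_, fun x y h1 h2 => ?_, fun a b c d h0 h1 h2 x y hxy => ?_⟩
  · rw [mem_map_rotL] at *
    have := h.diag' (-(y + 1)) x h2 (by rwa [show -(y + 1) + 1 = -y by ring])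
    rw [show -(y + 1) + 1 = -y by ring] at this
    rwa [mem_map_rotL]
  · rw [mem_map_rotL] at *
    have := h.diag (-(y + 1)) x (by rwa [show -(y + 1) + 1 = -y by ring]) h2
    rw [show -(y + 1) + 1 = -y by ring] at this
    rw [mem_map_rotL]
    exact this.symm
  · obtain ⟨x', y', h3, h4⟩ := h0
    have := h.closed (-d) (-c) a b ⟨-y', x', mem_map_rotL.1 h3, by omega⟩
      (fun y hy hy' => by
        have := h2 y hy hy'
        rw [mem_map_rotL, mem_map_rotL] at this
        rwa [show -c + 1 = -(c - 1) by ring, show -d - 1 = -(d + 1) by ring, and_comm])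
      (fun x hx hx' => by
        have := h1 (-x) (by omega) (by omega)
        rwa [mem_map_rotL, mem_map_rotL, neg_neg] at this) (-y) x (mem_map_rotL.1 hxy)
    omega

/-- A rectangle of pixels. -/
structure Box where
  x0 : ℤ
  x1 : ℤ
  y0 : ℤ
  y1 : ℤ

namespace Box

/-- The rectangle in the frame of reference that is turned to the left. -/
def turn (B : Box) : Box := ⟨B.y0, B.y1, -B.x1, -B.x0⟩

/-- The number of columns. -/
def w (B : Box) : ℕ := (B.x1 - B.x0 + 1).toNat

/-- The number of rows. -/
def h (B : Box) : ℕ := (B.y1 - B.y0 + 1).toNat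

theorem w_turn (B : Box) : B.turn.w = B.h := rfl

theorem h_turn (B : Box) : B.turn.h = B.w := by
  simp only [turn, w, h]
  congr 1
  ring

/-- The pixels that the robot visits when the bounding box has been found. -/
def region (B : Box) : Set Pixel := {p | (p.1 - B.x0, p.2 - B.y0) ∈ TileRobot.region B.w B.h}

/-- The rectangle is the bounding box of `P`. -/
structure IsBound (B : Box) (P : Finset Pixel) : Prop where
  mem : ∀ x y : ℤ, (x, y) ∈ P → B.x0 ≤ x ∧ x ≤ B.x1 ∧ B.y0 ≤ y ∧ y ≤ B.y1
  left : ∃ y, (B.x0, y) ∈ P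
  right : ∃ y, (B.x1, y) ∈ P
  bot : ∃ x, (x, B.y0) ∈ P
  top : ∃ x, (x, B.y1) ∈ P

theorem IsBound.turn {B : Box} (h : B.IsBound P) : B.turn.IsBound (P.map rotL⁻¹.toEmbedding) := by
  obtain ⟨h0, ⟨y, h1⟩, ⟨y', h2⟩, ⟨x, h3⟩, ⟨x', h4⟩⟩ := h
  refine ⟨fun x y hxy => ?_, ⟨-x, ?_⟩, ⟨-x', ?_⟩, ⟨y', ?_⟩, ⟨y, ?_⟩⟩
  · have := h0 _ _ (mem_map_rotL.1 hxy)
    simp only [Box.turn]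
    omega
  all_goals exact mem_map_rotL.2 (by simpa [Box.turn])

/-- The set `V` contains the region of the rectangle in all four frames of reference. -/
def Covers (B : Box) (V : Set Pixel) : Prop :=
  ∀ j : ℕ, ∀ p ∈ (turn^[j] B).region, (rotL ^ j) p ∈ V

theorem Covers.turn {B : Box} (h : B.Covers V) : B.turn.Covers (rotL ⁻¹' V) := fun j p hp => by
  have := h (j + 1) p hp
  rwa [pow_succ'] at this

theorem Covers.mem {B : Box} (h : B.Covers V) {x y : ℤ} (hx : B.x0 - 3 ≤ x ∧ x ≤ B.x1 + 3)
    (hy : B.y0 - 3 ≤ y ∧ y ≤ B.y1 + 3) : (x, y) ∈ V := by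
  refine h 0 (x, y) ?_
  simp only [region, TileRobot.region, Box.w, Box.h, Function.iterate_zero, id, Set.mem_ofPred_eq]
  omega

end Box

theorem Rotated.map {ρ ρ' : Pixel → Pixel} {g : Perm Dir} {E : Perm Pixel} {c : Cfg Label}
    (hE : ∀ v, ∃ v', ∀ p, E (ρ p + v) = ρ' (E p) + v')
    (h : Rotated ρ (E ⁻¹' V) (P.map E⁻¹.toEmbedding) c) : Rotated ρ' V P (c.map g E) := by
  obtain ⟨h1, h2, v, h3⟩ := h
  obtain ⟨v', hv'⟩ := hE v
  refine ⟨h1, h2, v', ?_⟩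
  ext q
  simp only [Cfg.map, h3, Finset.mem_map, Finset.mem_image, Equiv.coe_toEmbedding]
  constructor
  · rintro ⟨_, ⟨_, ⟨p, hp, rfl⟩, rfl⟩, rfl⟩
    exact ⟨p, hp, by rw [hv']; simp⟩
  · rintro ⟨p, hp, rfl⟩
    exact ⟨_, ⟨_, ⟨p, hp, rfl⟩, rfl⟩, by rw [hv']; simp⟩

theorem rotateCW_rotL (v : Pixel) : ∃ v', ∀ p, rotL (rotateCW p + v) = rotateCW (rotL p) + v' := by
  refine ⟨rotL v, fun p => ?_⟩
  ext <;> simp [rotL, rotateCW]; ring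

theorem rotateCW_shift (u v : Pixel) :
    ∃ v', ∀ p, shift u (rotateCW p + v) = rotateCW (shift u p) + v' := by
  refine ⟨v + u - rotateCW u, fun p => ?_⟩
  ext <;> simp [shift, rotateCW] <;> ring

theorem mem_map_shift {a b x y : ℤ} :
    (x, y) ∈ T.map (shift (a, b))⁻¹.toEmbedding ↔ (x + a, y + b) ∈ T := by
  rw [mem_map_perm]
  rfl

theorem Marked.mem_iff {L : List CornerMark} (h : Marked P T L)
    (hd : ∀ μ ∈ L, ∀ p ∈ μ.cells, p ∉ P) (p : Pixel) :
    p ∈ T ↔ p ∈ P ∨ ∃ μ ∈ L, p = (μ.x + μ.u + μ.v, μ.y + μ.v - μ.u) ∨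
      p = (μ.x + 2 * μ.u, μ.y + 2 * μ.v) := by
  by_cases hp : ∃ μ ∈ L, p ∈ μ.cells
  · obtain ⟨μ, hμ, hp⟩ := hp
    have hP := hd μ hμ p hp
    obtain ⟨h1, h2, h3, h4, -⟩ := h.on μ hμ
    constructor
    · intro hT
      refine Or.inr ⟨μ, hμ, ?_⟩
      simp only [CornerMark.cells, List.mem_cons, List.not_mem_nil, or_false] at hp
      rcases hp with rfl | rfl | rfl | rfl
      · exact absurd hT h1
      · exact Or.inl rfl
      · exact absurd hT h3
      · exact Or.inr rfl
    · rintro (hp | ⟨ν, hν, rfl | rfl⟩)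
      · exact absurd hp hP
      · exact (h.on ν hν).h2
      · exact (h.on ν hν).h4
  · push Not at hp
    rw [h.off p hp, iff_self_or]
    rintro ⟨μ, hμ, rfl | rfl⟩
    · exact absurd (by simp [CornerMark.cells]) (hp μ hμ)
    · exact absurd (by simp [CornerMark.cells]) (hp μ hμ)

/-- Around the bounding box all marks lie outside of `P`. Hence the memorized states can be dropped,
and each mark contributes just its two tiles. -/
theorem boxed_of_marked {a b c d : ℤ} {m : Bits × Bits × Bits × Bits}
    (hM : Marked P T (cornerMarks a b c d a c d m)) (hab : a ≤ b) (hcd : c ≤ d)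
    (hP : ∀ x y : ℤ, (x, y) ∈ P → a ≤ x ∧ x ≤ b ∧ c ≤ y ∧ y ≤ d) :
    Boxed (P.map (shift (a, c))⁻¹.toEmbedding) (b - a + 1).toNat (d - c + 1).toNat
      (T.map (shift (a, c))⁻¹.toEmbedding) := by
  intro x y
  rw [mem_map_shift, mem_map_shift]
  rw [hM.mem_iff]
  · simp only [cornerMarks, List.mem_cons, List.not_mem_nil, or_false, exists_eq_or_imp,
      exists_eq_left, Prod.mk.injEq, or_assoc]
    rw [show ((b - a + 1).toNat : ℤ) = b - a + 1 by omega,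
      show ((d - c + 1).toNat : ℤ) = d - c + 1 by omega]
    refine or_congr Iff.rfl (or_congr ?_ (or_congr ?_ (or_congr ?_ (or_congr ?_ (or_congr ?_
      (or_congr ?_ (or_congr ?_ ?_))))))) <;> omega
  · simp only [cornerMarks, CornerMark.cells, List.forall_mem_cons]
    simp only [List.not_mem_nil, false_imp_iff, implies_true, and_true]
    refine ⟨⟨?_, ?_, ?_, ?_⟩, ⟨?_, ?_, ?_, ?_⟩, ⟨?_, ?_, ?_, ?_⟩, ⟨?_, ?_, ?_, ?_⟩⟩ <;> intro h <;>
      have := hP _ _ h <;> omega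

theorem WP.set_mono {V' : Set Pixel} {n : ℕ} {c : Cfg Label} (h : WP body V K Post n c)
    (hV : V ⊆ V') : WP body V' K Post n c := by
  induction h with
  | done n c hc => exact .done _ _ hc
  | step n c h1 h2 h3 _ ih => exact .step _ _ h1 (hV h2) h3 ih

theorem rotate_marked {a b c d : ℤ} {m : Bits × Bits × Bits × Bits}
    (hM : Marked P T (cornerMarks a b c d a c d m)) (hab : a ≤ b) (hcd : c ≤ d)
    (hP : ∀ x y : ℤ, (x, y) ∈ P → a ≤ x ∧ x ≤ b ∧ c ≤ y ∧ y ≤ d)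
    (hV : (⟨a, b, c, d⟩ : Box).region ⊆ V)
    {w h : ℕ} (hw : w = (b - a + 1).toNat) (hh : h = (d - c + 1).toNat)
    (hK : P.card + 10 * (w + h) + 200 ≤ K) :
    WP body V K (Rotated rotateCW V P) (2000 * ((w + h) * (w * h)))
      (cfg body (goto setup) T (b + 1, c)) := by
  have e : cfg body (goto setup) T (b + 1, c) = (cfg body (goto setup)
      (T.map (shift (a, c))⁻¹.toEmbedding) (w, 0)).map 1 (shift (a, c)) := by
    rw [cfg_map_one]
    congr 1
    · ext r
      rw [mem_map_perm, mem_map_perm]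
      exact Eq.to_iff (congrArg (· ∈ T) ((shift (a, c)).apply_symm_apply r).symm)
    · ext <;> simp [shift]
      omega
  rw [e]
  have hV' : region w h ⊆ shift (a, c) ⁻¹' V := by
    rintro ⟨x, y⟩ hxy
    refine hV ?_
    subst hw hh
    simpa [Box.region, shift, Box.w, Box.h] using hxy
  have hb := boxed_of_marked hM hab hcd hP
  rw [← hw, ← hh] at hb
  refine WP.of_symm (isSymmetry_shift _) (((rotate_boxed (K := K) (by omega) (by omega)
    (fun x y hxy => ?_) hb ?_).set_mono hV').post_mono fun c' hc' =>
      Rotated.map (rotateCW_shift _) ⟨hc'.1, hV' hc'.2.1, hc'.2.2⟩)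
  · have := hP _ _ (mem_map_shift.1 hxy)
    omega
  · rwa [Finset.card_map]

/-- The invariant of the search for the bounding box `B`. -/
structure ScanInv (B : Box) (P T : Finset Pixel) (a b c d A C D : ℤ)
    (m : Bits × Bits × Bits × Bits) (g : Bool × Bool × Bool) (cnt : ℕ) (f : Bool) : Prop where
  rect : B.x0 ≤ a ∧ b ≤ B.x1 ∧ B.y0 ≤ c ∧ d ≤ B.y1
  tile : ∃ x y : ℤ, (x, y) ∈ P ∧ a ≤ x ∧ x ≤ b ∧ c ≤ y ∧ y ≤ d
  marked : Marked P T (cornerMarks a b c d A C D m)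
  lags : Lags a b c d A C D g
  fresh : (1 ≤ cnt → C = c) ∧ (2 ≤ cnt → A = a) ∧ (3 ≤ cnt → D = d)
  bot : 4 ≤ cnt → ∀ x, a ≤ x → x ≤ b → (x, c - 1) ∉ P
  left : 5 ≤ cnt → ∀ y, c ≤ y → y ≤ d → (a - 1, y) ∉ P
  top : 6 ≤ cnt → ∀ x, a ≤ x → x ≤ b → (x, d + 1) ∉ P
  first : f = true ↔ (b + 1, c) ∈ P

theorem turn_marks {a b b' c d A C : ℤ} {m : Bits × Bits × Bits × Bits} {k : Bits} :
    (restMarks a b c d A C m ++ [(⟨b', d, 0, 1, k⟩ : CornerMark)]).map CornerMark.turn =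
      cornerMarks c d (-b') (-a) C (-b) (-A) (m.2.1, m.2.2.1, m.2.2.2, k) := by
  simp [restMarks, cornerMarks, CornerMark.turn]

/-- A scan reaches only up to the mark at height `D`, which may lag behind the corner by one. After
three sides in succession without a tile all marks are up to date, and only from then on does a scan
cover an entire side. This explains the thresholds `1`, `2`, `3` for the marks and `4`, `5`, `6` for
the sides. -/
theorem ScanInv.next {B : Box} {a b c d A C D : ℤ} {m : Bits × Bits × Bits × Bits}
    {g : Bool × Bool × Bool} {cnt : ℕ} {f₀ : Bool} (h : ScanInv B P T₀ a b c d A C D m g cnt f₀)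
    (hB : B.IsBound P) {f : Bool}
    (hf : f = true ↔ ∃ y', c ≤ y' ∧ y' ≤ D ∧ (b + 1, y') ∈ P) {k : Bits} {cnt' : ℕ}
    (hM : Marked P T (restMarks a b c d A C m ++ [⟨b + (if f then 1 else 0), d, 0, 1, k⟩]))
    (hk : (b + (if f then 1 else 0), d + 1) ∈ P ↔ k.1 = true)
    (hcnt : cnt' = if f then 0 else cnt + 1) :
    ScanInv B.turn (P.map rotL⁻¹.toEmbedding) (T.map rotL⁻¹.toEmbedding) c d
      (-(b + (if f then 1 else 0))) (-a) C (-b) (-A) (m.2.1, m.2.2.1, m.2.2.2, k)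
      (g.2.1, g.2.2, f) cnt' k.1 := by
  obtain ⟨hr, ⟨x, y, ht⟩, -, ⟨⟨g1, g1'⟩, ⟨g2, g2'⟩, ⟨g3, g3'⟩⟩, ⟨e1, e2, e3⟩, hbot, hleft, htop, -⟩ := h
  have hab : a ≤ b := by omega
  refine ⟨?_, ⟨y, -x, mem_map_rotL.2 (by simpa using ht.1), ?_⟩, turn_marks ▸ hM.turn,
    ⟨⟨?_, ?_⟩, ⟨?_, ?_⟩, ⟨?_, ?_⟩⟩, ⟨?_, ?_, ?_⟩, ?_, ?_, ?_, ?_⟩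
  · simp only [Box.turn]
    cases f
    · simp only [Bool.false_eq_true, if_false]
      omega
    · obtain ⟨y', -, -, h⟩ := hf.1 rfl
      have := hB.mem _ _ h
      simp only [if_true]
      omega
  · split_ifs <;> omega
  · split_ifs <;> omega
  · simp only
    omega
  · omega
  · exact g3'
  · omega
  · simp only
    omega
  · intro h
    cases f <;> simp_all
  · intro h
    cases f
    · simp only [Bool.false_eq_true, if_false] at hcnt
      exact e1 (by omega)
    · simp_all
  · intro h
    cases f
    · simp only [Bool.false_eq_true, if_false] at hcnt
      rw [e2 (by omega)]
    · simp_all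
  · intro h x hx hx'
    cases f
    · simp only [Bool.false_eq_true, if_false, add_zero] at hcnt ⊢
      rw [mem_map_rotL, show -(-b - 1) = b + 1 by ring]
      exact fun hP => by simpa using hf.2 ⟨x, hx, by rw [e3 (by omega)]; exact hx', hP⟩
    · simp_all
  · intro h y hy hy'
    cases f
    · simp only [Bool.false_eq_true, if_false, add_zero] at hcnt hy ⊢
      rw [mem_map_rotL]
      exact hbot (by omega) _ (by omega) (by omega)
    · simp_all
  · intro h x hx hx'
    cases f
    · simp only [Bool.false_eq_true, if_false] at hcnt ⊢
      rw [mem_map_rotL, show -(-a + 1) = a - 1 by ring]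
      exact hleft (by omega) _ hx hx'
    · simp_all
  · rw [mem_map_rotL, neg_neg, hk]

theorem scan_side {B : Box} {a b c d A C D : ℤ} {m : Bits × Bits × Bits × Bits}
    {g : Bool × Bool × Bool} {cnt : Fin 7} {f₀ : Bool} (hP : Nice P)
    (h : ScanInv B P T a b c d A C D m g cnt f₀) (hV : B.Covers V) {S : ℕ} (hS : d - c + 1 ≤ S)
    (H : ∀ (f : Bool) (k : Bits) (T' : Finset Pixel),
      (f = true ↔ ∃ y', c ≤ y' ∧ y' ≤ D ∧ (b + 1, y') ∈ P) →
      Marked P T' (restMarks a b c d A C m ++ [⟨b + (if f then 1 else 0), d, 0, 1, k⟩]) →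
      ((b + (if f then 1 else 0), d + 1) ∈ P ↔ k.1 = true) →
      WS body V K Post s n (cfg body (
        if f then turn rot (scan (m.2.1, m.2.2.1, m.2.2.2, k) (g.2.1, g.2.2, true) 0 k.1)
        else if cnt = 6 then turn rot setup
        else turn rot (scan (m.2.1, m.2.2.1, m.2.2.2, k) (g.2.1, g.2.2, false) (cnt + 1) k.1))
        T' (b + (if f then 1 else 0), d + 1))) :
    WS body V K Post (s + 8) (n + 5 * S + 20)
      (cfg body (goto (scan m g cnt f₀)) T (b + 1, c)) := by
  obtain ⟨g1, g2, g3, g4, g5, g6, g7⟩ := h.lags.bounds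
  obtain ⟨hr1, hr2, hr3, hr4⟩ := h.rect
  obtain ⟨r, hr⟩ := Int.eq_ofNat_of_zero_le (sub_nonneg.2 g1)
  refine (scan_start (n := n + 4 + 9 + 5 * r) h.marked (hV.mem (by omega) (by omega))
    (scan_loop (n := n + 4 + 9) hP.diag h.marked h.lags
      (fun x y _ => hV.mem (by omega) (by omega)) (fun f hf => ?_) r le_rfl
        (by omega) ?_)).mono le_rfl
        (by omega)
  · refine scan_end (s := s + 4) (n := n + 4) h.marked h.lags
      (fun x y _ => hV.mem (by omega) (by omega)) fun T' hT' => ?_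
    refine place_mark hT' ?_ (fun x y _ => hV.mem ?_ (by omega)) fun k T' hT' hk => H f k T' hf hT' hk
    · intro k
      simp only [restMarks, CornerMark.cells, List.forall_mem_cons]
      simp only [List.mem_cons, Prod.mk.injEq, List.not_mem_nil, or_false, false_imp_iff,
        implies_true, and_true]
      cases f <;> simp only [Bool.false_eq_true, if_false, if_true] <;>
        refine ⟨⟨?_, ?_, ?_, ?_⟩, ⟨?_, ?_, ?_, ?_⟩, ⟨?_, ?_, ?_, ?_⟩⟩ <;> omega
    · split_ifs at * <;> omega
  · rw [h.first]
    constructor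
    · exact fun h => ⟨c, le_rfl, by omega, h⟩
    · rintro ⟨y', h1, h2, h3⟩
      rwa [show c = y' by omega]

/-- The search for the bounding box, followed by the rotation. -/
theorem rotate_scan {S : ℕ} (μ : ℕ) {N : ℕ} {V : Set Pixel} {P T : Finset Pixel} {B : Box}
    {a b c d A C D : ℤ} {m : Bits × Bits × Bits × Bits} {g : Bool × Bool × Bool} {cnt : Fin 7}
    {f : Bool} (hP : Nice P) (hB : B.IsBound P) (hV : B.Covers V)
    (h : ScanInv B P T a b c d A C D m g cnt f) (hS : B.w + B.h = S)
    (hK : P.card + 10 * S + 200 ≤ K) (hN : 2000 * (S * (B.w * B.h)) ≤ N)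
    (hμ : 9 * ((B.x1 - B.x0) - (b - a) + ((B.y1 - B.y0) - (d - c))) + (7 - cnt) ≤ μ) :
    WP body V K (Rotated rotateCW V P) (N + μ * (5 * S + 20))
      (cfg body (goto (scan m g cnt f)) T (b + 1, c)) := by
  -- The potential `μ` drops with every side: without a tile the counter increases, and with one the
  -- rectangle grows, which gains `9`, while resetting the counter costs at most `6`.
  induction μ generalizing V P T B a b c d A C D m g cnt f with
  | zero =>
    have := h.rect
    omega
  | succ μ ih =>
    obtain ⟨hr1, hr2, hr3, hr4⟩ := h.rect
    obtain ⟨x₀, y₀, ht⟩ := h.tile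
    have hcard : T.card ≤ P.card + 16 := h.marked.card_le
    suffices hs : WS body V K (Rotated rotateCW V P) (0 + 8) (N + μ * (5 * S + 20) + 5 * S + 20)
        (cfg body (goto (scan m g cnt f)) T (b + 1, c)) from
      (hs (by
        simp only [cfg, Box.w, Box.h] at hS ⊢
        omega)).mono (by rw [add_mul μ]; omega)
    refine scan_side hP h hV (by simp only [Box.w, Box.h] at hS; omega)
      fun f' k T' hf hM hk _ => ?_
    have hinv := fun cnt' hcnt => h.next hB hf hM hk (cnt' := cnt') hcnt
    have hK' : (P.map rotL⁻¹.toEmbedding).card + 10 * S + 200 ≤ K := by rwa [Finset.card_map]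
    have hS' : B.turn.w + B.turn.h = S := by rw [B.w_turn, B.h_turn, add_comm, hS]
    have hN' : 2000 * (S * (B.turn.w * B.turn.h)) ≤ N := by
      rwa [B.w_turn, B.h_turn, mul_comm B.h]
    cases f'
    · simp only [Bool.false_eq_true, if_false, add_zero] at hinv hM ⊢
      have hinv := hinv _ rfl
      -- Seven sides in succession without a tile: three to bring the marks up to date and four that
      -- exclude tiles next to the whole boundary. By connectedness the rectangle contains `P`, so
      -- it is the bounding box.
      by_cases hc : cnt = 6
      · subst hc
        simp only [if_true]
        have hR : ∀ x y : ℤ, (x, y) ∈ P → a ≤ x ∧ x ≤ b ∧ c ≤ y ∧ y ≤ d :=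
          hP.closed a b c d h.tile
            (fun y hy hy' => ⟨fun hy'' => by
              simpa using hf.2 ⟨y, hy, by rw [h.fresh.2.2 (by decide)]; exact hy', hy''⟩,
              h.left (by decide) y hy hy'⟩)
            fun x hx hx' => ⟨h.top (by decide) x hx hx', h.bot (by decide) x hx hx'⟩
        obtain rfl : a = B.x0 := le_antisymm (hR _ _ hB.left.choose_spec).1 hr1
        obtain rfl : b = B.x1 := le_antisymm hr2 (hR _ _ hB.right.choose_spec).2.1
        obtain rfl : c = B.y0 := le_antisymm (hR _ _ hB.bot.choose_spec).2.2.1 hr3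
        obtain rfl : d = B.y1 := le_antisymm hr4 (hR _ _ hB.top.choose_spec).2.2.2
        have hM' := hinv.marked
        rw [h.fresh.1 (by decide), h.fresh.2.1 (by decide)] at hM'
        refine WP.turn isSymmetry_rotL (WP.post_mono ((rotate_marked hM' (by omega) (by omega)
          (fun x y hxy => ?_) (fun p hp => hV 1 p hp) (w := B.h) (h := B.w) rfl ?_ ?_).mono ?_)
          fun c' hc' => Rotated.map rotateCW_rotL hc')
        · have := hR _ _ (mem_map_rotL.1 hxy)
          omega
        · rw [Box.w]
          congr 1
          ring
        · rw [Finset.card_map]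
          omega
        · rw [add_comm B.h, hS, mul_comm B.h]
          omega
      · simp only [hc, if_false]
        have hcnt : (cnt + 1).val = cnt.val + 1 := by
          have := Fin.val_add_one_of_lt (i := cnt) (by
            rw [Fin.lt_def]
            have := Fin.val_ne_of_ne hc
            have := cnt.2
            simp only [Fin.val_last]
            omega)
          exact this
        rw [← hcnt] at hinv
        refine WP.turn isSymmetry_rotL (WP.post_mono (ih hP.turn hB.turn hV.turn hinv hS' hK' hN' ?_)
          fun c' hc' => Rotated.map rotateCW_rotL hc')
        simp only [Box.turn]
        omega
    · simp only [if_true] at hinv hM ⊢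
      have hinv := hinv _ rfl
      refine WP.turn isSymmetry_rotL (WP.post_mono (ih hP.turn hB.turn hV.turn
        (cnt := 0) hinv hS' hK' hN' ?_) fun c' hc' => Rotated.map rotateCW_rotL hc')
      simp only [Box.turn]
      omega

/-- The first three marks are set around a single tile, before the search starts. -/
theorem rotate_init {S : ℕ} (i : ℕ) {N : ℕ} {V : Set Pixel} {P T : Finset Pixel} {B : Box} {x y : ℤ}
    {m : Bits × Bits × Bits × Bits} {k : Fin 4} (hk : k.val + i = 3) (hP : Nice P)
    (hB : B.IsBound P) (hV : B.Covers V) (hxy : (x, y) ∈ P)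
    (hM : Marked P T ((restMarks x x y y x y m).drop i)) (hS : B.w + B.h = S)
    (hK : P.card + 10 * S + 200 ≤ K) (hN : 2000 * (S * (B.w * B.h)) + (9 * S + 7) * (5 * S + 20) ≤ N) :
    WP body V K (Rotated rotateCW V P) (N + (i + 1) * 6) (cfg body (goto (init k m)) T (x, y)) := by
  -- Dropping `i` entries leaves the marks that exist already. One mark takes six steps: up, four
  -- for the mark, and back down.
  induction i using Nat.strong_induction_on generalizing V P T B x y m k with | _ i ih
  have hmem := hB.mem x y hxy
  have hlen : ((restMarks x x y y x y m).drop i).length ≤ 3 := by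
    rw [List.length_drop]
    exact Nat.sub_le _ _
  have hcard := hM.card_le
  have hd : ∀ k : Bits, ∀ ν ∈ (restMarks x x y y x y m).drop i,
      ∀ p ∈ (⟨x, y, 0, 1, k⟩ : CornerMark).cells, p ∉ ν.cells := by
    suffices h : ∀ k : Bits, ∀ ν ∈ restMarks x x y y x y m,
        ∀ p ∈ (⟨x, y, 0, 1, k⟩ : CornerMark).cells, p ∉ ν.cells from
      fun k ν hν => h k ν (List.mem_of_mem_drop hν)
    intro k
    simp only [restMarks, CornerMark.cells, List.forall_mem_cons]
    simp only [List.mem_cons, Prod.mk.injEq, List.not_mem_nil, or_false, false_imp_iff,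
      implies_true, and_true]
    refine ⟨⟨?_, ?_, ?_, ?_⟩, ⟨?_, ?_, ?_, ?_⟩, ⟨?_, ?_, ?_, ?_⟩⟩ <;> omega
  have hK' : (P.map rotL⁻¹.toEmbedding).card + 10 * S + 200 ≤ K := by rwa [Finset.card_map]
  have hS' : B.turn.w + B.turn.h = S := by rw [B.w_turn, B.h_turn, add_comm, hS]
  have hN' : 2000 * (S * (B.turn.w * B.turn.h)) + (9 * S + 7) * (5 * S + 20) ≤ N := by
    rwa [B.w_turn, B.h_turn, mul_comm B.h]
  suffices hs : WS body V K (Rotated rotateCW V P) (0 + 4) (N + i * 6 + 1 + 4 + 1)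
      (cfg body (goto (init k m)) T (x, y)) from
    (hs (by simp only [cfg]; omega)).mono (by omega)
  refine WS.enter ?_ rfl
  refine WS.mvU ?_ (hV.mem (by omega) (by omega))
  refine place_mark hM hd (fun a b _ => hV.mem (by omega) (by omega)) fun n T' hM' hn => ?_
  have hM'' := hM'.turn
  rw [List.map_append, List.map_drop] at hM''
  have hxy' : (y, -x) ∈ P.map rotL⁻¹.toEmbedding := mem_map_rotL.2 (by simpa)
  cases i with
  | zero =>
    obtain rfl : k = 3 := Fin.ext hk
    simp only [if_true]
    refine WS.mono (s := 0) (n := N) ?_ le_rfl (by omega)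
    intro _
    have hinv : ScanInv B.turn (P.map rotL⁻¹.toEmbedding) (T'.map rotL⁻¹.toEmbedding) y y (-x) (-x)
        y (-x) (-x) (m.2.1, m.2.2.1, m.2.2.2, n) (false, false, false) (0 : Fin 7) n.1 := by
      refine ⟨?_, ⟨y, -x, hxy', le_rfl, le_rfl, le_rfl, le_rfl⟩, ?_, ⟨?_, ?_, ?_⟩, ?_, ?_, ?_, ?_, ?_⟩
      · simp only [Box.turn]
        omega
      · rw [← turn_marks (a := x) (b := x) (m := m), List.map_append]
        exact hM''
      · simp
      · simp
      · simp
      · simp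
      · simp
      · simp
      · simp
      · rw [mem_map_rotL, neg_neg, hn]
    refine WP.turn isSymmetry_rotL (WP.post_mono ((rotate_scan (9 * S + 7) hP.turn hB.turn hV.turn
      hinv hS' hK' le_rfl ?_).mono hN') fun c' hc' => Rotated.map rotateCW_rotL hc')
    simp only [Box.w, Box.h] at hS
    simp only [Box.turn, Fin.val_zero]
    omega
  | succ i =>
    have hk3 : k ≠ 3 := by
      rintro rfl
      simp at hk
    have hk' : (k + 1).val + i = 3 := by
      have : (k + 1).val = k.val + 1 := Fin.val_add_one_of_lt (by
        rw [Fin.lt_def, Fin.val_last]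
        omega)
      omega
    simp only [hk3, if_false]
    refine WS.mvD ?_ (hV.mem (by omega) (by omega))
    refine WS.mono (s := 0) (n := N + (i + 1) * 6) ?_ (by omega) (by omega)
    rw [show y + 1 - 1 = y by ring]
    intro _
    refine WP.turn isSymmetry_rotL (WP.post_mono (ih i (Nat.lt_succ_self i) hk' hP.turn hB.turn hV.turn hxy'
      ?_ hS' hK' hN') fun c' hc' => Rotated.map rotateCW_rotL hc')
    refine Eq.mp ?_ hM''
    congr 1
    rcases i with _ | _ | i
    · simp [restMarks, CornerMark.turn]
    · simp [restMarks, CornerMark.turn]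
    · obtain rfl : i = 0 := by omega
      simp [restMarks, CornerMark.turn]

/-! ### Polyominoes and their bounding boxes -/

theorem IsPolyomino.nonempty (h : IsPolyomino P) : P.Nonempty := by
  obtain ⟨⟨p, hp⟩⟩ := h.connected.nonempty
  exact ⟨p, hp⟩

theorem grid_adj_iff {x y x' y' : ℤ} : grid.Adj (x, y) (x', y') ↔
    (x' = x + 1 ∧ y' = y) ∨ (x' = x - 1 ∧ y' = y) ∨ (x' = x ∧ y' = y + 1) ∨
      (x' = x ∧ y' = y - 1) := by
  simp only [grid]
  rcases abs_cases (x - x') with ⟨h1, h2⟩ | ⟨h1, h2⟩ <;>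
    rcases abs_cases (y - y') with ⟨h3, h4⟩ | ⟨h3, h4⟩ <;> rw [h1, h3] <;> omega

/-- A common neighbour of a diagonal pair is one of the two other corners of the 2×2 block.
Closedness of rectangles follows by moving along a path in `P`. -/
theorem IsPolyomino.nice (h : IsPolyomino P) : Nice P := by
  refine ⟨fun x y h1 h2 => ?_, fun x y h1 h2 => ?_, fun a b c d h0 h1 h2 x y hxy => ?_⟩
  · obtain ⟨⟨u, v⟩, hr, h3, h4⟩ := h.diagonal _ h1 _ h2 (by constructor <;> simp)
    rw [grid_adj_iff] at h3 h4
    have : (u = x ∧ v = y) ∨ (u = x + 1 ∧ v = y + 1) := by omega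
    rcases this with ⟨rfl, rfl⟩ | ⟨rfl, rfl⟩
    · exact Or.inl hr
    · exact Or.inr hr
  · obtain ⟨⟨u, v⟩, hr, h3, h4⟩ := h.diagonal _ h1 _ h2 (by constructor <;> simp)
    rw [grid_adj_iff] at h3 h4
    have : (u = x + 1 ∧ v = y) ∨ (u = x ∧ v = y + 1) := by omega
    rcases this with ⟨rfl, rfl⟩ | ⟨rfl, rfl⟩
    · exact Or.inl hr
    · exact Or.inr hr
  · obtain ⟨x', y', h3, h4⟩ := h0
    obtain ⟨W⟩ := h.connected.preconnected ⟨(x', y'), h3⟩ ⟨(x, y), hxy⟩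
    -- A step of the path that leaves the rectangle would end at a tile next to one of its sides.
    suffices hs : ∀ p q : (P : Set Pixel), (grid.induce (P : Set Pixel)).Walk p q →
        (a ≤ p.1.1 ∧ p.1.1 ≤ b ∧ c ≤ p.1.2 ∧ p.1.2 ≤ d) →
          a ≤ q.1.1 ∧ q.1.1 ≤ b ∧ c ≤ q.1.2 ∧ q.1.2 ≤ d from hs _ _ W h4
    intro p q W
    induction W with
    | nil => exact id
    | @cons p r q hpr _ ih =>
      intro hp
      apply ih
      obtain ⟨⟨px, py⟩, hpP⟩ := p
      obtain ⟨⟨rx, ry⟩, hrP⟩ := r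
      simp only [SimpleGraph.comap_adj, Function.Embedding.subtype_apply] at hpr
      simp only at hp ⊢
      have h5 := h1 py hp.2.2.1 hp.2.2.2
      have h6 := h2 px hp.1 hp.2.1
      by_contra hr
      rcases grid_adj_iff.1 hpr with ⟨rfl, rfl⟩ | ⟨rfl, rfl⟩ | ⟨rfl, rfl⟩ | ⟨rfl, rfl⟩
      · exact h5.1 (by rwa [show b + 1 = px + 1 by omega])
      · exact h5.2 (by rwa [show a - 1 = px - 1 by omega])
      · exact h6.1 (by rwa [show d + 1 = py + 1 by omega])
      · exact h6.2 (by rwa [show c - 1 = py - 1 by omega])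

theorem exists_isBound (hP : P.Nonempty) : ∃ B : Box, B.IsBound P := by
  obtain ⟨l, hl, hl'⟩ := P.exists_min_image Prod.fst hP
  obtain ⟨r, hr, hr'⟩ := P.exists_max_image Prod.fst hP
  obtain ⟨u, hu, hu'⟩ := P.exists_min_image Prod.snd hP
  obtain ⟨o, ho, ho'⟩ := P.exists_max_image Prod.snd hP
  exact ⟨⟨l.1, r.1, u.2, o.2⟩, fun x y h => ⟨hl' _ h, hr' _ h, hu' _ h, ho' _ h⟩, ⟨_, hl⟩, ⟨_, hr⟩,
    ⟨_, hu⟩, ⟨_, ho⟩⟩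

namespace Box

/-- The pixels of the rectangle. -/
def cells (B : Box) : Set Pixel := Set.Icc B.x0 B.x1 ×ˢ Set.Icc B.y0 B.y1

theorem IsBound.columns_eq {B : Box} (h : B.IsBound P) : columns P = Set.Icc B.x0 B.x1 := by
  ext x
  obtain ⟨l, hl⟩ := h.left
  obtain ⟨r, hr⟩ := h.right
  constructor
  · rintro ⟨p, hp, q, hq, h1, h2⟩
    have h3 := h.mem p.1 p.2 hp
    have h4 := h.mem q.1 q.2 hq
    exact ⟨by omega, by omega⟩
  · rintro ⟨h1, h2⟩
    exact ⟨_, hl, _, hr, h1, h2⟩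

theorem IsBound.rows_eq {B : Box} (h : B.IsBound P) : rows P = Set.Icc B.y0 B.y1 := by
  ext x
  obtain ⟨l, hl⟩ := h.bot
  obtain ⟨r, hr⟩ := h.top
  constructor
  · rintro ⟨p, hp, q, hq, h1, h2⟩
    have h3 := h.mem p.1 p.2 hp
    have h4 := h.mem q.1 q.2 hq
    exact ⟨by omega, by omega⟩
  · rintro ⟨h1, h2⟩
    exact ⟨_, hl, _, hr, h1, h2⟩

theorem IsBound.width_eq {B : Box} (h : B.IsBound P) : width P = B.w := by
  rw [width, h.columns_eq, ← Finset.coe_Icc, Set.ncard_coe_finset, Int.card_Icc, w]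
  congr 1
  ring

theorem IsBound.height_eq {B : Box} (h : B.IsBound P) : height P = B.h := by
  rw [height, h.rows_eq, ← Finset.coe_Icc, Set.ncard_coe_finset, Int.card_Icc, Box.h]
  congr 1
  ring

theorem IsBound.boundingBox_eq {B : Box} (h : B.IsBound P) : boundingBox P = B.cells := by
  rw [boundingBox, h.columns_eq, h.rows_eq, cells]

theorem IsBound.pos {B : Box} (h : B.IsBound P) : 1 ≤ B.w ∧ 1 ≤ B.h := by
  obtain ⟨y, hy⟩ := h.left
  have := h.mem _ _ hy
  simp only [w, Box.h]
  omega

end Box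

/-! ### The space that the robot needs -/

/-- A bound for the number of pixels in a region outside the bounding box. -/
def excess (w h : ℕ) : ℕ := (max w h - min w h) * min w h + 700 * (w + h)

theorem excess_comm (w h : ℕ) : excess w h = excess h w := by
  rw [excess, excess, max_comm, min_comm, add_comm w]

/-- The region is an L-shape of two arms of thickness about `min w h`. The bounding box fills one
arm, and the rest consists of strips of constant width and the end of the other arm, of length about
`|w - h|`. -/
theorem exists_cover {w h : ℕ} (hw : 1 ≤ w) (hh : 1 ≤ h) :
    ∃ S : Finset Pixel, S.card ≤ excess w h ∧ ∀ p ∈ region w h,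
      p ∈ S ∨ (0 ≤ p.1 ∧ p.1 < w ∧ 0 ≤ p.2 ∧ p.2 < h) := by
  wlog hhw : h ≤ w generalizing w h
  · obtain ⟨S, hS, h1⟩ := this hh hw (by omega)
    refine ⟨S.map (Equiv.prodComm ℤ ℤ).toEmbedding, by rwa [Finset.card_map, excess_comm],
      fun p hp => ?_⟩
    rcases h1 p.swap (by
      simp only [region, Set.mem_ofPred_eq, Prod.fst_swap, Prod.snd_swap] at hp ⊢
      omega) with h2 | h2
    · left
      rw [mem_map_perm]
      exact h2
    · right
      simp only [Prod.fst_swap, Prod.snd_swap] at h2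
      omega
  obtain ⟨d, rfl⟩ := Nat.exists_eq_add_of_le hhw
  -- Strips at the left, at the bottom and at the right, the vertical arm above height `h`, and a
  -- strip on top of the box. Only the arm, with `(h + 13) * (d + 13)` pixels, is not linear in `w +
  -- h`.
  refine ⟨(Finset.Icc (-12) (-1) ×ˢ Finset.Icc (-12) (h + d + 12 : ℤ)) ∪
    ((Finset.Icc (-12) (h + d + 12 : ℤ) ×ˢ Finset.Icc (-12) (-1)) ∪
    ((Finset.Icc (h + d : ℤ) (h + d + 12) ×ˢ Finset.Icc 0 (h + 12 : ℤ)) ∪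
    ((Finset.Icc 0 (h + 12 : ℤ) ×ˢ Finset.Icc (h : ℤ) (h + d + 12)) ∪
      (Finset.Icc 0 (h + d + 12 : ℤ) ×ˢ Finset.Icc (h : ℤ) (h + 12))))), ?_, ?_⟩
  · refine (Finset.card_union_le _ _).trans (Nat.add_le_add_left ((Finset.card_union_le _ _).trans
      (Nat.add_le_add_left ((Finset.card_union_le _ _).trans (Nat.add_le_add_left
        (Finset.card_union_le _ _) _)) _)) _ |>.trans ?_)
    simp only [Finset.card_product, Int.card_Icc, excess, max_eq_left hhw, min_eq_right hhw,
      Nat.add_sub_cancel_left]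
    rw [show (-1 + 1 - -12 : ℤ).toNat = 12 by rfl,
      show (h + d + 12 + 1 - -12 : ℤ).toNat = h + d + 25 by omega,
      show (h + d + 12 + 1 - (h + d) : ℤ).toNat = 13 by omega,
      show (h + 12 + 1 - 0 : ℤ).toNat = h + 13 by omega,
      show (h + d + 12 + 1 - h : ℤ).toNat = d + 13 by omega,
      show (h + d + 12 + 1 - 0 : ℤ).toNat = h + d + 13 by omega,
      show (h + 12 + 1 - h : ℤ).toNat = 13 by omega,
      show (h + 13) * (d + 13) = d * h + 13 * h + 13 * d + 169 by ring]
    omega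
  · rintro ⟨a, b⟩ hp
    simp only [region, Set.mem_ofPred_eq, Nat.cast_add] at hp
    simp only [Finset.mem_union, Finset.mem_product, Finset.mem_Icc, Nat.cast_add]
    omega

theorem rotL_pow_four : rotL ^ 4 = 1 := by
  ext p <;> simp [pow_succ, rotL]

theorem Box.turn_turn (B : Box) : B.turn.turn.turn.turn = B := by
  simp [Box.turn]

/-- The set of pixels that the robot can visit. -/
def Box.reach (B : Box) : Set Pixel :=
  {p | ∃ j : Fin 4, ∃ q ∈ (Box.turn^[j] B).region, (rotL ^ j.val) q = p}

/-- The frame in which the search ends depends on `P`; since four quarter turns are the identity,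
four regions suffice. -/
theorem Box.covers_reach (B : Box) : B.Covers B.reach := by
  intro j p hp
  refine ⟨⟨j % 4, Nat.mod_lt _ (by norm_num)⟩, p, ?_, ?_⟩
  · rw [← Nat.mod_add_div j 4, Function.iterate_add_apply, Function.iterate_mul,
      show Box.turn^[4] = id from funext Box.turn_turn, Function.iterate_id] at hp
    exact hp
  · conv_rhs => rw [← Nat.mod_add_div j 4, pow_add, pow_mul, rotL_pow_four, one_pow, mul_one]

theorem Box.mem_cells_turn {B : Box} {p : Pixel} : rotL p ∈ B.cells ↔ p ∈ B.turn.cells := by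
  obtain ⟨x, y⟩ := p
  simp only [cells, rotL, Box.turn, Equiv.coe_fn_mk, Set.mem_prod, Set.mem_Icc]
  omega

theorem Box.exists_cover_region {B : Box} (hw : 1 ≤ B.w) (hh : 1 ≤ B.h) :
    ∃ S : Finset Pixel, S.card ≤ excess B.w B.h ∧ ∀ p ∈ B.region, p ∈ S ∨ p ∈ B.cells := by
  obtain ⟨S, hS, h⟩ := exists_cover hw hh
  refine ⟨S.map (shift (B.x0, B.y0)).toEmbedding, by rwa [Finset.card_map], fun p hp => ?_⟩
  rcases h _ hp with h1 | h1
  · left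
    rw [mem_map_perm]
    exact h1
  · right
    simp only [Box.w, Box.h] at h1 hw hh
    simp only [Box.cells, Set.mem_prod, Set.mem_Icc]
    omega

theorem Box.exists_cover_turn {B : Box} (hw : 1 ≤ B.w) (hh : 1 ≤ B.h) (j : ℕ) :
    ∃ S : Finset Pixel, S.card ≤ excess B.w B.h ∧ ∀ p ∈ (Box.turn^[j] B).region,
      (rotL ^ j) p ∈ S ∨ (rotL ^ j) p ∈ B.cells := by
  induction j generalizing B with
  | zero => exact Box.exists_cover_region hw hh
  | succ j ih =>
    obtain ⟨S, hS, h⟩ := ih (B := B.turn) (by rwa [B.w_turn]) (by rwa [B.h_turn])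
    refine ⟨S.map rotL.toEmbedding, ?_, fun p hp => ?_⟩
    · rwa [Finset.card_map, excess_comm, ← B.w_turn, ← B.h_turn]
    · rw [pow_succ', Perm.mul_apply, Box.mem_cells_turn]
      refine (h p hp).imp (fun h => ?_) id
      rwa [mem_map_perm, Equiv.symm_apply_apply]

theorem Box.exists_cover_reach {B : Box} (hw : 1 ≤ B.w) (hh : 1 ≤ B.h) :
    ∃ S : Finset Pixel, S.card ≤ 4 * excess B.w B.h ∧ ∀ p ∈ B.reach, p ∈ S ∨ p ∈ B.cells := by
  choose S hS h using fun j => Box.exists_cover_turn hw hh (B := B) j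
  refine ⟨Finset.univ.biUnion fun j : Fin 4 => S j, ?_, ?_⟩
  · exact Finset.card_biUnion_le_card_mul Finset.univ (fun j : Fin 4 => S j) _ fun j _ => hS j
  · rintro _ ⟨j, q, hq, rfl⟩
    exact (h j q hq).imp_left fun h => Finset.mem_biUnion.2 ⟨j, Finset.mem_univ _, h⟩

/-! ### Reflection -/

/-- The reflection at the vertical axis, on directions. -/
def flip : Perm Dir := Equiv.swap .left .right

/-- The reflection at the vertical axis. -/
def reflect : Perm Pixel := (Equiv.neg ℤ).prodCongr (Equiv.refl ℤ)

theorem isSymmetry_reflect : IsSymmetry flip reflect := by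
  rintro d ⟨x, y⟩
  cases d <;> ext <;> simp [Dir.move, reflect, flip, Equiv.swap_apply_def] <;> ring

theorem mem_map_reflect {x y : ℤ} : (x, y) ∈ P.map reflect⁻¹.toEmbedding ↔ (-x, y) ∈ P := by
  rw [mem_map_perm]
  rfl

theorem Nice.reflect (h : Nice P) : Nice (P.map reflect⁻¹.toEmbedding) := by
  refine ⟨fun x y h1 h2 => ?_, fun x y h1 h2 => ?_, fun a b c d h0 h1 h2 x y hxy => ?_⟩
  · rw [mem_map_reflect] at *
    have := h.diag' (-(x + 1)) y h1 (by rwa [show -(x + 1) + 1 = -x by ring])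
    rwa [show -(x + 1) + 1 = -x by ring, mem_map_reflect] at *
  · rw [mem_map_reflect] at *
    have := h.diag (-(x + 1)) y (by rwa [show -(x + 1) + 1 = -x by ring]) h2
    rw [show -(x + 1) + 1 = -x by ring] at this
    rwa [mem_map_reflect]
  · obtain ⟨x', y', h3, h4⟩ := h0
    have := h.closed (-b) (-a) c d ⟨-x', y', mem_map_reflect.1 h3, by omega⟩
      (fun y hy hy' => by
        have := h1 y hy hy'
        rw [mem_map_reflect, mem_map_reflect] at this
        rwa [show -a + 1 = -(a - 1) by ring, show -b - 1 = -(b + 1) by ring, and_comm])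
      (fun x hx hx' => by
        have := h2 (-x) (by omega) (by omega)
        rwa [mem_map_reflect, mem_map_reflect, neg_neg] at this) (-x) y (mem_map_reflect.1 hxy)
    omega

theorem Box.IsBound.reflect {B : Box} (h : B.IsBound P) :
    (⟨-B.x1, -B.x0, B.y0, B.y1⟩ : Box).IsBound (P.map reflect⁻¹.toEmbedding) := by
  obtain ⟨h0, ⟨y, h1⟩, ⟨y', h2⟩, ⟨x, h3⟩, ⟨x', h4⟩⟩ := h
  refine ⟨fun x y hxy => ?_, ⟨y', ?_⟩, ⟨y, ?_⟩, ⟨-x, ?_⟩, ⟨-x', ?_⟩⟩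
  · have := h0 _ _ (mem_map_reflect.1 hxy)
    simp only
    omega
  all_goals exact mem_map_reflect.2 (by simpa)

/-! ### The robot -/

/-- The run from the actual start is the image under `E` of a run in the standard frame on the
preimage of `P`. By `hρ`, the image of the clockwise rotation is `ρ`, up to translation. -/
theorem toRobot_rotates {g : Perm Dir} {E : Perm Pixel} {ρ : Pixel → Pixel} (hE : IsSymmetry g E)
    (hρ : ∀ v, ∃ v', ∀ p, E (rotateCW p + v) = ρ (E p) + v') {B B' : Box}
    (m : Bits × Bits × Bits × Bits) (hP : Nice (P.map E⁻¹.toEmbedding)) (hB : B.IsBound P)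
    (hB' : B'.IsBound (P.map E⁻¹.toEmbedding)) (hw : B'.w = B.w) (hh : B'.h = B.h)
    (hc : ∀ p ∈ B'.cells, E p ∈ B.cells) {s : Pixel} (hs : s ∈ P) :
    ∃ n : ℕ, (toRobot body g (init 0 m)).TerminatesAt P s n ∧
      (∃ v : Pixel, ((toRobot body g (init 0 m)).run P s n).tiles = P.image fun p => ρ p + v) ∧
      n ≤ 3000 * ((B.w + B.h) * (B.w * B.h)) ∧
      (toRobot body g (init 0 m)).additionalSpace P s n ≤ 4 * excess B.w B.h ∧
      (toRobot body g (init 0 m)).auxiliaryTiles P s n ≤ 3000 * (B.w + B.h) := by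
  set R := toRobot body g (init 0 m) with hR
  have hpos := hB.pos
  have hs' : ((E⁻¹ s).1, (E⁻¹ s).2) ∈ P.map E⁻¹.toEmbedding := by
    rw [mem_map_perm]
    exact (E.apply_symm_apply s).symm ▸ hs
  have h1 := rotate_init 3 (m := m) (k := 0) (V := B'.reach) (K := P.card + 10 * (B.w + B.h) + 200)
    rfl hP hB' B'.covers_reach hs' (T := P.map E⁻¹.toEmbedding)
    ⟨fun _ _ => Iff.rfl, by simp [restMarks]⟩ (by rw [hw, hh])
    (by rw [Finset.card_map]) le_rfl
  have h2 := h1.map hE (V' := E '' B'.reach) (fun p hp => ⟨p, hp, rfl⟩) fun c hc =>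
    Rotated.map (P := P) (V := E '' B'.reach) (g := g) hρ
      (by rwa [Set.preimage_image_eq _ E.injective])
  have e : (cfg body (goto (init 0 m)) (P.map E⁻¹.toEmbedding) ((E⁻¹ s).1, (E⁻¹ s).2)).map g E
      = ⟨g, body (init 0 m), P, s⟩ := by
    ext1
    · simp [Cfg.map, cfg, resolve]
    · rfl
    · simp only [Cfg.map, cfg]
      ext r
      rw [mem_map_perm, mem_map_perm]
      exact Eq.to_iff (congrArg (· ∈ P) (E.apply_symm_apply r))
    · simp [Cfg.map, cfg]
  rw [e, hw, hh] at h2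
  obtain ⟨n, hn, ⟨hhalt, hV, v, hv⟩, hi⟩ := h2.exists_iterate
  simp only [← ofConfig_run body g (init 0 m) P s] at hhalt hV hv hi
  have hvis : ∀ i ≤ n, (R.run P s i).pos ∈ E '' B'.reach := fun i hin => by
    rcases hin.lt_or_eq with h | rfl
    · exact (hi i h).2.1
    · exact hV
  refine ⟨n, ⟨hhalt, fun i h => (hi i h).1⟩, ⟨v, hv⟩, ?_, ?_, ?_⟩
  · refine hn.trans ?_
    have h3 : B.w + B.h ≤ (B.w + B.h) * (B.w * B.h) :=
      Nat.le_mul_of_pos_right _ (Nat.mul_pos hpos.1 hpos.2)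
    -- The search costs a multiple of `(w + h) ^ 2`, which is absorbed because `w + h ≤ 2 * (w *
    -- h)`.
    have h4 : (B.w + B.h) * (B.w + B.h) ≤ 2 * ((B.w + B.h) * (B.w * B.h)) := by
      rw [mul_left_comm]
      refine Nat.mul_le_mul_left _ ?_
      have h5 := Nat.le_mul_of_pos_right B.w hpos.2
      have h6 := Nat.le_mul_of_pos_left B.h hpos.1
      omega
    generalize (B.w + B.h) * (B.w * B.h) = X at *
    rw [show (9 * (B.w + B.h) + 7) * (5 * (B.w + B.h) + 20)
      = 45 * ((B.w + B.h) * (B.w + B.h)) + 215 * (B.w + B.h) + 140 by ring]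
    omega
  · obtain ⟨S, hS, hS'⟩ := Box.exists_cover_reach (B := B') (by omega) (by omega)
    rw [hw, hh] at hS
    refine le_trans ?_ hS
    rw [← Finset.card_map E.toEmbedding, ← Set.ncard_coe_finset, Robot.additionalSpace]
    refine Set.ncard_le_ncard ?_ (Finset.finite_toSet _)
    rintro p ⟨hp, hp'⟩
    simp only [Robot.visited, Finset.coe_image, Set.mem_image, Finset.mem_coe,
      Finset.mem_range] at hp
    obtain ⟨i, hin, rfl⟩ := hp
    obtain ⟨q, hq, hq'⟩ := hvis i (by omega)
    rw [← hq'] at hp' ⊢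
    rcases hS' q hq with h | h
    · simpa using h
    · rw [hB.boundingBox_eq] at hp'
      exact absurd (hc q h) hp'
  · rw [Robot.auxiliaryTiles, Nat.sub_le_iff_le_add]
    refine Finset.sup_le fun i hin => ?_
    rcases (Nat.lt_succ_iff.1 (Finset.mem_range.1 hin)).lt_or_eq with h | rfl
    · refine (hi i h).2.2.trans ?_
      omega
    -- At the final time the bound comes from the result itself, which is an image of `P`.
    · have : (R.run P s i).tiles.card ≤ P.card := by
        change (ofConfig body (R.run P s i)).tiles.card ≤ _
        rw [hv]
        exact Finset.card_image_le
      omega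

/-- The symmetric bound with `min w h` is stronger than the one with `h`; the constant `3000`
exceeds `4 * 700`. -/
theorem excess_le (w h : ℕ) : ((4 * excess w h : ℕ) : ℤ) ≤
    (3000 : ℕ) * (|(w : ℤ) - h| * h + w + h) := by
  have h1 : ((max w h - min w h : ℕ) : ℤ) = |(w : ℤ) - h| := by
    rcases abs_cases ((w : ℤ) - h) with ⟨h2, h3⟩ | ⟨h2, h3⟩ <;> omega
  have h2 : |(w : ℤ) - h| * (min w h : ℕ) ≤ |(w : ℤ) - h| * h :=
    mul_le_mul_of_nonneg_left (by omega) (abs_nonneg _)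
  have h3 : 0 ≤ |(w : ℤ) - h| * h := mul_nonneg (abs_nonneg _) (by omega)
  rw [excess]
  push_cast at h1 h2 ⊢
  rw [h1]
  generalize |(w : ℤ) - h| * h = X at *
  linarith

end TileRobot

theorem mainTheorem6 (ρ : TileRobot.Pixel → TileRobot.Pixel)
    (hρ : ρ = TileRobot.rotateCW ∨ ρ = TileRobot.rotateCCW) :
    ∃ (R : TileRobot.Robot) (C : ℕ),
      ∀ P : Finset TileRobot.Pixel, TileRobot.IsPolyomino P → ∀ s ∈ P,
        ∃ n : ℕ, R.TerminatesAt P s n ∧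
          (∃ v : TileRobot.Pixel, (R.run P s n).tiles = P.image fun p => ρ p + v) ∧
          n ≤ C * ((TileRobot.width P + TileRobot.height P) *
            (TileRobot.width P * TileRobot.height P)) ∧
          (R.additionalSpace P s n : ℤ) ≤
            C * (|(TileRobot.width P : ℤ) - TileRobot.height P| * TileRobot.height P
              + TileRobot.width P + TileRobot.height P) ∧
          R.auxiliaryTiles P s n ≤ C * (TileRobot.width P + TileRobot.height P) := by
  open TileRobot in
  -- One program serves both rotations; only the initial frame of the robot differs.
  suffices h : ∃ (g : Equiv.Perm Dir) (E : Equiv.Perm Pixel), IsSymmetry g E ∧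
      (∀ v, ∃ v', ∀ p, E (rotateCW p + v) = ρ (E p) + v') ∧ ∀ (P : Finset Pixel) (B : Box),
        Nice P → B.IsBound P → Nice (P.map E⁻¹.toEmbedding) ∧
          ∃ B' : Box, B'.IsBound (P.map E⁻¹.toEmbedding) ∧ B'.w = B.w ∧ B'.h = B.h ∧
            ∀ p ∈ B'.cells, E p ∈ B.cells by
    obtain ⟨g, E, hE, hρ, h⟩ := h
    -- The initial memory is arbitrary: setting the four marks replaces all of it before any of it
    -- is used.
    refine ⟨toRobot Label.body g (Label.init 0 default), 3000, fun P hP s hs => ?_⟩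
    obtain ⟨B, hB⟩ := exists_isBound hP.nonempty
    obtain ⟨hP', B', hB', hw, hh, hc⟩ := h P B hP.nice hB
    obtain ⟨n, h1, h2, h3, h4, h5⟩ := toRobot_rotates hE hρ default hP' hB hB' hw hh hc hs
    rw [hB.width_eq, hB.height_eq]
    exact ⟨n, h1, h2, h3, (Nat.cast_le.2 h4).trans (excess_le _ _), h5⟩
  rcases hρ with rfl | rfl
  · refine ⟨1, 1, fun d p => rfl, fun v => ⟨v, fun p => rfl⟩, fun P B hP hB => ?_⟩
    have e : P.map (1 : Equiv.Perm TileRobot.Pixel)⁻¹.toEmbedding = P := by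
      ext p
      exact TileRobot.mem_map_perm
    rw [e]
    exact ⟨hP, B, hB, rfl, rfl, fun p hp => hp⟩
  -- Conjugation by a reflection turns the clockwise rotation into the counter-clockwise one.
  · refine ⟨TileRobot.flip, TileRobot.reflect, TileRobot.isSymmetry_reflect,
      fun v => ⟨TileRobot.reflect v, fun p => ?_⟩,
      fun P B hP hB => ⟨hP.reflect, _, hB.reflect, ?_, ?_, ?_⟩⟩
    · ext <;> simp [TileRobot.reflect, TileRobot.rotateCW, TileRobot.rotateCCW]; ring
    · simp only [TileRobot.Box.w]
      congr 1
      ring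
    · rfl
    · rintro ⟨x, y⟩
      simp only [TileRobot.Box.cells, TileRobot.reflect, Set.mem_prod, Set.mem_Icc,
        Equiv.prodCongr_apply, Prod.map_apply, Equiv.neg_apply, Equiv.refl_apply]
      omega
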